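/- A \emph{knot} is a subset of $\mathbb{R}^3$ that is the image of a topological embedding of the circle, and a \emph{knot type} is an equivalence class of knots under ambient isotopy of $\mathbb{R}^3$; it is non-trivial if it is not the type of a round circle. The cubic lattice is $\mathbb{Z}^3$, and the simple hexagonal lattice is $\{ax+by+cw : a,b,c\in\mathbb{Z}\}$ with $x=(1,0,0)$, $y=(\tfrac12,\tfrac{\sqrt3}{2},0)$, $w=(0,0,1)$. A \emph{polygon} in one of these lattices is a non-self-intersecting closed polygon composed of finitely many \emph{edges}, that is, segments of length $1$ between two points of the lattice (so edges are parallel to the coordinate axes in the cubic lattice, and to $x$, $y$, $z=y-x$ or $w$ in the simple hexagonal lattice). For a knot type $[K]$ let $e_L[K]$ and $e_{sh}[K]$ be the least number of edges of a polygon of knot type $[K]$ in the cubic lattice and in the simple hexagonal lattice, respectively (with value $+\infty$ if there is no such polygon, which happens only for wild knots). Proposition. For every non-trivial knot type $[K]$, $$e_{sh}[K]\;\ge\;\frac{3\,e_L[K]+30}{8}.$$ -/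

import Mathlib

open scoped ENNReal

noncomputable section

/-- Three-dimensional Euclidean space. -/
abbrev Space : Type := EuclideanSpace ℝ (Fin 3)

/-- A subset of space is a knot if it is the image of a topological embedding of the circle. -/
def IsKnot (S : Set Space) : Prop :=
  ∃ f : Circle → Space, Topology.IsEmbedding f ∧ Set.range f = S

/-- Two subsets of space are ambient isotopic if a continuous family `H t`, `0 ≤ t ≤ 1`, of
self-homeomorphisms of space starts at the identity and ends at a homeomorphism that carries
the first subset onto the second. -/
def AmbientIsotopic (A B : Set Space) : Prop :=
  ∃ H : unitInterval → (Space ≃ₜ Space),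
    Continuous (fun q : unitInterval × Space => H q.1 q.2) ∧
      (∀ p, H 0 p = p) ∧ H 1 '' A = B

theorem AmbientIsotopic.refl (A : Set Space) : AmbientIsotopic A A :=
  ⟨fun _ => Homeomorph.refl Space, continuous_snd, fun _ => rfl, by simp⟩

theorem AmbientIsotopic.symm {A B : Set Space} (h : AmbientIsotopic A B) :
    AmbientIsotopic B A := by
  obtain ⟨H, hc, h0, h1⟩ := h
  refine ⟨fun t => (H 1).symm.trans (H (unitInterval.symm t)), ?_, fun p => ?_, ?_⟩
  · exact hc.comp (((unitInterval.continuous_symm).comp continuous_fst).prodMk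
      ((H 1).symm.continuous.comp continuous_snd))
  · simp
  · subst h1
    ext p
    simp [h0]

theorem AmbientIsotopic.trans {A B C : Set Space} (h : AmbientIsotopic A B)
    (h' : AmbientIsotopic B C) : AmbientIsotopic A C := by
  obtain ⟨H, hc, h0, h1⟩ := h
  obtain ⟨G, gc, g0, g1⟩ := h'
  refine ⟨fun t => (H t).trans (G t), gc.comp (continuous_fst.prodMk hc), fun p => ?_, ?_⟩
  · simp [h0, g0]
  · subst h1 g1
    ext p
    simp

/-- Knots, up to ambient isotopy. -/
instance knotSetoid : Setoid {S : Set Space // IsKnot S} where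
  r J K := AmbientIsotopic J.1 K.1
  iseqv := ⟨fun J => AmbientIsotopic.refl J.1, fun h => h.symm, fun h h' => h.trans h'⟩

/-- A knot type is an ambient isotopy class of knots. -/
def KnotType : Type := Quotient knotSetoid

/-- The subset `S` of space is a knot of type `K`. -/
def KnotType.Contains (K : KnotType) (S : Set Space) : Prop :=
  ∃ h : IsKnot S, (Quotient.mk knotSetoid ⟨S, h⟩ : KnotType) = K

/-- The round unit circle in the horizontal coordinate plane. -/
def roundCircle : Set Space := Set.range fun z : Circle => !₂[(z : ℂ).re, (z : ℂ).im, 0]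

theorem isKnot_roundCircle : IsKnot roundCircle := by
  refine ⟨_, Topology.IsClosedEmbedding.isEmbedding
    (Continuous.isClosedEmbedding (f := fun z : Circle => (!₂[(z : ℂ).re, (z : ℂ).im, 0] : Space))
      ?_ ?_), rfl⟩
  · refine (PiLp.continuous_toLp 2 _).comp (continuous_pi fun i => ?_)
    fin_cases i
    · exact Complex.continuous_re.comp continuous_subtype_val
    · exact Complex.continuous_im.comp continuous_subtype_val
    · exact continuous_const
  · intro z z' h
    apply Circle.ext
    apply Complex.ext
    · simpa using congrArg (fun p : Space => p 0) h
    · simpa using congrArg (fun p : Space => p 1) h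

/-- The trivial knot type. -/
def KnotType.unknot : KnotType := Quotient.mk knotSetoid ⟨roundCircle, isKnot_roundCircle⟩

/-- The points of the cubic lattice: all coordinates are integers. -/
def cubicLattice : Set Space := {p | ∀ i, ∃ m : ℤ, p i = m}

/-- The points of the simple hexagonal lattice: the integral linear combinations of
`x = (1, 0, 0)`, `y = (1/2, √3/2, 0)` and `w = (0, 0, 1)`. -/
def shLattice : Set Space :=
  {p | ∃ a b c : ℤ,
    p = (a : ℝ) • !₂[(1 : ℝ), 0, 0] + (b : ℝ) • !₂[(1 / 2 : ℝ), √3 / 2, 0]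
      + (c : ℝ) • !₂[(0 : ℝ), 0, 1]}

/-- A non-intersecting closed polygon in the lattice with point set `L`, cut into its edges: a
cyclic sequence of at least three distinct lattice points, consecutive ones at distance one.
In the cubic lattice the unit lattice vectors are the six coordinate directions; in the simple
hexagonal lattice they are `±x, ±y, ±z, ±w` with `z = y - x`. In both lattices two different
unit segments between lattice points meet at most in a common endpoint, so that distinctness of
the vertices says that the polygon does not intersect itself. -/
structure LatticePolygon (L : Set Space) where
  /-- The number of edges, that is, the edge length of the polygon. -/
  numEdges : ℕ
  three_le : 3 ≤ numEdges
  /-- The lattice points on the polygon, in cyclic order. -/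
  vertex : ZMod numEdges → Space
  vertex_mem : ∀ i, vertex i ∈ L
  dist_eq_one : ∀ i, dist (vertex i) (vertex (i + 1)) = 1
  vertex_injective : Function.Injective vertex

/-- The polygon as a subset of space: the union of its edges. -/
def LatticePolygon.carrier {L : Set Space} (P : LatticePolygon L) : Set Space :=
  ⋃ i, segment ℝ (P.vertex i) (P.vertex (i + 1))

/-- The edge length of the knot type `K` in the lattice `L`: the least number of edges of a
polygon of type `K` in `L` (with value `⊤` if there is no such polygon, as for wild knots). -/
def KnotType.edgeLength (L : Set Space) (K : KnotType) : ℕ∞ :=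
  ⨅ (P : LatticePolygon L) (_ : K.Contains P.carrier), (P.numEdges : ℕ∞)

end

/-! A linear shear turns a polygon of the simple hexagonal lattice into a polygon in ℤ³ whose edges
are parallel to a coordinate axis or to the diagonal `(-1, 1, 0)`. This polygon is deformed into a
cubic one, and the edges are counted.

If two consecutive edges are sides of a lattice triangle, the third side can replace them, so acute
turns may be excluded (`IsLatPolygon.exists_noTurn`). Each diagonal edge can then be bent into a
staircase inside its unit cell: the sides of that cell make acute angles with the diagonal, hence do
not belong to the polygon. `fatEdge` is an edge together with the region swept out by its bending.
Different fat edges meet only in common ends, so the bending is an isotopy and its result is simple.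
Doubling the first two coordinates turns staircases into lattice paths, and edges in the directions
x, y, z, w become 2, 2, 4, 1 cubic edges. One column `k ≤ x ≤ k + 1` is left unstretched, which
saves one edge for every edge that crosses it.

If `c` of the `n` edges cross that column, and `n_z`, `n_w` edges have direction z, w, the cubic
polygon has `2n + 2n_z - n_w - c` edges. Rotations by sixty degrees permute x, y, z, so `3n_z ≤ n -
n_w` may be assumed. With `c ≥ 4` and `n_w ≥ 4` the length is at most `(8n - 32)/3`, slightly better
than required.

Nontriviality gives these two bounds. If a height function has at most two edges between any two
consecutive levels, the polygon can be peeled from the top down to a triangle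
(`IsBridgeHeight.ambientIsotopic_cone`), so it is trivial. The number of edges between two levels is
even, hence a nontrivial polygon has at least four somewhere. This is applied to the first and to
the third coordinate.

The isotopies are displacements along parallel lines, in particular the pushing of one side of a
triangle across it (`AmbientIsotopic.triangle_move`), and one radial isotopy from a standard
triangle to the circle. -/

section

open Set Filter Topology

/-! ### Isotopies along parallel lines -/

/-- The displacement `p ↦ p + h p • v` is a homeomorphism if `h` decreases along `v` with slope
less than one. -/
theorem exists_shear_homeomorph {h : Space → ℝ} (hc : Continuous h) {v : Space} {k : ℝ}
    (hk : k < 1) (hm : ∀ p s, 0 ≤ s → h p - k * s ≤ h (p + s • v)) :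
    ∃ F : Space ≃ₜ Space, ∀ p, F p = p + h p • v := by
  -- A preimage of `q` is `q - s • v` with `s = h (q - s • v)`. The difference of the two sides
  -- increases in `s` with slope at least `1 - k`: the intermediate value theorem gives existence,
  -- and monotonicity gives uniqueness.
  have mono : ∀ q s s', s ≤ s' →
      (1 - k) * (s' - s) ≤ (s' - h (q - s' • v)) - (s - h (q - s • v)) := by
    intro q s s' hs
    have := hm (q - s' • v) (s' - s) (by linarith)
    rw [show q - s' • v + (s' - s) • v = q - s • v by module] at this
    nlinarith
  have ex : ∀ q, ∃ s, s = h (q - s • v) := by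
    intro q
    have hcont : Continuous fun s : ℝ => s - h (q - s • v) := by fun_prop
    have hsurj := hcont.surjective (f := fun s : ℝ => s - h (q - s • v)) ?_ ?_
    · obtain ⟨s, hs⟩ := hsurj 0
      exact ⟨s, by simpa [sub_eq_zero] using hs⟩
    · have : Tendsto (fun s : ℝ => (1 - k) * s + (0 - h (q - (0 : ℝ) • v))) atTop atTop :=
        tendsto_atTop_add_const_right _ _ (tendsto_id.const_mul_atTop (by linarith))
      refine tendsto_atTop_mono' _ ?_ this
      filter_upwards [eventually_ge_atTop 0] with s hs
      have := mono q 0 s hs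
      linarith
    · have : Tendsto (fun s : ℝ => (1 - k) * s + (0 - h (q - (0 : ℝ) • v))) atBot atBot :=
        tendsto_atBot_add_const_right _ _ (tendsto_id.const_mul_atBot (by linarith))
      refine tendsto_atBot_mono' _ ?_ this
      filter_upwards [eventually_le_atBot 0] with s hs
      have := mono q s 0 hs
      linarith
  choose σ hσ using ex
  have uniq : ∀ q s, s = h (q - s • v) → s = σ q := by
    intro q s hs
    rcases le_total s (σ q) with hle | hle
    · have := mono q _ _ hle
      rw [← hs, ← hσ q] at this
      nlinarith
    · have := mono q _ _ hle
      rw [← hs, ← hσ q] at this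
      nlinarith
  have hσc : Continuous σ := by
    rw [continuous_iff_continuousAt]
    intro q
    -- The slope bound controls the distance to the root by the defect of the candidate `σ q`, and
    -- this defect vanishes at `q' = q`.
    have hb : ∀ q', |σ q' - σ q| ≤ |σ q - h (q' - σ q • v)| / (1 - k) := by
      intro q'
      rw [le_div_iff₀ (by linarith)]
      rcases le_total (σ q') (σ q) with hle | hle
      · have := mono q' _ _ hle
        rw [← hσ q'] at this
        rw [abs_of_nonpos (by linarith)]
        have h2 := le_abs_self (σ q - h (q' - σ q • v))
        nlinarith
      · have := mono q' _ _ hle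
        rw [← hσ q'] at this
        rw [abs_of_nonneg (by linarith)]
        have h2 := neg_abs_le (σ q - h (q' - σ q • v))
        nlinarith
    rw [ContinuousAt, tendsto_iff_dist_tendsto_zero]
    simp only [Real.dist_eq]
    refine squeeze_zero (fun _ => abs_nonneg _) hb ?_
    have : Continuous fun q' => |σ q - h (q' - σ q • v)| / (1 - k) := by fun_prop
    have h3 := this.tendsto q
    rw [← hσ q] at h3
    simpa using h3
  refine ⟨⟨⟨fun p => p + h p • v, fun q => q - σ q • v, ?_, ?_⟩, by fun_prop, by fun_prop⟩,
    fun p => rfl⟩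
  · intro p
    have : h p = σ (p + h p • v) := uniq _ _ (by simp)
    simp [← this]
  · intro q
    simp [← hσ q]

/-- Since `0 ≤ k`, the slope bound for `h` passes to `t * h` with `0 ≤ t ≤ 1`, so every intermediate
displacement is a homeomorphism. -/
theorem AmbientIsotopic.shear {h : Space → ℝ} (hc : Continuous h) {v : Space} {k : ℝ}
    (hk0 : 0 ≤ k) (hk : k < 1) (hm : ∀ p s, 0 ≤ s → h p - k * s ≤ h (p + s • v))
    (A : Set Space) : AmbientIsotopic A ((fun p => p + h p • v) '' A) := by
  have ex : ∀ t : unitInterval, ∃ F : Space ≃ₜ Space, ∀ p, F p = p + ((t : ℝ) * h p) • v := by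
    intro t
    refine exists_shear_homeomorph (h := fun p => (t : ℝ) * h p) (by fun_prop) hk ?_
    intro p s hs
    have h1 := mul_le_mul_of_nonneg_left (hm p s hs) t.2.1
    have h2 : (t : ℝ) * (k * s) ≤ k * s := mul_le_of_le_one_left (by positivity) t.2.2
    linarith
  choose H hH using ex
  refine ⟨H, ?_, fun p => by simp [hH], ?_⟩
  · simp only [hH]
    fun_prop
  · exact image_congr fun p _ => by simp [hH]

/-- Finite unions of segments. -/
def IsPolyhedral (R : Set Space) : Prop :=
  ∃ s : Finset (Space × Space), R = ⋃ x ∈ s, segment ℝ x.1 x.2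

theorem IsPolyhedral.segment (a b : Space) : IsPolyhedral (segment ℝ a b) :=
  ⟨{(a, b)}, by simp⟩

theorem IsPolyhedral.empty : IsPolyhedral ∅ :=
  ⟨∅, by simp⟩

theorem IsPolyhedral.union {R S : Set Space} (hR : IsPolyhedral R) (hS : IsPolyhedral S) :
    IsPolyhedral (R ∪ S) := by
  classical
  obtain ⟨s, rfl⟩ := hR
  obtain ⟨t, rfl⟩ := hS
  exact ⟨s ∪ t, by rw [Finset.set_biUnion_union]⟩

theorem IsPolyhedral.biUnion {ι : Type*} (s : Finset ι) {R : ι → Set Space}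
    (h : ∀ i ∈ s, IsPolyhedral (R i)) : IsPolyhedral (⋃ i ∈ s, R i) := by
  classical
  induction s using Finset.induction_on with
  | empty => simpa using IsPolyhedral.empty
  | insert a s _ ih =>
    rw [Finset.set_biUnion_insert]
    exact (h a (by simp)).union (ih fun i hi => h i (by simp [hi]))

/-! ### The triangle move -/

/-- The gauge of a bipyramid around the triangle with vertices `±e`, `b`, in terms of the
coordinates `U`, `S` in the plane of the triangle; the bipyramid shrinks to the triangle as `δ`
tends to zero. -/
noncomputable def bipyramidGauge (U S : Space →ₗ[ℝ] ℝ) (e b : Space) (δ : ℝ) (q : Space) : ℝ :=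
  |U q| + max (S q / (1 + δ)) (-S q / δ) + ‖q - U q • e - S q • b‖ / δ

section Bipyramid

variable {U S : Space →ₗ[ℝ] ℝ} {e b : Space} {δ : ℝ}

theorem bipyramidGauge_neg (q : Space) :
    bipyramidGauge (-U) S (-e) b δ q = bipyramidGauge U S e b δ q := by
  simp [bipyramidGauge]

theorem continuous_bipyramidGauge : Continuous (bipyramidGauge U S e b δ) := by
  have h1 : Continuous U := U.continuous_of_finiteDimensional
  have h2 : Continuous S := S.continuous_of_finiteDimensional
  unfold bipyramidGauge
  fun_prop

theorem bipyramidGauge_smul {l : ℝ} (hl : 0 ≤ l) (q : Space) :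
    bipyramidGauge U S e b δ (l • q) = l * bipyramidGauge U S e b δ q := by
  have h1 : l • q - (l * U q) • e - (l * S q) • b = l • (q - U q • e - S q • b) := by module
  have h2 : max (l * S q / (1 + δ)) (-(l * S q) / δ) = l * max (S q / (1 + δ)) (-S q / δ) := by
    rw [mul_max_of_nonneg _ _ hl]
    congr 1 <;> ring
  simp only [bipyramidGauge, map_smul, smul_eq_mul, h1, h2, norm_smul, abs_mul, Real.norm_eq_abs,
    abs_of_nonneg hl]
  ring

theorem bipyramidGauge_add_le (hδ : 0 < δ) (p q : Space) :
    bipyramidGauge U S e b δ (p + q)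
      ≤ bipyramidGauge U S e b δ p + bipyramidGauge U S e b δ q := by
  have h1 := abs_add_le (U p) (U q)
  have h2 : max ((S p + S q) / (1 + δ)) (-(S p + S q) / δ)
      ≤ max (S p / (1 + δ)) (-S p / δ) + max (S q / (1 + δ)) (-S q / δ) := by
    refine max_le ?_ ?_
    · rw [add_div]; exact add_le_add (le_max_left _ _) (le_max_left _ _)
    · rw [neg_add, add_div]; exact add_le_add (le_max_right _ _) (le_max_right _ _)
  have h3 : ‖p + q - (U p + U q) • e - (S p + S q) • b‖ / δ
      ≤ ‖p - U p • e - S p • b‖ / δ + ‖q - U q • e - S q • b‖ / δ := by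
    rw [← add_div]
    gcongr
    refine le_trans (le_of_eq ?_) (norm_add_le _ _)
    congr 1
    module
  simp only [bipyramidGauge, map_add]
  linarith

/-- The bipyramids are nested: a point outside the one for `δ'` stays outside for every smaller `δ`.
-/
theorem bipyramidGauge_antitone {δ' : ℝ} (hδ : 0 < δ) (h : δ ≤ δ') (q : Space) :
    bipyramidGauge U S e b δ' q ≤ bipyramidGauge U S e b δ q := by
  unfold bipyramidGauge
  have hδ' : 0 < δ' := hδ.trans_le h
  refine add_le_add (add_le_add le_rfl ?_) ?_
  · rcases le_total 0 (S q) with hS | hS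
    · refine max_le (le_max_of_le_left ?_) (le_max_of_le_left ?_)
      · gcongr
      · exact (div_nonpos_of_nonpos_of_nonneg (by linarith) hδ'.le).trans (by positivity)
    · have : 0 ≤ -S q := by linarith
      refine max_le (le_max_of_le_right ?_) (le_max_of_le_right ?_)
      · exact (div_nonpos_of_nonpos_of_nonneg hS (by positivity)).trans (by positivity)
      · gcongr
  · gcongr

theorem bipyramidGauge_vertex (hU : U e = 1) (hS : S e = 0) :
    bipyramidGauge U S e b δ (-e) = 1 := by
  simp [bipyramidGauge, hU, hS]

/-- The triangle contains the intersection of all the closed bipyramids. If the gauge is at most one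
for every `δ`, letting `δ` tend to zero leaves no component outside the plane and gives `0 ≤ S` and
`|U| + S ≤ 1`. -/
theorem exists_one_lt_bipyramidGauge {m q : Space}
    (hq : q ∉ convexHull ℝ {m - e, m + b, m + e}) :
    ∃ δ > 0, 1 < bipyramidGauge U S e b δ (q - m) := by
  by_contra! hcon
  apply hq
  set p := q - m with hp
  have h0 : ∀ δ > 0, 0 ≤ max (S p / (1 + δ)) (-S p / δ) := by
    intro δ hδ
    rcases le_total 0 (S p) with h | h
    · exact le_max_of_le_left (by positivity)
    · exact le_max_of_le_right (div_nonneg (by linarith) hδ.le)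
  have hr : ‖p - U p • e - S p • b‖ ≤ 0 := by
    refine le_of_forall_pos_le_add fun δ hδ => ?_
    have h1 := hcon δ hδ
    have h2 := h0 δ hδ
    unfold bipyramidGauge at h1
    have h3 : ‖p - U p • e - S p • b‖ / δ ≤ 1 := by linarith [abs_nonneg (U p)]
    rw [div_le_one hδ] at h3
    linarith
  have hS : 0 ≤ S p := by
    refine le_of_forall_pos_le_add fun δ hδ => ?_
    have h1 := hcon δ hδ
    unfold bipyramidGauge at h1
    have h2 := le_max_right (S p / (1 + δ)) (-S p / δ)
    have h4 : 0 ≤ ‖p - U p • e - S p • b‖ / δ := by positivity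
    have h3 : -S p / δ ≤ 1 := by linarith [abs_nonneg (U p)]
    rw [div_le_one hδ] at h3
    linarith
  have hU : |U p| + S p ≤ 1 := by
    refine le_of_forall_pos_le_add fun δ hδ => ?_
    have h1 := hcon δ hδ
    unfold bipyramidGauge at h1
    have h2 := le_max_left (S p / (1 + δ)) (-S p / δ)
    have h4 : 0 ≤ ‖p - U p • e - S p • b‖ / δ := by positivity
    have h5 : S p / (1 + δ) ≤ 1 - |U p| := by linarith
    rw [div_le_iff₀ (by linarith)] at h5
    nlinarith [abs_nonneg (U p)]
  have hpe : p = U p • e + S p • b := by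
    have := norm_le_zero_iff.1 hr
    rw [← sub_eq_zero, ← this]
    abel
  have hab := abs_le.1 (show |U p| ≤ 1 - S p by linarith)
  have hconv := convex_convexHull ℝ ({m - e, m + b, m + e} : Set Space)
  -- The weights are the barycentric coordinates of `U p • e + S p • b` with respect to `-e`, `b`,
  -- `e`.
  have key := hconv.sum_mem (t := Finset.univ)
    (w := ![(1 - S p - U p) / 2, S p, (1 - S p + U p) / 2]) (z := ![m - e, m + b, m + e])
    (by
      intro i _
      fin_cases i <;> simp <;> linarith)
    (by simp [Fin.sum_univ_three]; ring)
    (by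
      intro i _
      apply subset_convexHull
      fin_cases i <;> simp)
  simp only [Fin.sum_univ_three, Matrix.cons_val_zero, Matrix.cons_val_one,
    Matrix.cons_val] at key
  convert key using 1
  have hqm : q = m + (U p • e + S p • b) := by rw [← hpe, hp]; abel
  clear_value p
  rw [hqm]
  module

/-- Near each point of `K` one `δ` works by continuity, and all smaller ones do by nesting;
compactness makes the choice uniform. -/
theorem eventually_bipyramidGauge_of_disjoint {m : Space} {K : Set Space} (hK : IsCompact K)
    (hd : ∀ q ∈ K, q ∉ convexHull ℝ {m - e, m + b, m + e}) :
    ∀ᶠ δ in 𝓝[>] (0 : ℝ), ∀ q ∈ K, 1 ≤ bipyramidGauge U S e b δ (q - m) := by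
  refine hK.induction_on (p := fun K => ∀ᶠ δ in 𝓝[>] (0 : ℝ), ∀ q ∈ K,
    1 ≤ bipyramidGauge U S e b δ (q - m)) (by simp) ?_ ?_ fun q hq => ?_
  · exact fun s t hst h => h.mono fun δ hδ q hq => hδ q (hst hq)
  · intro s t hs ht
    filter_upwards [hs, ht] with δ h1 h2 q hq
    exact hq.elim (h1 q) (h2 q)
  obtain ⟨δ, hδ, h1⟩ := exists_one_lt_bipyramidGauge (U := U) (S := S) (hd q hq)
  have hcont : Continuous fun q => bipyramidGauge U S e b δ (q - m) :=
    continuous_bipyramidGauge.comp (continuous_id.sub continuous_const)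
  refine ⟨{z | 1 < bipyramidGauge U S e b δ (z - m)},
    mem_nhdsWithin_of_mem_nhds (hcont.continuousAt.eventually (lt_mem_nhds h1)), ?_⟩
  filter_upwards [Ioc_mem_nhdsGT hδ] with δ' hδ' z hz
  exact (le_of_lt hz).trans (bipyramidGauge_antitone hδ'.1 hδ'.2 _)

/-- The vertex lies on the boundary of every bipyramid, so compactness does not apply near it.
Instead, one point of the segment is moved outside, and the behaviour of the gauge along the segment
does the rest. -/
theorem eventually_bipyramidGauge_ray (hU : U e = 1) (hS : S e = 0) {m q : Space}
    (hd : ∀ z ∈ segment ℝ (m - e) q, z ∈ convexHull ℝ {m - e, m + b, m + e} → z = m - e) :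
    ∀ᶠ δ in 𝓝[>] (0 : ℝ), ∀ z ∈ segment ℝ (m - e) q,
      1 ≤ bipyramidGauge U S e b δ (z - m) := by
  have hv : ∀ δ, bipyramidGauge U S e b δ (m - e - m) = 1 := by
    intro δ
    rw [show m - e - m = -e by abel]
    exact bipyramidGauge_vertex hU hS
  by_cases hq : q = m - e
  · refine Eventually.of_forall fun δ z hz => ?_
    rw [hq, segment_same] at hz
    rw [hz, hv]
  -- The point `p` at parameter `τ` is so close to the vertex that `U (p - m) ≤ 0`; hence `|U|` is
  -- affine between the vertex and `p`.
  set τ : ℝ := 1 / (|U (q - (m - e))| + 1) with hτ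
  have hτ0 : 0 < τ := by positivity
  have hτ1 : τ ≤ 1 := by
    rw [hτ, div_le_one (by positivity)]
    linarith [abs_nonneg (U (q - (m - e)))]
  have hτU : τ * U (q - (m - e)) ≤ 1 := by
    rw [hτ, one_div, inv_mul_le_one₀ (by positivity)]
    linarith [le_abs_self (U (q - (m - e)))]
  obtain ⟨p, hp⟩ : ∃ p, p = m - e + τ • (q - (m - e)) := ⟨_, rfl⟩
  have hpT : p ∉ convexHull ℝ {m - e, m + b, m + e} := by
    intro h
    have := hd p (by rw [segment_eq_image']; exact ⟨τ, ⟨hτ0.le, hτ1⟩, hp.symm⟩) h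
    rw [hp, add_eq_left, smul_eq_zero, sub_eq_zero] at this
    exact this.elim hτ0.ne' hq
  have hUp : U (p - m) ≤ 0 := by
    rw [hp, show m - e + τ • (q - (m - e)) - m = -e + τ • (q - (m - e)) by module, map_add,
      map_smul, map_neg, hU, smul_eq_mul]
    linarith
  obtain ⟨δ, hδ, h1⟩ := exists_one_lt_bipyramidGauge (U := U) (S := S) hpT
  filter_upwards [Ioc_mem_nhdsGT hδ] with δ' hδ' z hz
  replace h1 : 1 ≤ bipyramidGauge U S e b δ' (p - m) :=
    (le_of_lt h1).trans (bipyramidGauge_antitone hδ'.1 hδ'.2 _)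
  rw [segment_eq_image'] at hz
  obtain ⟨σ, ⟨hσ0, hσ1⟩, rfl⟩ := hz
  simp only
  have hqp : q - (m - e) = τ⁻¹ • (p - (m - e)) := by
    rw [hp, add_sub_cancel_left, smul_smul, inv_mul_cancel₀ hτ0.ne', one_smul]
  -- Between the vertex and `p` the gauge is affine, with value 1 at the vertex and at least 1 at
  -- `p`. Beyond `p`, the point `p` lies between the vertex and `z`, and convexity of the gauge
  -- excludes a value below 1 at `z`.
  rcases le_total σ τ with hle | hle
  · set l := σ / τ with hl
    have hl0 : 0 ≤ l := by positivity
    have hl1 : l ≤ 1 := (div_le_one hτ0).2 hle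
    have hz : m - e + σ • (q - (m - e)) - m = -((1 - l) • e) + l • (p - m) := by
      rw [hqp, smul_smul, ← div_eq_mul_inv, ← hl]
      module
    have e1 : |U (-((1 - l) • e) + l • (p - m))| = (1 - l) + l * |U (p - m)| := by
      simp only [map_add, map_neg, map_smul, hU, smul_eq_mul, mul_one]
      rw [abs_of_nonpos hUp, abs_of_nonpos (by nlinarith)]
      ring
    have e2 : S (-((1 - l) • e) + l • (p - m)) = l * S (p - m) := by simp [hS]
    have e3 : -((1 - l) • e) + l • (p - m) - U (-((1 - l) • e) + l • (p - m)) • e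
        - S (-((1 - l) • e) + l • (p - m)) • b
        = l • (p - m - U (p - m) • e - S (p - m) • b) := by
      rw [e2]
      simp only [map_add U, map_neg U, map_smul U, hU, smul_eq_mul, mul_one]
      module
    have e4 : max (l * S (p - m) / (1 + δ')) (-(l * S (p - m)) / δ')
        = l * max (S (p - m) / (1 + δ')) (-S (p - m) / δ') := by
      rw [mul_max_of_nonneg _ _ hl0]
      congr 1 <;> ring
    have : bipyramidGauge U S e b δ' (-((1 - l) • e) + l • (p - m))
        = (1 - l) + l * bipyramidGauge U S e b δ' (p - m) := by
      unfold bipyramidGauge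
      rw [e1, e3, e2, e4, norm_smul, Real.norm_eq_abs, abs_of_nonneg hl0]
      ring
    rw [hz, this]
    nlinarith
  · have hσ : 0 < σ := hτ0.trans_le hle
    set l := τ / σ with hl
    have hl0 : 0 < l := by positivity
    have hl1 : l ≤ 1 := (div_le_one hσ).2 hle
    have hz : p - m = (1 - l) • (m - e - m) + l • (m - e + σ • (q - (m - e)) - m) := by
      have : l * σ = τ := by rw [hl]; field_simp
      rw [hp, ← this]
      module
    have hb := bipyramidGauge_add_le (U := U) (S := S) (e := e) (b := b) hδ'.1
      ((1 - l) • (m - e - m)) (l • (m - e + σ • (q - (m - e)) - m))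
    rw [← hz, bipyramidGauge_smul (by linarith), bipyramidGauge_smul hl0.le, hv] at hb
    nlinarith

/-- A segment through both vertices would contain their midpoint `m`, which is in the triangle. So
the segment contains at most one of them, and is cut there into two rays. -/
theorem eventually_bipyramidGauge_segment (hU : U e = 1) (hS : S e = 0) {m p q : Space}
    (hd : segment ℝ p q ∩ convexHull ℝ {m - e, m + b, m + e} ⊆ {m - e, m + e}) :
    ∀ᶠ δ in 𝓝[>] (0 : ℝ), ∀ z ∈ segment ℝ p q, 1 ≤ bipyramidGauge U S e b δ (z - m) := by
  have he : e ≠ 0 := by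
    rintro rfl
    simp at hU
  have hm : m ∈ segment ℝ (m - e) (m + e) :=
    ⟨1 / 2, 1 / 2, by norm_num, by norm_num, by norm_num, by module⟩
  have hboth : ¬ (m - e ∈ segment ℝ p q ∧ m + e ∈ segment ℝ p q) := by
    rintro ⟨h1, h2⟩
    have h3 : m ∈ segment ℝ p q := (convex_segment p q).segment_subset h1 h2 hm
    have h4 : m ∈ convexHull ℝ {m - e, m + b, m + e} :=
      (convex_convexHull ℝ _).segment_subset (subset_convexHull ℝ _ (by simp))
        (subset_convexHull ℝ _ (by simp)) hm
    rcases hd ⟨h3, h4⟩ with h | h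
    · exact he (by simpa using h.symm)
    · exact he (by simpa using (mem_singleton_iff.1 h).symm)
  have split : ∀ x ∈ segment ℝ p q, ∀ z ∈ segment ℝ p q,
      z ∈ segment ℝ x p ∨ z ∈ segment ℝ x q := by
    intro x hx z hz
    rw [segment_eq_image'] at hx hz
    obtain ⟨s, ⟨hs0, hs1⟩, rfl⟩ := hx
    obtain ⟨t, ⟨ht0, ht1⟩, rfl⟩ := hz
    rcases le_total t s with h | h
    · left
      rcases hs0.eq_or_lt with rfl | hs
      · have : t = 0 := le_antisymm h ht0
        subst this
        simp
      · rw [segment_symm, segment_eq_image']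
        refine ⟨t / s, ⟨by positivity, (div_le_one hs).2 h⟩, ?_⟩
        simp only
        have : t = t / s * s := by field_simp
        conv_rhs => rw [this]
        module
    · right
      rcases hs1.eq_or_lt with rfl | hs
      · have : t = 1 := le_antisymm ht1 h
        subst this
        simp
      · rw [segment_eq_image']
        have h1 : 0 < 1 - s := by linarith
        refine ⟨(t - s) / (1 - s), ⟨div_nonneg (by linarith) h1.le,
          (div_le_one h1).2 (by linarith)⟩, ?_⟩
        simp only
        have : t = s + (t - s) / (1 - s) * (1 - s) := by field_simp; ring
        conv_rhs => rw [this]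
        module
  by_cases ha : m - e ∈ segment ℝ p q
  · have hd' : ∀ z ∈ segment ℝ p q, z ∈ convexHull ℝ {m - e, m + b, m + e} → z = m - e := by
      intro z hz hz'
      rcases hd ⟨hz, hz'⟩ with h | h
      · exact h
      · rw [mem_singleton_iff] at h
        exact absurd ⟨ha, h ▸ hz⟩ hboth
    filter_upwards [eventually_bipyramidGauge_ray hU hS (q := p) fun z hz =>
        hd' z ((convex_segment p q).segment_subset ha (left_mem_segment ℝ p q) hz),
      eventually_bipyramidGauge_ray hU hS (q := q) fun z hz =>
        hd' z ((convex_segment p q).segment_subset ha (right_mem_segment ℝ p q) hz)]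
      with δ h1 h2 z hz
    exact (split _ ha z hz).elim (h1 z) (h2 z)
  by_cases hc : m + e ∈ segment ℝ p q
  · have hset : ({m - -e, m + b, m + -e} : Set Space) = {m - e, m + b, m + e} := by
      ext z
      simp only [sub_neg_eq_add, ← sub_eq_add_neg, mem_insert_iff, mem_singleton_iff]
      tauto
    have hd' : ∀ z ∈ segment ℝ p q, z ∈ convexHull ℝ {m - -e, m + b, m + -e} →
        z = m - -e := by
      rw [hset]
      intro z hz hz'
      rcases hd ⟨hz, hz'⟩ with h | h
      · exact absurd (h ▸ hz) ha
      · simpa using h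
    have hc' : m - -e ∈ segment ℝ p q := by simpa using hc
    have hU' : (-U) (-e) = 1 := by simp [hU]
    have hS' : S (-e) = 0 := by simp [hS]
    filter_upwards [eventually_bipyramidGauge_ray hU' hS' (q := p) fun z hz =>
        hd' z ((convex_segment p q).segment_subset hc' (left_mem_segment ℝ p q) hz),
      eventually_bipyramidGauge_ray hU' hS' (q := q) fun z hz =>
        hd' z ((convex_segment p q).segment_subset hc' (right_mem_segment ℝ p q) hz)]
      with δ h1 h2 z hz
    simp only [bipyramidGauge_neg] at h1 h2
    exact (split _ hc' z hz).elim (h1 z) (h2 z)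
  · refine eventually_bipyramidGauge_of_disjoint ?_ ?_
    · rw [segment_eq_image']
      exact isCompact_Icc.image (by fun_prop)
    · intro z hz hz'
      rcases hd ⟨hz, hz'⟩ with h | h
      · exact ha (h ▸ hz)
      · rw [mem_singleton_iff] at h
        exact hc (h ▸ hz)

end Bipyramid

theorem exists_dual_pair {x y : Space} (h : LinearIndependent ℝ ![x, y]) :
    ∃ U S : Space →ₗ[ℝ] ℝ, U x = 1 ∧ U y = 0 ∧ S x = 0 ∧ S y = 1 := by
  obtain ⟨g, hg⟩ := LinearMap.exists_leftInverse_of_injective (Fintype.linearCombination ℝ ![x, y])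
    (LinearMap.ker_eq_bot.2 (linearIndependent_iff_injective_fintypeLinearCombination.1 h))
  have key : ∀ c : Fin 2 → ℝ, g (c 0 • x + c 1 • y) = c := by
    intro c
    have := LinearMap.congr_fun hg c
    simpa [Fintype.linearCombination_apply] using this
  have hx := key ![1, 0]
  have hy := key ![0, 1]
  simp at hx hy
  exact ⟨LinearMap.proj 0 ∘ₗ g, LinearMap.proj 1 ∘ₗ g, by simp [hx], by simp [hy], by simp [hx],
    by simp [hy]⟩

/-- A side of a triangle can be pushed across the triangle to the other two sides, away from
a finite union of segments that meets the triangle at most in the ends of the side. -/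
theorem AmbientIsotopic.triangle_move {a b c : Space} {R : Set Space}
    (hind : LinearIndependent ℝ ![c - a, b - a]) (hR : IsPolyhedral R)
    (hT : R ∩ convexHull ℝ {a, b, c} ⊆ {a, c}) :
    AmbientIsotopic (segment ℝ a c ∪ R) (segment ℝ a b ∪ segment ℝ b c ∪ R) := by
  -- Coordinates centred at the midpoint of the side: `e` is half the side, and `v` points to the
  -- opposite vertex.
  obtain ⟨m, hm⟩ : ∃ m, m = (2⁻¹ : ℝ) • (a + c) := ⟨_, rfl⟩
  obtain ⟨e, he⟩ : ∃ e, e = (2⁻¹ : ℝ) • (c - a) := ⟨_, rfl⟩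
  obtain ⟨v, hv⟩ : ∃ v, v = b - m := ⟨_, rfl⟩
  have ha : a = m - e := by rw [hm, he]; module
  have hc : c = m + e := by rw [hm, he]; module
  have hb : b = m + v := by rw [hv]; abel
  clear hm he hv
  subst ha hc hb
  have hind' : LinearIndependent ℝ ![e, v] := by
    rw [LinearIndependent.pair_iff] at hind ⊢
    intro s t hst
    have := hind ((s - t) / 2) t (by rw [← hst]; module)
    exact ⟨by linarith [this.1, this.2], this.2⟩
  obtain ⟨U, S, hUe, hUv, hSe, hSv⟩ := exists_dual_pair hind'
  obtain ⟨s, rfl⟩ := hR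
  have hev : ∀ᶠ δ in 𝓝[>] (0 : ℝ), ∀ x ∈ s, ∀ z ∈ segment ℝ x.1 x.2,
      1 ≤ bipyramidGauge U S e v δ (z - m) := by
    rw [eventually_all_finset]
    refine fun x hx => eventually_bipyramidGauge_segment hUe hSe (subset_trans ?_ hT)
    exact inter_subset_inter_left _ (subset_biUnion_of_mem (u := fun x => segment ℝ x.1 x.2) hx)
  obtain ⟨δ, hδ, hδ0⟩ := (hev.and self_mem_nhdsWithin).exists
  replace hδ0 : 0 < δ := hδ0
  have hcont : Continuous fun q => bipyramidGauge U S e v δ (q - m) :=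
    continuous_bipyramidGauge.comp (continuous_id.sub continuous_const)
  -- Moving along `v` changes only `S`, at unit speed, so the gauge grows at rate at most `1 / (1 +
  -- δ)`. The tip of the bipyramid beyond the triangle makes this less than one, as
  -- `AmbientIsotopic.shear` demands.
  have hslope : ∀ (p : Space) (t : ℝ), 0 ≤ t →
      bipyramidGauge U S e v δ (p + t • v - m)
        ≤ bipyramidGauge U S e v δ (p - m) + t / (1 + δ) := by
    intro p t ht
    have e1 : p + t • v - m = (p - m) + t • v := by abel
    have e2 : (p - m) + t • v - U (p - m) • e - (S (p - m) + t) • v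
        = p - m - U (p - m) • e - S (p - m) • v := by module
    have e3 : max ((S (p - m) + t) / (1 + δ)) (-(S (p - m) + t) / δ)
        ≤ max (S (p - m) / (1 + δ)) (-S (p - m) / δ) + t / (1 + δ) := by
      have h0 : 0 ≤ t / (1 + δ) := by positivity
      refine max_le ?_ ?_
      · rw [add_div]
        gcongr
        exact le_max_left _ _
      · have : -(S (p - m) + t) / δ ≤ -S (p - m) / δ := by gcongr; linarith
        exact this.trans ((le_max_right _ _).trans (by linarith))
    simp only [bipyramidGauge, e1, map_add, map_smul, hUv, hSv, smul_eq_mul, mul_zero, mul_one,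
      add_zero, e2]
    linarith
  have hiso := AmbientIsotopic.shear (h := fun p => max 0 (1 - bipyramidGauge U S e v δ (p - m)))
    (by fun_prop) (v := v) (k := 1 / (1 + δ)) (by positivity)
    (by rw [div_lt_one (by positivity)]; linarith)
    (by
      intro p t ht
      have h1 := hslope p t ht
      have h2 : 0 ≤ t / (1 + δ) := by positivity
      rw [show 1 / (1 + δ) * t = t / (1 + δ) by ring, sub_le_iff_le_add]
      refine max_le ?_ ?_
      · have := le_max_left 0 (1 - bipyramidGauge U S e v δ (p + t • v - m))
        linarith
      · have := le_max_right 0 (1 - bipyramidGauge U S e v δ (p + t • v - m))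
        linarith)
    (segment ℝ (m - e) (m + e) ∪ ⋃ x ∈ s, segment ℝ x.1 x.2)
  refine cast (congrArg _ ?_) hiso
  rw [image_union]
  congr 1
  -- A point `m + u • e` of the side moves by `(1 - |u|) • v`, which lands exactly on one of the
  -- other two sides.
  · have hval : ∀ u : ℝ, bipyramidGauge U S e v δ (m + u • e - m) = |u| := by
      intro u
      simp [bipyramidGauge, hUe, hSe]
    ext z
    constructor
    · rintro ⟨y, hy, rfl⟩
      rw [segment_eq_image'] at hy
      obtain ⟨t, ⟨ht0, ht1⟩, rfl⟩ := hy
      have e1 : m - e + t • (m + e - (m - e)) = m + (2 * t - 1) • e := by module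
      simp only
      rw [e1, hval, max_eq_right (by linarith [abs_le.2 (show -1 ≤ 2 * t - 1 ∧ 2 * t - 1 ≤ 1 by
        constructor <;> linarith)])]
      rcases le_total (2 * t - 1) 0 with h | h
      · left
        rw [abs_of_nonpos h, segment_eq_image']
        exact ⟨2 * t, ⟨by linarith, by linarith⟩, by simp only; module⟩
      · right
        rw [abs_of_nonneg h, segment_eq_image']
        exact ⟨2 * t - 1, ⟨by linarith, by linarith⟩, by simp only; module⟩
    · rintro (hz | hz)
      · rw [segment_eq_image'] at hz
        obtain ⟨t, ⟨ht0, ht1⟩, rfl⟩ := hz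
        refine ⟨m + (t - 1) • e, ?_, ?_⟩
        · rw [segment_eq_image']
          exact ⟨t / 2, ⟨by linarith, by linarith⟩, by simp only; module⟩
        · simp only
          rw [hval, abs_of_nonpos (by linarith), max_eq_right (by linarith)]
          module
      · rw [segment_eq_image'] at hz
        obtain ⟨t, ⟨ht0, ht1⟩, rfl⟩ := hz
        refine ⟨m + t • e, ?_, ?_⟩
        · rw [segment_eq_image']
          exact ⟨(t + 1) / 2, ⟨by linarith, by linarith⟩, by simp only; module⟩
        · simp only
          rw [hval, abs_of_nonneg (by linarith), max_eq_right (by linarith)]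
          module
  · have : EqOn (fun p => p + max 0 (1 - bipyramidGauge U S e v δ (p - m)) • v) id
        (⋃ x ∈ s, segment ℝ x.1 x.2) := by
      intro z hz
      simp only [mem_iUnion] at hz
      obtain ⟨x, hx, hz⟩ := hz
      have := hδ x hx z hz
      simp [max_eq_left (show 1 - bipyramidGauge U S e v δ (z - m) ≤ 0 by linarith)]
    rw [this.image_eq, image_id]

/-! ### Triangles are trivial knots -/

theorem mem_segment_iff_exists_smul {x y z : Space} :
    z ∈ segment ℝ x y ↔ ∃ t : ℝ, 0 ≤ t ∧ t ≤ 1 ∧ z = (1 - t) • x + t • y := by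
  rw [segment_eq_image]
  constructor
  · rintro ⟨t, ⟨h0, h1⟩, rfl⟩
    exact ⟨t, h0, h1, rfl⟩
  · rintro ⟨t, h0, h1, rfl⟩
    exact ⟨t, ⟨h0, h1⟩, rfl⟩

theorem mem_convexHull_triangle_iff {a b c z : Space} :
    z ∈ convexHull ℝ {a, b, c} ↔ ∃ α β γ : ℝ, 0 ≤ α ∧ 0 ≤ β ∧ 0 ≤ γ ∧ α + β + γ = 1 ∧
      z = α • a + β • b + γ • c := by
  rw [convexHull_insert (by simp), convexHull_pair, mem_convexJoin]
  constructor
  · rintro ⟨x, rfl, y, hy, hz⟩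
    obtain ⟨s, hs0, hs1, rfl⟩ := mem_segment_iff_exists_smul.1 hy
    obtain ⟨t, ht0, ht1, rfl⟩ := mem_segment_iff_exists_smul.1 hz
    exact ⟨1 - t, t * (1 - s), t * s, by linarith, mul_nonneg ht0 (by linarith), by positivity,
      by ring, by module⟩
  · rintro ⟨α, β, γ, h1, h2, h3, hs, rfl⟩
    refine ⟨a, rfl, ?_⟩
    rcases (add_nonneg h2 h3).eq_or_lt with h | h
    · have hb : β = 0 := by linarith
      have hc : γ = 0 := by linarith
      have ha : α = 1 := by linarith
      refine ⟨b, left_mem_segment _ _ _, ?_⟩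
      simp [ha, hb, hc, left_mem_segment]
    · refine ⟨(1 - γ / (β + γ)) • b + (γ / (β + γ)) • c, mem_segment_iff_exists_smul.2
        ⟨_, by positivity, (div_le_one h).2 (by linarith), rfl⟩, mem_segment_iff_exists_smul.2
        ⟨β + γ, h.le, by linarith, ?_⟩⟩
      have e1 : (β + γ) * (1 - γ / (β + γ)) = β := by field_simp; ring
      have e2 : (β + γ) * (γ / (β + γ)) = γ := by field_simp
      rw [smul_add, smul_smul, smul_smul, e1, e2, show 1 - (β + γ) = α by linarith, add_assoc]

/-- The boundary of a triangle. -/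
def triangleBoundary (a b c : Space) : Set Space :=
  segment ℝ a b ∪ segment ℝ b c ∪ segment ℝ a c

theorem triangleBoundary_rotate (a b c : Space) :
    triangleBoundary a b c = triangleBoundary b c a := by
  unfold triangleBoundary
  rw [segment_symm ℝ a b, segment_symm ℝ a c]
  ac_rfl

theorem triangleBoundary_swap_right (a b c : Space) :
    triangleBoundary a b c = triangleBoundary a c b := by
  unfold triangleBoundary
  rw [segment_symm ℝ b c]
  ac_rfl

theorem triangleBoundary_swap (a b c : Space) :
    triangleBoundary a b c = triangleBoundary b a c := by
  unfold triangleBoundary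
  rw [segment_symm ℝ a b]
  ac_rfl

/-- A radial factor need not be continuous at the origin: boundedness suffices there because it
multiplies a vector tending to zero. -/
theorem continuous_smul_self_of_bounded {X : Type*} [TopologicalSpace X] {φ : X × Space → ℝ}
    {C : ℝ} (hφ : ∀ x, |φ x| ≤ C) (hc : ∀ x : X × Space, x.2 ≠ 0 → ContinuousAt φ x) :
    Continuous fun x => φ x • x.2 := by
  rw [continuous_iff_continuousAt]
  intro x
  by_cases hx : x.2 = 0
  · rw [ContinuousAt, hx, smul_zero]
    refine squeeze_zero_norm (a := fun x => C * ‖x.2‖) (fun y => ?_) ?_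
    · rw [norm_smul, Real.norm_eq_abs]
      exact mul_le_mul_of_nonneg_right (hφ y) (norm_nonneg _)
    · have : Continuous fun x : X × Space => C * ‖x.2‖ := by fun_prop
      simpa [hx] using this.tendsto x
  · exact (hc x hx).smul continuousAt_snd

section Radial

variable {g : Space → ℝ} {κ C : ℝ}

theorem radial_factor_bounds (hκ1 : κ ≤ 1) (hC : 1 ≤ C)
    (hb : ∀ p, p ≠ 0 → κ * ‖p‖ ≤ g p ∧ g p ≤ C * ‖p‖) {t : ℝ} (ht0 : 0 ≤ t) (ht1 : t ≤ 1)
    {p : Space} (hp : p ≠ 0) :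
    κ ≤ (1 - t) + t * (g p / ‖p‖) ∧ (1 - t) + t * (g p / ‖p‖) ≤ C := by
  have hn : 0 < ‖p‖ := norm_pos_iff.2 hp
  have h1 : κ ≤ g p / ‖p‖ := (le_div_iff₀ hn).2 (hb p hp).1
  have h2 : g p / ‖p‖ ≤ C := (div_le_iff₀ hn).2 (hb p hp).2
  constructor <;> nlinarith

/-- The radial isotopy from the unit sphere of one gauge to the round unit sphere. -/
theorem ambientIsotopic_radial (hg : Continuous g)
    (hs : ∀ (l : ℝ) p, 0 < l → g (l • p) = l * g p) (hκ : 0 < κ) (hκ1 : κ ≤ 1) (hC : 1 ≤ C)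
    (hb : ∀ p, p ≠ 0 → κ * ‖p‖ ≤ g p ∧ g p ≤ C * ‖p‖) (A : Set Space) :
    AmbientIsotopic A ((fun p => (g p / ‖p‖) • p) '' A) := by
  classical
  obtain ⟨ρ, hρ⟩ : ∃ ρ : unitInterval × Space → ℝ,
      ∀ x, ρ x = if x.2 = 0 then 1 else (1 - (x.1 : ℝ)) + x.1 * (g x.2 / ‖x.2‖) := ⟨_, fun _ => rfl⟩
  have hρb : ∀ x, κ ≤ ρ x ∧ ρ x ≤ C := by
    intro x
    rw [hρ]
    split_ifs with h
    · exact ⟨hκ1, hC⟩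
    · exact radial_factor_bounds hκ1 hC hb x.1.2.1 x.1.2.2 h
  have hρ0 : ∀ x, 0 < ρ x := fun x => hκ.trans_le (hρb x).1
  have hρc : ∀ x, x.2 ≠ 0 → ContinuousAt ρ x := by
    intro x hx
    have h1 : ContinuousAt (fun x : unitInterval × Space =>
        (1 - (x.1 : ℝ)) + x.1 * (g x.2 / ‖x.2‖)) x := by
      have : ‖x.2‖ ≠ 0 := norm_ne_zero_iff.2 hx
      fun_prop (disch := assumption)
    refine h1.congr ?_
    have : ∀ᶠ y : unitInterval × Space in 𝓝 x, y.2 ≠ 0 :=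
      continuousAt_snd.eventually (isOpen_ne.mem_nhds hx)
    filter_upwards [this] with y hy
    rw [hρ, if_neg hy]
  -- The factor is constant on open rays, so division by the same factor is the inverse map.
  have hρs : ∀ t (l : ℝ) p, 0 < l → ρ (t, l • p) = ρ (t, p) := by
    intro t l p hl
    rw [hρ, hρ]
    simp only [smul_eq_zero, hl.ne', false_or]
    split_ifs with h
    · rfl
    · rw [hs l p hl, norm_smul, Real.norm_eq_abs, abs_of_pos hl, mul_div_mul_left _ _ hl.ne']
  have hF : Continuous fun x : unitInterval × Space => ρ x • x.2 :=
    continuous_smul_self_of_bounded (C := C)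
      (fun x => by rw [abs_of_pos (hρ0 x)]; exact (hρb x).2) hρc
  have hG : Continuous fun x : unitInterval × Space => (ρ x)⁻¹ • x.2 :=
    continuous_smul_self_of_bounded (C := κ⁻¹)
      (fun x => by
        rw [abs_of_pos (inv_pos.2 (hρ0 x))]
        exact inv_anti₀ hκ (hρb x).1)
      (fun x hx => (hρc x hx).inv₀ (hρ0 x).ne')
  let H : unitInterval → (Space ≃ₜ Space) := fun t =>
    { toFun := fun p => ρ (t, p) • p
      invFun := fun p => (ρ (t, p))⁻¹ • p
      left_inv := fun p => by
        simp only
        rw [hρs _ _ _ (hρ0 _), smul_smul, inv_mul_cancel₀ (hρ0 _).ne', one_smul]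
      right_inv := fun p => by
        simp only
        rw [hρs _ _ _ (inv_pos.2 (hρ0 _)), smul_smul, mul_inv_cancel₀ (hρ0 _).ne', one_smul]
      continuous_toFun := hF.comp (Continuous.prodMk_right t)
      continuous_invFun := hG.comp (Continuous.prodMk_right t) }
  refine ⟨H, hF, fun p => ?_, image_congr fun p _ => ?_⟩
  · change ρ (0, p) • p = p
    rw [hρ]
    simp
  · change ρ (1, p) • p = _
    rw [hρ]
    by_cases hp : p = 0 <;> simp [hp]

end Radial

/-- The gauge of a bipyramid over the triangle with vertices `(1, 0, 0)`, `(0, 1, 0)`,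
`(-1, -1, 0)`. -/
def triangleGauge (p : Space) : ℝ :=
  max (p 0 + p 1) (max (p 0 - 2 * p 1) (p 1 - 2 * p 0)) + |p 2|

theorem triangleGauge_smul (l : ℝ) (p : Space) (hl : 0 < l) :
    triangleGauge (l • p) = l * triangleGauge p := by
  simp only [triangleGauge, PiLp.smul_apply, smul_eq_mul, abs_mul, abs_of_pos hl, mul_add,
    mul_max_of_nonneg _ _ hl.le]
  ring_nf

theorem continuous_triangleGauge : Continuous triangleGauge := by
  unfold triangleGauge
  fun_prop

theorem norm_eq_sqrt_coords (p : Space) : ‖p‖ = √(p 0 ^ 2 + p 1 ^ 2 + p 2 ^ 2) := by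
  rw [EuclideanSpace.norm_eq]
  simp [Fin.sum_univ_three]

theorem triangleGauge_bounds (p : Space) :
    1 / 6 * ‖p‖ ≤ triangleGauge p ∧ triangleGauge p ≤ 6 * ‖p‖ := by
  have h0 : |p 0| ≤ ‖p‖ := by simpa using PiLp.norm_apply_le p 0
  have h1 : |p 1| ≤ ‖p‖ := by simpa using PiLp.norm_apply_le p 1
  have h2 : |p 2| ≤ ‖p‖ := by simpa using PiLp.norm_apply_le p 2
  have hle : ‖p‖ ≤ |p 0| + |p 1| + |p 2| := by
    rw [norm_eq_sqrt_coords]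
    refine Real.sqrt_le_iff.2 ⟨by positivity, ?_⟩
    rw [← sq_abs (p 0), ← sq_abs (p 1), ← sq_abs (p 2)]
    nlinarith [mul_nonneg (abs_nonneg (p 0)) (abs_nonneg (p 1)),
      mul_nonneg (abs_nonneg (p 0)) (abs_nonneg (p 2)),
      mul_nonneg (abs_nonneg (p 1)) (abs_nonneg (p 2))]
  set M := max (p 0 + p 1) (max (p 0 - 2 * p 1) (p 1 - 2 * p 0)) with hM
  have m1 : p 0 + p 1 ≤ M := le_max_left _ _
  have m2 : p 0 - 2 * p 1 ≤ M := (le_max_left _ _).trans (le_max_right _ _)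
  have m3 : p 1 - 2 * p 0 ≤ M := (le_max_right _ _).trans (le_max_right _ _)
  have hg : triangleGauge p = M + |p 2| := rfl
  rw [hg]
  have a0 := abs_le.1 h0
  have a1 := abs_le.1 h1
  have n2 := abs_nonneg (p 2)
  constructor
  · have b0 : |p 0| ≤ M + M + M := by rw [abs_le]; constructor <;> linarith
    have b1 : |p 1| ≤ M + M + M := by rw [abs_le]; constructor <;> linarith
    linarith
  · have : M ≤ 3 * ‖p‖ := by
      refine max_le ?_ (max_le ?_ ?_) <;> linarith
    have := norm_nonneg p
    linarith

theorem mem_triangleBoundary_standard (p : Space) :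
    p ∈ triangleBoundary !₂[1, 0, 0] !₂[0, 1, 0] !₂[-1, -1, 0] ↔
      p 2 = 0 ∧ triangleGauge p = 1 := by
  have hcoord : ∀ (s t u : ℝ), p = !₂[s, t, u] ↔ p 0 = s ∧ p 1 = t ∧ p 2 = u := by
    intro s t u
    constructor
    · rintro rfl
      simp
    · rintro ⟨h0, h1, h2⟩
      ext i
      fin_cases i <;> simp [h0, h1, h2]
  have hseg : ∀ (x y : Fin 3 → ℝ), p ∈ segment ℝ (!₂[x 0, x 1, x 2] : Space) !₂[y 0, y 1, y 2] ↔
      ∃ t : ℝ, 0 ≤ t ∧ t ≤ 1 ∧ p 0 = (1 - t) * x 0 + t * y 0 ∧ p 1 = (1 - t) * x 1 + t * y 1 ∧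
        p 2 = (1 - t) * x 2 + t * y 2 := by
    intro x y
    rw [mem_segment_iff_exists_smul]
    refine exists_congr fun t => and_congr_right fun _ => and_congr_right fun _ => ?_
    rw [← hcoord]
    constructor
    · rintro rfl
      ext i
      fin_cases i <;> simp
    · rintro rfl
      ext i
      fin_cases i <;> simp
  have s1 := hseg ![1, 0, 0] ![0, 1, 0]
  have s2 := hseg ![0, 1, 0] ![-1, -1, 0]
  have s3 := hseg ![1, 0, 0] ![-1, -1, 0]
  simp only [Matrix.cons_val_zero, Matrix.cons_val_one, Matrix.cons_val] at s1 s2 s3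
  unfold triangleBoundary triangleGauge
  rw [mem_union, mem_union, s1, s2, s3]
  constructor
  · rintro ((⟨t, h0, h1, e0, e1, e2⟩ | ⟨t, h0, h1, e0, e1, e2⟩) | ⟨t, h0, h1, e0, e1, e2⟩)
    · refine ⟨by linarith, ?_⟩
      rw [e0, e1, e2, max_eq_left (max_le (by linarith) (by linarith))]
      simp
    · refine ⟨by linarith, ?_⟩
      rw [e0, e1, e2, max_eq_right (le_max_of_le_right (by linarith)),
        max_eq_right (by linarith)]
      simp
      ring
    · refine ⟨by linarith, ?_⟩
      rw [e0, e1, e2, max_eq_right (le_max_of_le_left (by linarith)),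
        max_eq_left (by linarith)]
      simp
      ring
  · rintro ⟨h2, hg⟩
    rw [h2, abs_zero, add_zero] at hg
    have m1 : p 0 + p 1 ≤ 1 := hg ▸ le_max_left _ _
    have m2 : p 0 - 2 * p 1 ≤ 1 := hg ▸ (le_max_left _ _).trans (le_max_right _ _)
    have m3 : p 1 - 2 * p 0 ≤ 1 := hg ▸ (le_max_right _ _).trans (le_max_right _ _)
    rcases max_choice (p 0 + p 1) (max (p 0 - 2 * p 1) (p 1 - 2 * p 0)) with h | h
    · rw [h] at hg
      exact Or.inl (Or.inl ⟨p 1, by linarith, by linarith, by linarith, by linarith, by linarith⟩)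
    · rw [h] at hg
      rcases max_choice (p 0 - 2 * p 1) (p 1 - 2 * p 0) with h' | h'
      · rw [h'] at hg
        exact Or.inr ⟨-p 1, by linarith, by linarith, by linarith, by linarith, by linarith⟩
      · rw [h'] at hg
        exact Or.inl (Or.inr ⟨-p 0, by linarith, by linarith, by linarith, by linarith,
          by linarith⟩)

theorem ambientIsotopic_standard_triangle :
    AmbientIsotopic (triangleBoundary !₂[1, 0, 0] !₂[0, 1, 0] !₂[-1, -1, 0]) roundCircle := by
  have h := ambientIsotopic_radial continuous_triangleGauge triangleGauge_smul
    (κ := 1 / 6) (C := 6) (by norm_num) (by norm_num) (by norm_num)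
    (fun p _ => triangleGauge_bounds p) (triangleBoundary !₂[1, 0, 0] !₂[0, 1, 0] !₂[-1, -1, 0])
  refine cast (congrArg _ ?_) h
  ext q
  have hpos : ∀ q : Space, q ≠ 0 → 0 < triangleGauge q := fun q hq =>
    (by have := norm_pos_iff.2 hq; positivity : (0 : ℝ) < 1 / 6 * ‖q‖).trans_le
      (triangleGauge_bounds q).1
  have hcirc : q ∈ roundCircle ↔ q 2 = 0 ∧ ‖q‖ = 1 := by
    constructor
    · rintro ⟨z, rfl⟩
      refine ⟨by simp, ?_⟩
      rw [norm_eq_sqrt_coords]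
      have : Complex.normSq z = 1 := by simp
      rw [Complex.normSq_apply] at this
      simp [← sq] at this ⊢
      exact this
    · rintro ⟨h2, h1⟩
      rw [norm_eq_sqrt_coords, h2, Real.sqrt_eq_one] at h1
      refine ⟨⟨⟨q 0, q 1⟩, ?_⟩, ?_⟩
      · refine mem_sphere_zero_iff_norm.2 ?_
        rw [Complex.norm_def, Complex.normSq_apply, Real.sqrt_eq_one]
        simp only
        linarith
      · ext i
        fin_cases i <;> simp [h2]
  rw [hcirc]
  constructor
  · rintro ⟨p, hp, rfl⟩
    rw [mem_triangleBoundary_standard] at hp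
    have hn : p ≠ 0 := by
      rintro rfl
      simp [triangleGauge] at hp
    have : ‖p‖ ≠ 0 := norm_ne_zero_iff.2 hn
    simp only
    rw [hp.2]
    refine ⟨by simp [hp.1], ?_⟩
    rw [norm_smul, Real.norm_eq_abs, abs_of_nonneg (by positivity)]
    field_simp
  · rintro ⟨h2, h1⟩
    have hn : q ≠ 0 := by
      rintro rfl
      simp at h1
    have hg := hpos q hn
    refine ⟨(triangleGauge q)⁻¹ • q, ?_, ?_⟩
    · rw [mem_triangleBoundary_standard, triangleGauge_smul _ _ (inv_pos.2 hg)]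
      exact ⟨by simp [h2], inv_mul_cancel₀ hg.ne'⟩
    · simp only
      rw [triangleGauge_smul _ _ (inv_pos.2 hg), inv_mul_cancel₀ hg.ne', norm_smul, h1,
        Real.norm_eq_abs, abs_of_pos (inv_pos.2 hg), smul_smul]
      field_simp
      simp

/-- Three points that do not lie on a line. -/
def Noncollinear (a b c : Space) : Prop :=
  ∀ s t : ℝ, s • (b - a) + t • (c - a) = 0 → s = 0 ∧ t = 0

namespace Noncollinear

variable {a b c : Space}

theorem linearIndependent (h : Noncollinear a b c) : LinearIndependent ℝ ![b - a, c - a] :=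
  LinearIndependent.pair_iff.2 h

theorem swap (h : Noncollinear a b c) : Noncollinear b a c := fun s t hst => by
  have := h (-s - t) t (by rw [← hst]; module)
  constructor <;> linarith [this.1, this.2]

theorem swap_right (h : Noncollinear a b c) : Noncollinear a c b := fun s t hst =>
  (h t s (by rw [← hst]; module)).symm

theorem ne (h : Noncollinear a b c) : b ≠ c := by
  rintro rfl
  have := h 1 (-1) (by module)
  linarith [this.1]

end Noncollinear

theorem triangle_move_of_noncollinear {a b c : Space} {R : Set Space} (h : Noncollinear a b c)
    (hR : IsPolyhedral R) (hT : R ∩ convexHull ℝ {a, b, c} ⊆ {a, c}) :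
    AmbientIsotopic (segment ℝ a c ∪ R) (segment ℝ a b ∪ segment ℝ b c ∪ R) :=
  AmbientIsotopic.triangle_move h.swap_right.linearIndependent hR hT

/-- The four points span a tetrahedron. The side `ac` is pushed across the face `a a' c`, and then
the path `b a a'` is pulled back across the face `b a a'` to `b a'`. Affine independence shows that
each face meets the rest only in the allowed points. -/
theorem triangleBoundary_exchange_of_not_coplanar {a a' b c : Space}
    (h : ∀ s t u : ℝ, s • (a - c) + t • (b - c) + u • (a' - c) = 0 → s = 0 ∧ t = 0 ∧ u = 0) :
    AmbientIsotopic (triangleBoundary a b c) (triangleBoundary a' b c) := by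
  have m1 := triangle_move_of_noncollinear (a := a) (b := a') (c := c)
    (R := segment ℝ a b ∪ segment ℝ b c)
    (fun s t hst => by
      have := h (-s - t) 0 s (by rw [← hst]; module)
      constructor <;> linarith [this.1, this.2.2])
    ((IsPolyhedral.segment _ _).union (IsPolyhedral.segment _ _)) (by
      rintro p ⟨hp | hp, hT⟩
      · obtain ⟨t, -, -, rfl⟩ := mem_segment_iff_exists_smul.1 hp
        obtain ⟨α, β, γ, -, -, -, hs, he⟩ := mem_convexHull_triangle_iff.1 hT
        have := (h (1 - t - α) t (-β) (by
          rw [← sub_eq_zero] at he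
          rw [← he, show γ = 1 - α - β by linarith]
          module)).2.1
        left
        rw [this]
        module
      · obtain ⟨t, -, -, rfl⟩ := mem_segment_iff_exists_smul.1 hp
        obtain ⟨α, β, γ, -, -, -, hs, he⟩ := mem_convexHull_triangle_iff.1 hT
        have := (h (-α) (1 - t) (-β) (by
          rw [← sub_eq_zero] at he
          rw [← he, show γ = 1 - α - β by linarith]
          module)).2.1
        right
        rw [mem_singleton_iff, this, show t = 1 by linarith]
        module)
  have m2 := triangle_move_of_noncollinear (a := b) (b := a) (c := a')
    (R := segment ℝ b c ∪ segment ℝ a' c)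
    (fun s t hst => by
      have := h s (-s - t) t (by rw [← hst]; module)
      exact ⟨this.1, this.2.2⟩)
    ((IsPolyhedral.segment _ _).union (IsPolyhedral.segment _ _)) (by
      rintro p ⟨hp | hp, hT⟩
      · obtain ⟨t, -, -, rfl⟩ := mem_segment_iff_exists_smul.1 hp
        obtain ⟨α, β, γ, -, -, -, hs, he⟩ := mem_convexHull_triangle_iff.1 hT
        have := h (-β) (1 - t - α) (-γ) (by
          rw [← sub_eq_zero] at he
          rw [← he, show γ = 1 - α - β by linarith]
          module)
        left
        rw [show t = 0 by linarith [this.1, this.2.1, this.2.2]]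
        module
      · obtain ⟨t, -, -, rfl⟩ := mem_segment_iff_exists_smul.1 hp
        obtain ⟨α, β, γ, -, -, -, hs, he⟩ := mem_convexHull_triangle_iff.1 hT
        have := h (-β) (-α) (1 - t - γ) (by
          rw [← sub_eq_zero] at he
          rw [← he, show γ = 1 - α - β by linarith]
          module)
        right
        rw [mem_singleton_iff, show t = 0 by linarith [this.1, this.2.1, this.2.2]]
        module)
  unfold triangleBoundary
  rw [show segment ℝ a b ∪ segment ℝ b c ∪ segment ℝ a c
      = segment ℝ a c ∪ (segment ℝ a b ∪ segment ℝ b c) by ac_rfl]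
  rw [segment_symm ℝ a' b, show segment ℝ b a' ∪ segment ℝ b c ∪ segment ℝ a' c
      = segment ℝ b a' ∪ (segment ℝ b c ∪ segment ℝ a' c) by ac_rfl]
  refine m1.trans ?_
  rw [show segment ℝ a a' ∪ segment ℝ a' c ∪ (segment ℝ a b ∪ segment ℝ b c)
    = segment ℝ b a ∪ segment ℝ a a' ∪ (segment ℝ b c ∪ segment ℝ a' c) by
      rw [segment_symm ℝ b a]; ac_rfl]
  exact m2.symm

/-- If the four points are coplanar, the exchange passes through a vertex `c + w` outside the plane.
-/
theorem triangleBoundary_exchange {a a' b c : Space} (h : Noncollinear c a b)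
    (h' : Noncollinear c a' b) :
    AmbientIsotopic (triangleBoundary a b c) (triangleBoundary a' b c) := by
  by_cases hi : ∀ s t u : ℝ,
      s • (a - c) + t • (b - c) + u • (a' - c) = 0 → s = 0 ∧ t = 0 ∧ u = 0
  · exact triangleBoundary_exchange_of_not_coplanar hi
  have hspan : Submodule.span ℝ {a - c, b - c} ≠ ⊤ := by
    intro htop
    classical
    have h2 := finrank_span_finset_le_card (R := ℝ) (M := Space) ({a - c, b - c} : Finset Space)
    rw [Finset.coe_pair, Set.finrank, htop] at h2
    have h3 : ({a - c, b - c} : Finset Space).card ≤ 2 := Finset.card_le_two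
    simp at h2
    omega
  obtain ⟨w, -, hw⟩ := SetLike.exists_of_lt (lt_top_iff_ne_top.2 hspan)
  have hw' : ∀ s t u : ℝ, s • (a - c) + t • (b - c) + u • w = 0 → s = 0 ∧ t = 0 ∧ u = 0 := by
    intro s t u hstu
    have hu : u = 0 := by
      by_contra hu
      refine hw (Submodule.mem_span_pair.2 ⟨-(u⁻¹ * s), -(u⁻¹ * t), ?_⟩)
      have : u⁻¹ • (s • (a - c) + t • (b - c) + u • w) = 0 := by rw [hstu, smul_zero]
      rw [smul_add, smul_smul u⁻¹ u, inv_mul_cancel₀ hu, one_smul] at this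
      rw [← sub_eq_zero, ← neg_eq_zero, ← this]
      module
    subst hu
    have := h s t (by simpa using hstu)
    exact ⟨this.1, this.2, rfl⟩
  have e1 : AmbientIsotopic (triangleBoundary a b c) (triangleBoundary (c + w) b c) :=
    triangleBoundary_exchange_of_not_coplanar (by simpa using hw')
  refine e1.trans (AmbientIsotopic.symm (triangleBoundary_exchange_of_not_coplanar ?_))
  push Not at hi
  obtain ⟨s, t, u, hstu, hne⟩ := hi
  have hu : u ≠ 0 := by
    rintro rfl
    have := h s t (by simpa using hstu)
    exact hne this.1 this.2 rfl
  have ha' : a' - c = (-(u⁻¹ * s)) • (a - c) + (-(u⁻¹ * t)) • (b - c) := by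
    have : u⁻¹ • (s • (a - c) + t • (b - c) + u • (a' - c)) = 0 := by rw [hstu, smul_zero]
    rw [smul_add, smul_smul u⁻¹ u, inv_mul_cancel₀ hu, one_smul] at this
    rw [← sub_eq_zero, ← this]
    module
  have hs : s ≠ 0 := by
    rintro rfl
    have := h' 1 (u⁻¹ * t) (by rw [ha']; module)
    linarith [this.1]
  intro σ τ υ hστ
  rw [ha', add_sub_cancel_left] at hστ
  have := hw' (σ * (-(u⁻¹ * s))) (σ * (-(u⁻¹ * t)) + τ) υ (by rw [← hστ]; module)
  have hσ : σ = 0 := by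
    rcases mul_eq_zero.1 this.1 with h | h
    · exact h
    · simp [hu, hs] at h
  refine ⟨hσ, ?_, this.2.2⟩
  have h2 := this.2.1
  rw [hσ] at h2
  linarith

theorem Noncollinear.exists_off_line {a b c x y : Space} (h : Noncollinear a b c) (hxy : x ≠ y) :
    Noncollinear y a x ∨ Noncollinear y b x ∨ Noncollinear y c x := by
  by_contra! hcon
  have key : ∀ z, ¬ Noncollinear y z x → ∃ l : ℝ, z = y + l • (x - y) := by
    intro z hz
    unfold Noncollinear at hz
    push Not at hz
    obtain ⟨s, t, hst, hne⟩ := hz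
    have hs : s ≠ 0 := by
      rintro rfl
      rw [zero_smul, zero_add, smul_eq_zero, sub_eq_zero] at hst
      exact hst.elim (hne rfl) hxy
    refine ⟨-(s⁻¹ * t), ?_⟩
    have : s⁻¹ • (s • (z - y) + t • (x - y)) = 0 := by rw [hst, smul_zero]
    rw [smul_add, smul_smul s⁻¹ s, inv_mul_cancel₀ hs, one_smul] at this
    rw [← sub_eq_zero, ← this]
    module
  obtain ⟨l, rfl⟩ := key a hcon.1
  obtain ⟨m, rfl⟩ := key b hcon.2.1
  obtain ⟨n, rfl⟩ := key c hcon.2.2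
  have h1 := h (n - l) (l - m) (by module)
  have h2 : m = l := by linarith [h1.2]
  have h3 := h 1 0 (by rw [h2]; module)
  linarith [h3.1]

/-- The vertices are exchanged one at a time. `Noncollinear.exists_off_line` always supplies a
vertex of the target triangle off the line through the two vertices that stay, so no intermediate
triangle degenerates. -/
theorem triangleBoundary_ambientIsotopic_triangleBoundary {a b c a' b' c' : Space}
    (h : Noncollinear a b c) (h' : Noncollinear a' b' c') :
    AmbientIsotopic (triangleBoundary a b c) (triangleBoundary a' b' c') := by
  have step2 : ∀ {b c a' b' c' : Space}, Noncollinear a' b c → Noncollinear a' b' c' →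
      Noncollinear a' b' c →
      AmbientIsotopic (triangleBoundary a' b c) (triangleBoundary a' b' c') := by
    intro b c a' b' c' h h' h1
    have e1 : AmbientIsotopic (triangleBoundary b c a') (triangleBoundary b' c a') :=
      triangleBoundary_exchange h h1
    rw [← triangleBoundary_rotate a', triangleBoundary_rotate b'] at e1
    have e2 : AmbientIsotopic (triangleBoundary c a' b') (triangleBoundary c' a' b') :=
      triangleBoundary_exchange h1.swap.swap_right h'.swap.swap_right
    rw [triangleBoundary_rotate c'] at e2
    exact e1.trans e2
  have step1 : ∀ {b c a' b' c' : Space}, Noncollinear a' b c → Noncollinear a' b' c' →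
      AmbientIsotopic (triangleBoundary a' b c) (triangleBoundary a' b' c') := by
    intro b c a' b' c' h h'
    rcases h'.exists_off_line (x := c) (y := a') h.swap.ne.symm with h1 | h1 | h1
    · exact absurd (h1 1 0 (by simp)).1 one_ne_zero
    · exact step2 h h' h1
    · have := step2 h h'.swap_right h1
      rwa [triangleBoundary_swap_right a' c'] at this
  rcases h'.exists_off_line (x := b) (y := c) h.ne with h1 | h1 | h1
  · exact (triangleBoundary_exchange h.swap_right.swap h1).trans (step1 h1.swap.swap_right h')
  · rw [triangleBoundary_swap a']
    exact (triangleBoundary_exchange h.swap_right.swap h1).trans (step1 h1.swap.swap_right h'.swap)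
  · rw [← triangleBoundary_rotate c']
    exact (triangleBoundary_exchange h.swap_right.swap h1).trans
      (step1 h1.swap.swap_right h'.swap_right.swap)

/-- Every nondegenerate triangle is a trivial knot. -/
theorem Noncollinear.ambientIsotopic_roundCircle {a b c : Space} (h : Noncollinear a b c) :
    AmbientIsotopic (triangleBoundary a b c) roundCircle := by
  refine (triangleBoundary_ambientIsotopic_triangleBoundary h ?_).trans
    ambientIsotopic_standard_triangle
  intro s t hst
  have h0 := congrArg (fun p : Space => p 0) hst
  have h1 := congrArg (fun p : Space => p 1) hst
  simp at h0 h1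
  constructor <;> linarith

/-! ### Polygons with at most two edges between consecutive levels -/

/-- The union of the edges number `s`, ..., `t - 1` of a sequence of points. -/
def polyPath (v : ℕ → Space) (s t : ℕ) : Set Space :=
  ⋃ i ∈ Finset.Ico s t, segment ℝ (v i) (v (i + 1))

section PolyPath

variable {v : ℕ → Space} {s t : ℕ}

theorem mem_polyPath {p : Space} :
    p ∈ polyPath v s t ↔ ∃ i, s ≤ i ∧ i < t ∧ p ∈ segment ℝ (v i) (v (i + 1)) := by
  simp [polyPath, and_assoc]

theorem isPolyhedral_polyPath : IsPolyhedral (polyPath v s t) :=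
  IsPolyhedral.biUnion _ fun _ _ => IsPolyhedral.segment _ _

theorem polyPath_eq_segment_union (h : s < t) :
    polyPath v s t = segment ℝ (v s) (v (s + 1)) ∪ polyPath v (s + 1) t := by
  rw [polyPath, ← Finset.insert_Ico_succ_left_eq_Ico h, Finset.set_biUnion_insert]
  rfl

theorem polyPath_succ (h : s ≤ t) :
    polyPath v s (t + 1) = polyPath v s t ∪ segment ℝ (v t) (v (t + 1)) := by
  rw [polyPath, ← Finset.insert_Ico_right_eq_Ico_add_one h, Finset.set_biUnion_insert, union_comm]
  rfl

@[simp]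
theorem polyPath_self : polyPath v s s = ∅ := by
  simp [polyPath]

end PolyPath

/-! ### Triangle moves controlled by a height function -/

section Moves

variable {f : Space →ₗ[ℝ] ℝ} {A a b d a' d' : Space} {R : Set Space} {k : ℝ}

theorem noncollinear_of_height (ha : f a = k) (hb : f b = k) (hA : f A ≠ k) (hab : a ≠ b) :
    Noncollinear A a b := by
  intro s t hst
  have h1 := congrArg f hst
  simp only [map_add, map_smul, map_sub, ha, hb, smul_eq_mul, map_zero, ← add_mul, mul_eq_zero,
    sub_eq_zero, hA.symm, or_false] at h1
  obtain rfl : t = -s := by linarith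
  have h2 : s • (a - b) = 0 := by rw [← hst]; module
  rw [smul_eq_zero, sub_eq_zero] at h2
  have := h2.resolve_right hab
  simp [this]

theorem le_height_of_mem_segment {p : Space} (ha : k ≤ f a) (hb : k ≤ f b)
    (hp : p ∈ segment ℝ a b) : k ≤ f p := by
  obtain ⟨t, h0, h1, rfl⟩ := mem_segment_iff_exists_smul.1 hp
  simp only [map_add, map_smul, smul_eq_mul]
  nlinarith

theorem height_le_of_mem_segment {p : Space} (ha : f a ≤ k) (hb : f b ≤ k)
    (hp : p ∈ segment ℝ a b) : f p ≤ k := by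
  obtain ⟨t, h0, h1, rfl⟩ := mem_segment_iff_exists_smul.1 hp
  simp only [map_add, map_smul, smul_eq_mul]
  nlinarith

theorem mem_segment_of_mem_triangle_of_height_le {p : Space} (ha : f a = k) (hb : f b = k)
    (hA : k < f A) (hp : p ∈ convexHull ℝ {a, A, b}) (hpk : f p ≤ k) : p ∈ segment ℝ a b := by
  obtain ⟨α, β, γ, h1, h2, h3, hs, rfl⟩ := mem_convexHull_triangle_iff.1 hp
  simp only [map_add, map_smul, smul_eq_mul, ha, hb] at hpk
  have h0 : β = 0 := by
    by_contra hne
    have : 0 < β := lt_of_le_of_ne h2 (Ne.symm hne)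
    have := mul_pos this (sub_pos.2 hA)
    rw [show α = 1 - β - γ by linarith] at hpk
    linarith
  exact ⟨α, γ, h1, h3, by linarith, by rw [h0]; module⟩

/-- Over a horizontal edge, a cone point above that edge can be inserted. -/
theorem ambientIsotopic_insert_apex (ha : f a = k) (hb : f b = k) (hA : k < f A) (hab : a ≠ b)
    (hR : IsPolyhedral R) (hRk : ∀ p ∈ R, f p ≤ k) (hRab : R ∩ segment ℝ a b ⊆ {a, b}) :
    AmbientIsotopic (segment ℝ a b ∪ R) (segment ℝ a A ∪ segment ℝ A b ∪ R) := by
  refine triangle_move_of_noncollinear (noncollinear_of_height ha hb hA.ne' hab).swap hR ?_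
  rintro p ⟨hp, hT⟩
  exact hRab ⟨hp, mem_segment_of_mem_triangle_of_height_le ha hb hA hT (hRk p hp)⟩

/-- The end of an arc can be moved along a horizontal edge of the arc, if the rest of the polygon
is a segment from an apex above the arc to the other end of the arc. -/
theorem ambientIsotopic_cone_step (ha : f a = k) (hb : f b = k) (hA : k < f A) (hab : a ≠ b)
    (hd : f d = k) (hR : IsPolyhedral R) (hRk : ∀ p ∈ R, f p ≤ k)
    (hRab : R ∩ segment ℝ a b ⊆ {b}) (hdab : d ∉ segment ℝ a b) :
    AmbientIsotopic (segment ℝ A b ∪ (R ∪ segment ℝ d A))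
      (segment ℝ A a ∪ segment ℝ a b ∪ (R ∪ segment ℝ d A)) := by
  refine triangle_move_of_noncollinear (noncollinear_of_height ha hb hA.ne' hab)
    (hR.union (IsPolyhedral.segment _ _)) ?_
  rintro p ⟨hp | hp, hT⟩
  · right
    rw [insert_comm] at hT
    exact hRab ⟨hp, mem_segment_of_mem_triangle_of_height_le ha hb hA hT (hRk p hp)⟩
  -- Comparing heights shows that `p` has the same weight on `A` in the segment and in the triangle.
  -- Unless `p = A`, cancelling `A` puts `d` on the segment `ab`.
  · left
    obtain ⟨t, h0, h1, rfl⟩ := mem_segment_iff_exists_smul.1 hp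
    obtain ⟨α, β, γ, hα, hβ, hγ, hs, he⟩ := mem_convexHull_triangle_iff.1 hT
    have h2 := congrArg f he
    simp only [map_add, map_smul, smul_eq_mul, ha, hb, hd] at h2
    have hαt : (α - t) * (f A - k) = 0 := by
      have : β = 1 - α - γ := by linarith
      rw [this] at h2
      linarith
    have hαt' : α = t := by
      rcases mul_eq_zero.1 hαt with h | h <;> linarith
    subst hαt'
    rcases h1.eq_or_lt with h1 | h1
    · rw [h1]
      module
    · exfalso
      apply hdab
      have hne : 1 - α ≠ 0 := by linarith
      have h3 : (1 - α) • d = β • a + γ • b := by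
        rw [← sub_eq_zero] at he ⊢
        rw [← he]
        module
      refine ⟨(1 - α)⁻¹ * β, (1 - α)⁻¹ * γ, ?_, ?_, ?_, ?_⟩
      · exact mul_nonneg (inv_nonneg.2 (by linarith)) hβ
      · exact mul_nonneg (inv_nonneg.2 (by linarith)) hγ
      · rw [← mul_add, show β + γ = 1 - α by linarith, inv_mul_cancel₀ hne]
      · rw [mul_smul, mul_smul, ← smul_add, ← h3, smul_smul, inv_mul_cancel₀ hne, one_smul]

/-- Two disjoint edges that go down from the ends of a horizontal edge to the next level can be
replaced by a segment and one edge. -/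
theorem ambientIsotopic_drop_step (ha : f a = k) (hd : f d = k) (ha' : f a' = k - 1)
    (hd' : f d' = k - 1) (had : a ≠ d) (had' : a' ≠ d')
    (hdisj : Disjoint (segment ℝ a a') (segment ℝ d d'))
    (hR : IsPolyhedral R) (hRk : ∀ p ∈ R, f p ≤ k - 1) :
    AmbientIsotopic (segment ℝ a' d ∪ (R ∪ segment ℝ d d'))
      (segment ℝ a' a ∪ segment ℝ a d ∪ (R ∪ segment ℝ d d')) := by
  refine triangle_move_of_noncollinear (noncollinear_of_height ha hd (by linarith) had)
    (hR.union (IsPolyhedral.segment _ _)) ?_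
  rintro p ⟨hp | hp, hT⟩
  · left
    have h1 := hRk p hp
    obtain ⟨α, β, γ, hα, hβ, hγ, hs, rfl⟩ := mem_convexHull_triangle_iff.1 hT
    simp only [map_add, map_smul, smul_eq_mul, ha, ha', hd] at h1
    have h2 : α = 1 - β - γ := by linarith
    rw [h2] at h1
    have hβ0 : β = 0 := by linarith
    have hγ0 : γ = 0 := by linarith
    rw [h2, hβ0, hγ0]
    module
  -- Comparing heights identifies the weight of `a'` with that of `d'`, whence `β • d + α • d' = α •
  -- a' + β • a`. If `β > 0`, normalizing gives a common point of the disjoint edges; if `β = 0`,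
  -- then `a' ≠ d'` forces `α = 0`, that is, `p = d`.
  · right
    obtain ⟨t, h0, h1, rfl⟩ := mem_segment_iff_exists_smul.1 hp
    obtain ⟨α, β, γ, hα, hβ, hγ, hs, he⟩ := mem_convexHull_triangle_iff.1 hT
    have h2 := congrArg f he
    simp only [map_add, map_smul, smul_eq_mul, ha, ha', hd, hd'] at h2
    have hαt : α = t := by
      have : α = 1 - β - γ := by linarith
      rw [this] at h2
      linarith
    subst hαt
    have h3 : β • d + α • d' = α • a' + β • a := by
      rw [← sub_eq_zero] at he ⊢
      rw [← he, show γ = 1 - α - β by linarith]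
      module
    rcases hβ.eq_or_lt with hβ | hβ
    · rw [← hβ] at h3
      have h4 : α • (d' - a') = 0 := by
        rw [← sub_eq_zero] at h3
        rw [← h3]
        module
      rw [smul_eq_zero, sub_eq_zero] at h4
      rw [h4.resolve_right had'.symm, mem_singleton_iff]
      module
    · exfalso
      have hpos : 0 < β + α := by linarith
      have hz : (β / (β + α)) • a + (α / (β + α)) • a' ∈ segment ℝ d d' := by
        refine ⟨β / (β + α), α / (β + α), by positivity, by positivity, by field_simp, ?_⟩
        rw [div_eq_inv_mul, div_eq_inv_mul, mul_smul, mul_smul, mul_smul, mul_smul, ← smul_add,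
          ← smul_add, h3, add_comm (α • a')]
      exact disjoint_left.1 hdisj
        ⟨_, _, by positivity, by positivity, by field_simp, rfl⟩ hz

end Moves

/-! ### Simple polygons and their height functions -/

/-- A closed polygon with vertices `v 0`, ..., `v (n - 1)`, `v n = v 0`, continued periodically,
that does not intersect itself. -/
structure IsSimplePolygon (n : ℕ) (v : ℕ → Space) : Prop where
  three_le : 3 ≤ n
  periodic : ∀ i, v (i + n) = v i
  inj : ∀ i j, v i = v j → i ≡ j [MOD n]
  inter : ∀ i j, ¬ i ≡ j [MOD n] →
    segment ℝ (v i) (v (i + 1)) ∩ segment ℝ (v j) (v (j + 1)) ⊆ {v i, v (i + 1)}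

namespace IsSimplePolygon

variable {n : ℕ} {v : ℕ → Space}

theorem shift (h : IsSimplePolygon n v) (r : ℕ) : IsSimplePolygon n fun i => v (i + r) where
  three_le := h.three_le
  periodic i := by rw [add_right_comm, h.periodic]
  inj i j hij := Nat.ModEq.add_right_cancel' r (h.inj _ _ hij)
  inter i j hij := by
    have := h.inter (i + r) (j + r) fun hc => hij (Nat.ModEq.add_right_cancel' r hc)
    simpa only [add_right_comm _ 1 r] using this

theorem polyPath_shift (v : ℕ → Space) (r s t : ℕ) :
    polyPath (fun i => v (i + r)) s t = polyPath v (s + r) (t + r) := by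
  ext p
  simp only [mem_polyPath]
  constructor
  · rintro ⟨i, h1, h2, h3⟩
    exact ⟨i + r, by omega, by omega, by rwa [add_right_comm] at h3⟩
  · rintro ⟨i, h1, h2, h3⟩
    refine ⟨i - r, by omega, by omega, ?_⟩
    rwa [Nat.sub_add_cancel (by omega), add_right_comm, Nat.sub_add_cancel (by omega)]

theorem polyPath_period (hp : ∀ i, v (i + n) = v i) (r : ℕ) :
    polyPath v r (r + n) = polyPath v 0 n := by
  induction r with
  | zero => simp
  | succ r ih =>
    rw [← ih]
    rcases Nat.eq_zero_or_pos n with rfl | hn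
    · simp
    · rw [polyPath_eq_segment_union (show r < r + n by omega), add_right_comm,
        polyPath_succ (show r + 1 ≤ r + n by omega), union_comm, hp r, add_right_comm, hp (r + 1)]

theorem polyPath_shift_period (hp : ∀ i, v (i + n) = v i) (r : ℕ) :
    polyPath (fun i => v (i + r)) 0 n = polyPath v 0 n := by
  rw [polyPath_shift, zero_add, add_comm n, polyPath_period hp]

theorem ne (h : IsSimplePolygon n v) {i j : ℕ} (hij : i < j) (hj : j < n) : v i ≠ v j := by
  intro he
  have := (h.inj _ _ he).eq_of_lt_of_lt (by omega) hj
  omega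

/-- Two edges of the arc from `v 0` to `v (n - 1)` meet at most in a common vertex. -/
theorem eq_of_mem_of_mem (h : IsSimplePolygon n v) {i j : ℕ} (hij : i < j) (hj : j + 1 < n)
    {p : Space} (hi : p ∈ segment ℝ (v i) (v (i + 1))) (hp : p ∈ segment ℝ (v j) (v (j + 1))) :
    j = i + 1 ∧ p = v j := by
  have hne : ¬ i ≡ j [MOD n] := fun hc => by
    have := hc.eq_of_lt_of_lt (by omega) (by omega)
    omega
  have key : ∀ {a b : ℕ}, a < n → b < n → p = v a → p = v b → a = b := fun ha hb h1 h2 =>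
    (h.inj _ _ (h1.symm.trans h2)).eq_of_lt_of_lt ha hb
  have h1 := h.inter i j hne ⟨hi, hp⟩
  have h2 := h.inter j i (fun hc => hne hc.symm) ⟨hp, hi⟩
  simp only [mem_insert_iff, mem_singleton_iff] at h1 h2
  rcases h1 with h1 | h1 <;> rcases h2 with h2 | h2
  · have := key (by omega) (by omega) h1 h2
    omega
  · have := key (by omega) (by omega) h1 h2
    omega
  · exact ⟨(key (by omega) (by omega) h1 h2).symm, h2⟩
  · have := key (by omega) (by omega) h1 h2
    omega

end IsSimplePolygon

/-- The edge from height `a` to height `b` goes between the levels `k` and `k + 1`. -/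
def Crosses (k a b : ℤ) : Prop :=
  a = k ∧ b = k + 1 ∨ a = k + 1 ∧ b = k

instance (k a b : ℤ) : Decidable (Crosses k a b) := by
  unfold Crosses
  infer_instance

theorem exists_crosses_of_lt {g : ℕ → ℤ} (hstep : ∀ i, |g (i + 1) - g i| ≤ 1) {k : ℤ} {s t : ℕ}
    (hst : s ≤ t) (hs : g s ≤ k) (ht : k < g t) :
    ∃ i, s ≤ i ∧ i < t ∧ Crosses k (g i) (g (i + 1)) := by
  induction t, hst using Nat.le_induction with
  | base => omega
  | succ t hst ih =>
    by_cases h : k < g t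
    · obtain ⟨i, h1, h2, h3⟩ := ih h
      exact ⟨i, h1, by omega, h3⟩
    · have := abs_le.1 (hstep t)
      exact ⟨t, hst, by omega, Or.inl ⟨by omega, by omega⟩⟩

/-- A linear height function on a polygon: heights of vertices are integers, heights change by at
most one along an edge, and at most two edges cross between two consecutive levels. -/
structure IsBridgeHeight (n : ℕ) (v : ℕ → Space) (f : Space →ₗ[ℝ] ℝ) (g : ℕ → ℤ) : Prop where
  exists_up : ∃ u, f u = 1
  height : ∀ i, f (v i) = g i
  step : ∀ i, |g (i + 1) - g i| ≤ 1
  cross : ∀ k i j l, ¬ i ≡ j [MOD n] → ¬ j ≡ l [MOD n] → ¬ i ≡ l [MOD n] →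
    Crosses k (g i) (g (i + 1)) → Crosses k (g j) (g (j + 1)) → ¬ Crosses k (g l) (g (l + 1))

namespace IsBridgeHeight

variable {n : ℕ} {v : ℕ → Space} {f : Space →ₗ[ℝ] ℝ} {g : ℕ → ℤ}

theorem shift (h : IsBridgeHeight n v f g) (r : ℕ) :
    IsBridgeHeight n (fun i => v (i + r)) f fun i => g (i + r) where
  exists_up := h.exists_up
  height i := h.height _
  step i := by
    have := h.step (i + r)
    rwa [add_right_comm] at this
  cross k i j l h1 h2 h3 h4 h5 := by
    have := h.cross k (i + r) (j + r) (l + r) (fun hc => h1 (Nat.ModEq.add_right_cancel' r hc))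
      (fun hc => h2 (Nat.ModEq.add_right_cancel' r hc))
      (fun hc => h3 (Nat.ModEq.add_right_cancel' r hc))
    simp only [add_right_comm _ r 1] at this
    exact this h4 h5

theorem not_crosses (h : IsBridgeHeight n v f g) {k : ℤ} {i j l : ℕ} (hij : i < j) (hjl : j < l)
    (hl : l < n) (h1 : Crosses k (g i) (g (i + 1))) (h2 : Crosses k (g j) (g (j + 1)))
    (h3 : Crosses k (g l) (g (l + 1))) : False :=
  h.cross k i j l
    (fun hc => by have := hc.eq_of_lt_of_lt (by omega) (by omega); omega)
    (fun hc => by have := hc.eq_of_lt_of_lt (by omega) (by omega); omega)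
    (fun hc => by have := hc.eq_of_lt_of_lt (by omega) (by omega); omega) h1 h2 h3

theorem height_le_of_mem_polyPath (h : IsBridgeHeight n v f g) {s t : ℕ} {k : ℤ}
    (hk : ∀ i, s ≤ i → i ≤ t → g i ≤ k) {p : Space} (hp : p ∈ polyPath v s t) : f p ≤ k := by
  obtain ⟨i, h1, h2, h3⟩ := mem_polyPath.1 hp
  refine height_le_of_mem_segment ?_ ?_ h3
  · rw [h.height]; exact_mod_cast hk i h1 (by omega)
  · rw [h.height]; exact_mod_cast hk (i + 1) (by omega) (by omega)

/-- An arc closed up by two segments to an apex above it is a trivial knot. -/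
theorem ambientIsotopic_cone (hv : IsSimplePolygon n v) (h : IsBridgeHeight n v f g) (m : ℕ) :
    ∀ (s t : ℕ) (A : Space) (k : ℤ), t - s = m → s < t → t < n → g s = k → g t = k →
      (∀ i, s ≤ i → i ≤ t → g i ≤ k) → (k : ℝ) < f A →
      AmbientIsotopic (segment ℝ A (v s) ∪ polyPath v s t ∪ segment ℝ (v t) A) roundCircle := by
  induction m using Nat.strong_induction_on with
  | _ m ih =>
  intro s t A k hm hst htn hs ht hle hA
  have fs : f (v s) = k := by rw [h.height, hs]
  have ft : f (v t) = k := by rw [h.height, ht]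
  have nst : v s ≠ v t := hv.ne hst htn
  have tri : ∀ B, f B ≠ k → ∀ S, S = segment ℝ B (v s) ∪ segment ℝ (v s) (v t) ∪
      segment ℝ B (v t) → AmbientIsotopic S roundCircle := by
    rintro B hB S rfl
    exact (noncollinear_of_height fs ft hB nst).ambientIsotopic_roundCircle
  rcases (Nat.succ_le_of_lt hst).eq_or_lt with hst1 | hst1
  · refine tri A hA.ne' _ ?_
    rw [← hst1, polyPath_succ le_rfl, polyPath_self, empty_union, segment_symm ℝ _ A]
  -- A horizontal first or last edge is removed by sliding the end of the segment from `A` along it.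
  by_cases h1 : g (s + 1) = k
  · have fs1 : f (v (s + 1)) = k := by rw [h.height, h1]
    have hmem : ∀ j, s + 1 ≤ j → j < t → ∀ p, p ∈ segment ℝ (v j) (v (j + 1)) →
        p ∈ segment ℝ (v s) (v (s + 1)) → j = s + 1 ∧ p = v j := fun j hj hjt p hp hp' =>
      hv.eq_of_mem_of_mem (by omega) (by omega) hp' hp
    have key := ambientIsotopic_cone_step (R := polyPath v (s + 1) t) fs fs1 hA
      (hv.ne (by omega) (by omega)) ft isPolyhedral_polyPath
      (fun p hp => h.height_le_of_mem_polyPath (fun i hi hi' => hle i (by omega) hi') hp)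
      (by
        rintro p ⟨hp, hp'⟩
        obtain ⟨j, hj, hjt, hpj⟩ := mem_polyPath.1 hp
        obtain ⟨rfl, rfl⟩ := hmem j hj hjt p hpj hp'
        rfl)
      (by
        intro hc
        obtain ⟨j, rfl⟩ : ∃ j, t = j + 1 := ⟨t - 1, by omega⟩
        obtain ⟨rfl, he⟩ := hmem j (by omega) (by omega) _ (right_mem_segment ℝ _ _) hc
        exact hv.ne (by omega) htn he.symm)
    rw [polyPath_eq_segment_union hst]
    have := ih _ (by omega) (s + 1) t A k rfl hst1 htn h1 ht (fun i hi hi' => hle i (by omega) hi')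
      hA
    rw [union_assoc] at this
    refine AmbientIsotopic.trans ?_ this
    rw [← union_assoc, union_assoc]
    exact key.symm
  obtain ⟨u, rfl⟩ : ∃ u, t = u + 1 := ⟨t - 1, by omega⟩
  by_cases h2 : g u = k
  · have fu : f (v u) = k := by rw [h.height, h2]
    have key := ambientIsotopic_cone_step (R := polyPath v s u) ft fu hA
      (hv.ne (by omega) (by omega)).symm fs isPolyhedral_polyPath
      (fun p hp => h.height_le_of_mem_polyPath (fun i hi hi' => hle i hi (by omega)) hp)
      (by
        rintro p ⟨hp, hp'⟩
        rw [segment_symm] at hp'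
        obtain ⟨j, hj, hjt, hpj⟩ := mem_polyPath.1 hp
        obtain ⟨rfl, rfl⟩ := hv.eq_of_mem_of_mem hjt (by omega) hpj hp'
        rfl)
      (by
        intro hc
        rw [segment_symm] at hc
        obtain ⟨-, he⟩ := hv.eq_of_mem_of_mem (show s < u by omega) (by omega)
          (left_mem_segment ℝ _ _) hc
        exact hv.ne (by omega) (by omega) he)
    rw [polyPath_succ (by omega)]
    have := ih _ (by omega) s u A k rfl (by omega) (by omega) hs h2
      (fun i hi hi' => hle i hi (by omega)) hA
    rw [segment_symm ℝ A, segment_symm ℝ (v u)] at this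
    rw [segment_symm ℝ A, segment_symm ℝ (v u), segment_symm ℝ (v (u + 1)) A]
    refine AmbientIsotopic.trans ?_ this
    refine cast ?_ key.symm
    congr 1 <;> ac_rfl
  have h1' : g (s + 1) = k - 1 := by
    have := abs_le.1 (h.step s)
    have := hle (s + 1) (by omega) (by omega)
    omega
  have h2' : g u = k - 1 := by
    have := abs_le.1 (h.step u)
    have := hle u (by omega) (by omega)
    omega
  -- Both end edges now descend and use up the two edges allowed between the levels `k - 1` and `k`,
  -- so the arc between them cannot return to level `k`.
  have hle' : ∀ i, s + 1 ≤ i → i ≤ u → g i ≤ k - 1 := by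
    intro i hi hi'
    by_contra hc
    obtain ⟨j, hj1, hj2, hj3⟩ := exists_crosses_of_lt h.step (k := k - 1) hi (by omega) (by omega)
    exact h.not_crosses (show s < j by omega) (show j < u by omega) (by omega)
      (Or.inr ⟨by omega, h1'⟩) hj3 (Or.inl ⟨h2', by omega⟩)
  have fs1 : f (v (s + 1)) = (k : ℝ) - 1 := by rw [h.height, h1']; push_cast; rfl
  have fu : f (v u) = (k : ℝ) - 1 := by rw [h.height, h2']; push_cast; rfl
  have ends : ∀ {a a' p : Space}, f a = k → f a' = k - 1 → p ∈ segment ℝ a a' → k ≤ f p →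
      p = a := by
    intro a a' p ha ha' hp hk
    obtain ⟨t, h0, -, rfl⟩ := mem_segment_iff_exists_smul.1 hp
    simp only [map_add, map_smul, smul_eq_mul, ha, ha'] at hk
    rw [show t = 0 by linarith]
    module
  -- The apex is first flattened onto the horizontal segment from `v s` to `v (u + 1)`. Then `key`
  -- cuts off the corner `v s`, and `v (u + 1)` becomes the apex over a shorter arc one level lower.
  have flat := ambientIsotopic_insert_apex (R := polyPath v s (u + 1)) fs ft hA nst
    isPolyhedral_polyPath (fun p hp => h.height_le_of_mem_polyPath hle hp)
    (by
      rintro p ⟨hp, hp'⟩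
      have hk : (k : ℝ) ≤ f p := le_height_of_mem_segment fs.ge ft.ge hp'
      obtain ⟨j, hj, hju, hpj⟩ := mem_polyPath.1 hp
      rcases hj.eq_or_lt with rfl | hj
      · exact Or.inl (ends fs fs1 hpj hk)
      rcases (Nat.le_of_lt_succ hju).eq_or_lt with rfl | hju
      · rw [segment_symm] at hpj
        exact Or.inr (ends ft fu hpj hk)
      · exfalso
        have : f p ≤ ((k - 1 : ℤ) : ℝ) :=
          h.height_le_of_mem_polyPath hle' (mem_polyPath.2 ⟨j, hj, hju, hpj⟩)
        push_cast at this
        linarith)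
  have flat' : AmbientIsotopic
      (segment ℝ A (v s) ∪ polyPath v s (u + 1) ∪ segment ℝ (v (u + 1)) A)
      (segment ℝ (v s) (v (u + 1)) ∪ polyPath v s (u + 1)) := by
    refine cast ?_ flat.symm
    rw [segment_symm ℝ (v s) A, segment_symm ℝ A (v (u + 1))]
    congr 1
    ac_rfl
  refine flat'.trans ?_
  rw [polyPath_eq_segment_union hst, polyPath_succ (show s + 1 ≤ u by omega)]
  rcases (show s + 1 ≤ u by omega).eq_or_lt with hsu | hsu
  · obtain rfl : u = s + 1 := hsu.symm
    refine tri (v (s + 1)) (by rw [fu]; linarith) _ ?_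
    rw [polyPath_self, empty_union, segment_symm ℝ (v (s + 1)) (v s)]
    ac_rfl
  · have key := ambientIsotopic_drop_step (R := polyPath v (s + 1) u) fs ft fs1 fu nst
      (hv.ne hsu (by omega))
      (by
        rw [disjoint_left]
        intro p hp hp'
        rw [segment_symm] at hp'
        have := (hv.eq_of_mem_of_mem (show s < u by omega) htn hp hp').1
        omega)
      isPolyhedral_polyPath
      (fun p hp => by
        have := h.height_le_of_mem_polyPath hle' hp
        push_cast at this
        exact this)
    have next := ih _ (by omega) (s + 1) u (v (u + 1)) (k - 1) rfl hsu (by omega) h1' h2' hle'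
      (by rw [ft]; push_cast; linarith)
    refine AmbientIsotopic.trans ?_ next
    rw [segment_symm ℝ (v (u + 1)) (v (s + 1)), union_assoc, segment_symm ℝ (v u)]
    refine cast ?_ key.symm
    rw [segment_symm ℝ (v (s + 1)) (v s)]
    congr 1
    ac_rfl

/-- An apex inserted above the top edge from `v (n - 1)` to `v 0` makes the polygon a closed-up arc
as in `ambientIsotopic_cone`. -/
theorem ambientIsotopic_roundCircle_of_flat_top (hv : IsSimplePolygon n v)
    (h : IsBridgeHeight n v f g) (h0 : g (n - 1) = g 0) (hmax : ∀ i, g i ≤ g 0) :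
    AmbientIsotopic (polyPath v 0 n) roundCircle := by
  have h3 := hv.three_le
  obtain ⟨m, rfl⟩ : ∃ m, n = m + 1 := ⟨n - 1, by omega⟩
  rw [Nat.add_sub_cancel] at h0
  obtain ⟨u, hu⟩ := h.exists_up
  have hA : (g 0 : ℝ) < f (v 0 + u) := by rw [map_add, hu, h.height]; linarith
  have hm : v (m + 1) = v 0 := by simpa using hv.periodic 0
  have key := ambientIsotopic_insert_apex (R := polyPath v 0 m) (f := f) (a := v m) (b := v 0)
    (by rw [h.height, h0]) (h.height 0) hA (hv.ne (by omega) (by omega)).symm isPolyhedral_polyPath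
    (fun p hp => h.height_le_of_mem_polyPath (fun i _ _ => hmax i) hp)
    (by
      rintro p ⟨hp, hp'⟩
      obtain ⟨j, -, hj, hpj⟩ := mem_polyPath.1 hp
      rw [← hm] at hp' ⊢
      refine hv.inter m j (fun hc => ?_) ⟨hp', hpj⟩
      have := hc.eq_of_lt_of_lt (by omega) (by omega)
      omega)
  rw [polyPath_succ (Nat.zero_le m), hm, union_comm]
  refine key.trans ?_
  have := h.ambientIsotopic_cone hv m 0 m (v 0 + u) (g 0) rfl (by omega) (by omega) rfl h0
    (fun i _ _ => hmax i) hA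
  refine cast ?_ this
  congr 1
  ac_rfl

/-- Here `v 0` is itself the apex: its two edges are the only ones just below the top level, so the
rest is an arc lying at least one level lower. -/
theorem ambientIsotopic_roundCircle_of_pointed_top (hv : IsSimplePolygon n v)
    (h : IsBridgeHeight n v f g) (hmax : ∀ i, g i ≤ g 0) (h1 : g 1 ≠ g 0) (h0 : g (n - 1) ≠ g 0)
    (hn : g n = g 0) : AmbientIsotopic (polyPath v 0 n) roundCircle := by
  have h3 := hv.three_le
  obtain ⟨m, rfl⟩ : ∃ m, n = m + 1 := ⟨n - 1, by omega⟩
  rw [Nat.add_sub_cancel] at h0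
  have hm : v (m + 1) = v 0 := by simpa using hv.periodic 0
  have h1' : g 1 = g 0 - 1 := by
    have := abs_le.1 (h.step 0)
    have := hmax 1
    rw [zero_add] at *
    omega
  have hm' : g m = g 0 - 1 := by
    have := abs_le.1 (h.step m)
    have := hmax m
    omega
  have hle : ∀ i, 1 ≤ i → i ≤ m → g i ≤ g 0 - 1 := by
    intro i hi hi'
    by_contra hc
    obtain ⟨j, hj1, hj2, hj3⟩ :=
      exists_crosses_of_lt h.step (k := g 0 - 1) hi (by omega) (by omega)
    exact h.not_crosses (show 0 < j by omega) (show j < m by omega) (by omega)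
      (Or.inr ⟨by omega, h1'⟩) hj3 (Or.inl ⟨hm', by omega⟩)
  have := h.ambientIsotopic_cone hv (m - 1) 1 m (v 0) (g 0 - 1) rfl (by omega) (by omega) h1' hm'
    hle (by rw [h.height]; push_cast; linarith)
  rwa [polyPath_succ (Nat.zero_le m), polyPath_eq_segment_union (show 0 < m by omega), hm]

/-- A polygon with a linear height function such that at most two edges lie between any two
consecutive levels is a trivial knot. -/
theorem ambientIsotopic_roundCircle (hv : IsSimplePolygon n v) (h : IsBridgeHeight n v f g)
    (hg : ∀ i, g (i + n) = g i) :
    AmbientIsotopic (polyPath v 0 n) roundCircle := by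
  have h3 := hv.three_le
  obtain ⟨r, -, hr⟩ := Finset.exists_max_image (Finset.range n) g ⟨0, by simp; omega⟩
  have hmax : ∀ i, g i ≤ g r := by
    intro i
    have hper : Function.Periodic g n := hg
    rw [← hper.map_mod_nat i]
    exact hr _ (Finset.mem_range.2 (Nat.mod_lt _ (by omega)))
  by_cases hflat : ∃ q, g q = g r ∧ g (q + 1) = g r
  · obtain ⟨q, hq, hq1⟩ := hflat
    rw [← IsSimplePolygon.polyPath_shift_period hv.periodic (q + 1)]
    refine (h.shift (q + 1)).ambientIsotopic_roundCircle_of_flat_top (hv.shift _) ?_ fun i => ?_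
    · rw [show n - 1 + (q + 1) = q + n by omega, hg, zero_add, hq, hq1]
    · rw [zero_add, hq1]
      exact hmax _
  · push Not at hflat
    rw [← IsSimplePolygon.polyPath_shift_period hv.periodic r]
    refine (h.shift r).ambientIsotopic_roundCircle_of_pointed_top (hv.shift _) (fun i => ?_) ?_ ?_ ?_
    · rw [zero_add]
      exact hmax _
    · rw [zero_add, add_comm]
      exact hflat r rfl
    · intro hc
      refine hflat (n - 1 + r) (by simpa using hc) ?_
      rw [show n - 1 + r + 1 = r + n by omega, hg]
    · rw [add_comm, hg, zero_add]

end IsBridgeHeight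

/-! ### The simple hexagonal lattice in sheared coordinates -/

/-- The space point with given integer coordinates. -/
noncomputable def latPt (p : ℤ × ℤ × ℤ) : Space := !₂[(p.1 : ℝ), (p.2.1 : ℝ), (p.2.2 : ℝ)]

@[simp] theorem latPt_zero (p : ℤ × ℤ × ℤ) : latPt p 0 = p.1 := rfl
@[simp] theorem latPt_one (p : ℤ × ℤ × ℤ) : latPt p 1 = p.2.1 := rfl
@[simp] theorem latPt_two (p : ℤ × ℤ × ℤ) : latPt p 2 = p.2.2 := rfl

theorem space_ext {p q : Space} (h0 : p 0 = q 0) (h1 : p 1 = q 1) (h2 : p 2 = q 2) : p = q := by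
  ext i
  fin_cases i
  exacts [h0, h1, h2]

theorem latPt_injective : Function.Injective latPt := by
  intro p q h
  have h0 := congrArg (fun z : Space => z 0) h
  have h1 := congrArg (fun z : Space => z 1) h
  have h2 := congrArg (fun z : Space => z 2) h
  simp only [latPt_zero, latPt_one, latPt_two, Int.cast_inj] at h0 h1 h2
  exact Prod.ext h0 (Prod.ext h1 h2)

/-- The directions `x`, `y`, `z = y - x`, `w` of the simple hexagonal lattice. -/
def latDir : Fin 4 → ℤ × ℤ × ℤ :=
  ![(1, 0, 0), (0, 1, 0), (-1, 1, 0), (0, 0, 1)]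

/-- Two lattice points are the ends of an edge in direction number `t`. -/
def IsStep (t : Fin 4) (p q : ℤ × ℤ × ℤ) : Prop :=
  q = p + latDir t ∨ p = q + latDir t

/-- Two lattice points are the ends of an edge. -/
def LatAdj (p q : ℤ × ℤ × ℤ) : Prop :=
  ∃ t, IsStep t p q

instance (t : Fin 4) (p q : ℤ × ℤ × ℤ) : Decidable (IsStep t p q) := by
  unfold IsStep
  infer_instance

theorem IsStep.symm {t : Fin 4} {p q : ℤ × ℤ × ℤ} (h : IsStep t p q) : IsStep t q p :=
  Or.symm h

theorem LatAdj.symm {p q : ℤ × ℤ × ℤ} (h : LatAdj p q) : LatAdj q p :=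
  h.imp fun _ => IsStep.symm

theorem isStep_zero {p q : ℤ × ℤ × ℤ} : IsStep 0 p q ↔
    (q.1 = p.1 + 1 ∨ p.1 = q.1 + 1) ∧ q.2.1 = p.2.1 ∧ q.2.2 = p.2.2 := by
  simp only [IsStep, latDir, Prod.ext_iff, Prod.fst_add, Prod.snd_add, Matrix.cons_val]
  omega

theorem isStep_one {p q : ℤ × ℤ × ℤ} : IsStep 1 p q ↔
    (q.2.1 = p.2.1 + 1 ∨ p.2.1 = q.2.1 + 1) ∧ q.1 = p.1 ∧ q.2.2 = p.2.2 := by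
  simp only [IsStep, latDir, Prod.ext_iff, Prod.fst_add, Prod.snd_add, Matrix.cons_val]
  omega

theorem isStep_two {p q : ℤ × ℤ × ℤ} : IsStep 2 p q ↔
    (q.1 = p.1 - 1 ∧ q.2.1 = p.2.1 + 1 ∨ p.1 = q.1 - 1 ∧ p.2.1 = q.2.1 + 1) ∧
      q.2.2 = p.2.2 := by
  simp only [IsStep, latDir, Prod.ext_iff, Prod.fst_add, Prod.snd_add, Matrix.cons_val]
  omega

theorem isStep_three {p q : ℤ × ℤ × ℤ} : IsStep 3 p q ↔
    (q.2.2 = p.2.2 + 1 ∨ p.2.2 = q.2.2 + 1) ∧ q.1 = p.1 ∧ q.2.1 = p.2.1 := by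
  simp only [IsStep, latDir, Prod.ext_iff, Prod.fst_add, Prod.snd_add, Matrix.cons_val]
  omega

theorem latAdj_iff {p q : ℤ × ℤ × ℤ} :
    LatAdj p q ↔ IsStep 0 p q ∨ IsStep 1 p q ∨ IsStep 2 p q ∨ IsStep 3 p q := by
  constructor
  · rintro ⟨t, ht⟩
    fin_cases t
    exacts [Or.inl ht, Or.inr (Or.inl ht), Or.inr (Or.inr (Or.inl ht)),
      Or.inr (Or.inr (Or.inr ht))]
  · rintro (h | h | h | h)
    exacts [⟨_, h⟩, ⟨_, h⟩, ⟨_, h⟩, ⟨_, h⟩]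

theorem latAdj_iff_coords {p q : ℤ × ℤ × ℤ} : LatAdj p q ↔
    ((q.1 = p.1 + 1 ∨ p.1 = q.1 + 1) ∧ q.2.1 = p.2.1 ∧ q.2.2 = p.2.2) ∨
    ((q.2.1 = p.2.1 + 1 ∨ p.2.1 = q.2.1 + 1) ∧ q.1 = p.1 ∧ q.2.2 = p.2.2) ∨
    ((q.1 = p.1 - 1 ∧ q.2.1 = p.2.1 + 1 ∨ p.1 = q.1 - 1 ∧ p.2.1 = q.2.1 + 1) ∧
      q.2.2 = p.2.2) ∨
    ((q.2.2 = p.2.2 + 1 ∨ p.2.2 = q.2.2 + 1) ∧ q.1 = p.1 ∧ q.2.1 = p.2.1) := by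
  rw [latAdj_iff, isStep_zero, isStep_one, isStep_two, isStep_three]

/-! ### Neighbourhoods of edges -/

/-- The part, in the lower half of its cell, of the region swept out when the diagonal edge with
lower end `s` is bent: above the diagonal if the cell does not lie to the left of the column
number `k`, and below the diagonal otherwise. -/
def lowerBend (k : ℤ) (s : ℤ × ℤ × ℤ) (p : Space) : Prop :=
  p 2 = s.2.2 ∧
    ((k < s.1 ∧ p 0 ≤ s.1 ∧ p 1 ≤ s.2.1 + 1 / 2 ∧ (s.1 : ℝ) + s.2.1 ≤ p 0 + p 1) ∨
      (s.1 ≤ k ∧ s.1 - 1 / 2 ≤ p 0 ∧ s.2.1 ≤ p 1 ∧ p 0 + p 1 ≤ s.1 + s.2.1))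

/-- The part in the upper half of the cell of the region swept out when the diagonal edge with
lower end `s` is bent: above the diagonal if the cell lies to the right of the column
number `k`, and below the diagonal otherwise. -/
def upperBend (k : ℤ) (s : ℤ × ℤ × ℤ) (p : Space) : Prop :=
  p 2 = s.2.2 ∧
    ((k + 1 < s.1 ∧ p 0 ≤ s.1 - 1 / 2 ∧ p 1 ≤ s.2.1 + 1 ∧ (s.1 : ℝ) + s.2.1 ≤ p 0 + p 1) ∨
      (s.1 ≤ k + 1 ∧ s.1 - 1 ≤ p 0 ∧ s.2.1 + 1 / 2 ≤ p 1 ∧ p 0 + p 1 ≤ s.1 + s.2.1))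

/-- The edge in direction number `t` from `s`, with the region swept out by bending it. -/
def fatEdge (k : ℤ) (t : Fin 4) (s : ℤ × ℤ × ℤ) (p : Space) : Prop :=
  match t with
  | 0 => s.1 ≤ p 0 ∧ p 0 ≤ s.1 + 1 ∧ p 1 = s.2.1 ∧ p 2 = s.2.2
  | 1 => s.2.1 ≤ p 1 ∧ p 1 ≤ s.2.1 + 1 ∧ p 0 = s.1 ∧ p 2 = s.2.2
  | 2 => lowerBend k s p ∨ upperBend k s p
  | 3 => s.2.2 ≤ p 2 ∧ p 2 ≤ s.2.2 + 1 ∧ p 0 = s.1 ∧ p 1 = s.2.1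

/-- An edge makes an acute angle with the diagonal edge with lower end `s`. -/
def IsAcute (s : ℤ × ℤ × ℤ) (t' : Fin 4) (s' : ℤ × ℤ × ℤ) : Prop :=
  s'.2.2 = s.2.2 ∧
    ((t' = 0 ∧ s'.1 = s.1 - 1 ∧ (s'.2.1 = s.2.1 ∨ s'.2.1 = s.2.1 + 1)) ∨
      (t' = 1 ∧ s'.2.1 = s.2.1 ∧ (s'.1 = s.1 - 1 ∨ s'.1 = s.1)))

theorem int_cases_of_le {i j : ℤ} {x : ℝ} (h1 : (i : ℝ) ≤ x) (h2 : x ≤ i + 1) (h3 : (j : ℝ) ≤ x)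
    (h4 : x ≤ j + 1) : j = i - 1 ∨ j = i ∨ j = i + 1 := by
  have h5 : (i : ℝ) ≤ (j + 1 : ℤ) := by push_cast; linarith
  have h6 : (j : ℝ) ≤ (i + 1 : ℤ) := by push_cast; linarith
  rw [Int.cast_le] at h5 h6
  omega

theorem lowerBend.bounds {k : ℤ} {s : ℤ × ℤ × ℤ} {p : Space} (h : lowerBend k s p) :
    s.1 - 1 / 2 ≤ p 0 ∧ p 0 ≤ s.1 ∧ s.2.1 ≤ p 1 ∧ p 1 ≤ s.2.1 + 1 / 2 := by
  obtain ⟨-, ⟨-, h1, h2, h3⟩ | ⟨-, h1, h2, h3⟩⟩ := h <;>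
    exact ⟨by linarith, by linarith, by linarith, by linarith⟩

theorem upperBend.bounds {k : ℤ} {s : ℤ × ℤ × ℤ} {p : Space} (h : upperBend k s p) :
    s.1 - 1 ≤ p 0 ∧ p 0 ≤ s.1 - 1 / 2 ∧ s.2.1 + 1 / 2 ≤ p 1 ∧ p 1 ≤ s.2.1 + 1 := by
  obtain ⟨-, ⟨-, h1, h2, h3⟩ | ⟨-, h1, h2, h3⟩⟩ := h <;>
    exact ⟨by linarith, by linarith, by linarith, by linarith⟩

/-- The bounding box of a fat edge. -/
theorem fatEdge.bounds {k : ℤ} {s : ℤ × ℤ × ℤ} {p : Space} (h : fatEdge k 2 s p) :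
    s.1 - 1 ≤ p 0 ∧ p 0 ≤ s.1 ∧ s.2.1 ≤ p 1 ∧ p 1 ≤ s.2.1 + 1 ∧ p 2 = s.2.2 := by
  rcases h with h | h
  · have := h.bounds
    exact ⟨by linarith, by linarith, by linarith, by linarith, h.1⟩
  · have := h.bounds
    exact ⟨by linarith, by linarith, by linarith, by linarith, h.1⟩

/-- Half cells of different cells touch in three ways. The contact at `s` is the common end of two
diagonals. The contacts at the middle of a vertical or of a horizontal lattice edge are excluded by
the thresholds: the first would need `k < i` and `i + 1 ≤ k + 1`, the second `i ≤ k` and `k + 1 <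
i`, where `i = s.1`. -/
theorem lowerBend_upperBend {k : ℤ} {s s' : ℤ × ℤ × ℤ} {p : Space}
    (h : lowerBend k s p) (h' : upperBend k s' p) :
    s = s' ∨ (p = latPt s ∧ s = s' + latDir 2) := by
  obtain ⟨i, j, l⟩ := s
  obtain ⟨i', j', l'⟩ := s'
  have b := h.bounds
  have b' := h'.bounds
  obtain ⟨hl, h⟩ := h
  obtain ⟨hl', h'⟩ := h'
  simp only at b b' hl hl' h h'
  obtain rfl : l = l' := by exact_mod_cast hl.symm.trans hl'
  have hi := int_cases_of_le (i := i - 1) (j := i' - 1) (x := p 0) (by push_cast; linarith)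
    (by push_cast; linarith) (by push_cast; linarith) (by push_cast; linarith)
  have hj := int_cases_of_le (i := j) (j := j') (x := p 1) (by linarith) (by linarith)
    (by linarith) (by linarith)
  have hi' : i' = i - 1 ∨ i' = i ∨ i' = i + 1 := by omega
  clear hi
  rcases hi' with rfl | rfl | rfl
  · exfalso
    push_cast at b'
    linarith
  · rcases hj with rfl | rfl | rfl
    · exfalso
      push_cast at b' h'
      rcases h with ⟨hk, h⟩ | ⟨hk, h⟩
      · linarith
      · rcases h' with ⟨hk', h'⟩ | ⟨hk', h'⟩
        · omega
        · linarith
    · exact Or.inl rfl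
    · exfalso
      push_cast at b'
      linarith
  · rcases hj with rfl | rfl | rfl
    · right
      push_cast at b'
      refine ⟨space_ext ?_ ?_ hl, ?_⟩
      · simp only [latPt_zero]
        linarith
      · simp only [latPt_one]
        linarith
      · simp [latDir]
    · exfalso
      push_cast at b' h'
      rcases h with ⟨hk, h⟩ | ⟨hk, h⟩
      · rcases h' with ⟨hk', h'⟩ | ⟨hk', h'⟩
        · linarith
        · omega
      · linarith
    · exfalso
      push_cast at b'
      linarith

/-- Boxes of side `1 / 2` in the same relative position in different unit cells are disjoint, so two
lower bends, or two upper bends, never meet. -/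
theorem eq_of_half_boxes {s s' : ℤ × ℤ × ℤ} {p : Space} {a b : ℝ}
    (h : s.1 + a ≤ p 0 ∧ p 0 ≤ s.1 + a + 1 / 2 ∧ s.2.1 + b ≤ p 1 ∧ p 1 ≤ s.2.1 + b + 1 / 2 ∧
      p 2 = s.2.2)
    (h' : s'.1 + a ≤ p 0 ∧ p 0 ≤ s'.1 + a + 1 / 2 ∧ s'.2.1 + b ≤ p 1 ∧
      p 1 ≤ s'.2.1 + b + 1 / 2 ∧ p 2 = s'.2.2) : s = s' := by
  have key : ∀ {i j : ℤ} {x : ℝ}, (i : ℝ) ≤ x → x ≤ i + 1 / 2 → (j : ℝ) ≤ x → x ≤ j + 1 / 2 →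
      i = j := by
    intro i j x h1 h2 h3 h4
    rcases int_cases_of_le h1 (by linarith) h3 (by linarith) with rfl | rfl | rfl
    · push_cast at h4; linarith
    · rfl
    · push_cast at h3; linarith
  refine Prod.ext (key (x := p 0 - a) ?_ ?_ ?_ ?_) (Prod.ext (key (x := p 1 - b) ?_ ?_ ?_ ?_) ?_)
  any_goals linarith [h.1, h.2.1, h.2.2.1, h.2.2.2.1, h'.1, h'.2.1, h'.2.2.1, h'.2.2.2.1]
  exact Int.cast_injective (α := ℝ) (h.2.2.2.2.symm.trans h'.2.2.2.2)

theorem fatEdge_diag_diag {k : ℤ} {s s' : ℤ × ℤ × ℤ} {p : Space} (hne : s ≠ s')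
    (h : fatEdge k 2 s p) (h' : fatEdge k 2 s' p) : p = latPt s ∨ p = latPt (s + latDir 2) := by
  rcases h with h | h <;> rcases h' with h' | h'
  · have b := h.bounds
    have b' := h'.bounds
    exact absurd (eq_of_half_boxes (a := -1 / 2) (b := 0)
      ⟨by linarith, by linarith, by linarith, by linarith, h.1⟩
      ⟨by linarith, by linarith, by linarith, by linarith, h'.1⟩) hne
  · rcases lowerBend_upperBend h h' with h | h
    · exact absurd h hne
    · exact Or.inl h.1
  · rcases lowerBend_upperBend h' h with h | h
    · exact absurd h.symm hne
    · exact Or.inr (h.2 ▸ h.1)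
  · have b := h.bounds
    have b' := h'.bounds
    exact absurd (eq_of_half_boxes (a := -1) (b := 1 / 2)
      ⟨by linarith, by linarith, by linarith, by linarith, h.1⟩
      ⟨by linarith, by linarith, by linarith, by linarith, h'.1⟩) hne

theorem intervals_meet {i j : ℤ} {x : ℝ} (h1 : (i : ℝ) ≤ x) (h2 : x ≤ i + 1) (h3 : (j : ℝ) ≤ x)
    (h4 : x ≤ j + 1) (hne : i ≠ j) : x = i ∨ x = i + 1 := by
  rcases int_cases_of_le h1 h2 h3 h4 with rfl | rfl | rfl
  · push_cast at h4
    left; linarith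
  · exact absurd rfl hne
  · push_cast at h3
    right; linarith

theorem int_meets_interval {i j : ℤ} (h1 : (i : ℝ) ≤ (j : ℝ)) (h2 : (j : ℝ) ≤ i + 1) :
    (j : ℝ) = i ∨ (j : ℝ) = i + 1 := by
  have h3 : i ≤ j := by exact_mod_cast h1
  have h4 : j ≤ i + 1 := by exact_mod_cast h2
  rcases (show j = i ∨ j = i + 1 by omega) with rfl | rfl
  · exact Or.inl rfl
  · right; push_cast; rfl

theorem eq_latPt {p : Space} {a b c : ℤ} (h0 : p 0 = a) (h1 : p 1 = b) (h2 : p 2 = c) :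
    p = latPt (a, b, c) :=
  space_ext h0 h1 h2

theorem eq_latPt_add_latDir {p : Space} {a b c : ℤ} :
    (p 0 = a + 1 → p 1 = b → p 2 = c → p = latPt ((a, b, c) + latDir 0)) ∧
    (p 0 = a → p 1 = b + 1 → p 2 = c → p = latPt ((a, b, c) + latDir 1)) ∧
    (p 0 = a - 1 → p 1 = b + 1 → p 2 = c → p = latPt ((a, b, c) + latDir 2)) ∧
    (p 0 = a → p 1 = b → p 2 = c + 1 → p = latPt ((a, b, c) + latDir 3)) := by
  refine ⟨?_, ?_, ?_, ?_⟩ <;>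
  · intro h0 h1 h2
    apply space_ext <;> simp [latDir, h0, h1, h2]
    try ring

/-- The fat edges in the coordinate directions meet only in common ends. -/
theorem fatEdge_straight {k : ℤ} {t t' : Fin 4} {s s' : ℤ × ℤ × ℤ} {p : Space}
    (hne : (t, s) ≠ (t', s')) (ht : t ≠ 2) (ht' : t' ≠ 2)
    (h : fatEdge k t s p) (h' : fatEdge k t' s' p) : p = latPt s ∨ p = latPt (s + latDir t) := by
  obtain ⟨i, j, l⟩ := s
  obtain ⟨i', j', l'⟩ := s'
  have e0 : p 0 = i ∨ p 0 = i + 1 → p 1 = j → p 2 = l →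
      p = latPt (i, j, l) ∨ p = latPt ((i, j, l) + latDir 0) := by
    rintro (h | h) h1 h2
    exacts [Or.inl (eq_latPt h h1 h2), Or.inr (eq_latPt_add_latDir.1 h h1 h2)]
  have e1 : p 1 = j ∨ p 1 = j + 1 → p 0 = i → p 2 = l →
      p = latPt (i, j, l) ∨ p = latPt ((i, j, l) + latDir 1) := by
    rintro (h | h) h1 h2
    exacts [Or.inl (eq_latPt h1 h h2), Or.inr (eq_latPt_add_latDir.2.1 h1 h h2)]
  have e3 : p 2 = l ∨ p 2 = l + 1 → p 0 = i → p 1 = j →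
      p = latPt (i, j, l) ∨ p = latPt ((i, j, l) + latDir 3) := by
    rintro (h | h) h1 h2
    exacts [Or.inl (eq_latPt h1 h2 h), Or.inr (eq_latPt_add_latDir.2.2.2 h1 h2 h)]
  have inj : ∀ {x : ℝ} {a b : ℤ}, x = a → x = b → a = b := fun h h' => by
    exact_mod_cast h.symm.trans h'
  have meet : ∀ {x : ℝ} {a b : ℤ}, (a : ℝ) ≤ x → x ≤ a + 1 → x = b → x = a ∨ x = a + 1 := by
    rintro x a b h1 h2 rfl
    exact int_meets_interval h1 h2
  fin_cases t <;> fin_cases t' <;> simp [fatEdge] at h h' hne ht ht' ⊢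
  · exact e0 (intervals_meet h.1 h.2.1 h'.1 h'.2.1 fun hi =>
      hne hi (inj h.2.2.1 h'.2.2.1) (inj h.2.2.2 h'.2.2.2)) h.2.2.1 h.2.2.2
  · exact e0 (meet h.1 h.2.1 h'.2.2.1) h.2.2.1 h.2.2.2
  · exact e0 (meet h.1 h.2.1 h'.2.2.1) h.2.2.1 h.2.2.2
  · exact e1 (meet h.1 h.2.1 h'.2.2.1) h.2.2.1 h.2.2.2
  · exact e1 (intervals_meet h.1 h.2.1 h'.1 h'.2.1 fun hi =>
      hne (inj h.2.2.1 h'.2.2.1) hi (inj h.2.2.2 h'.2.2.2)) h.2.2.1 h.2.2.2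
  · exact e1 (meet h.1 h.2.1 h'.2.2.2) h.2.2.1 h.2.2.2
  · exact e3 (meet h.1 h.2.1 h'.2.2.2) h.2.2.1 h.2.2.2
  · exact e3 (meet h.1 h.2.1 h'.2.2.2) h.2.2.1 h.2.2.2
  · exact e3 (intervals_meet h.1 h.2.1 h'.1 h'.2.1 fun hi =>
      hne (inj h.2.2.1 h'.2.2.1) (inj h.2.2.2 h'.2.2.2) hi) h.2.2.1 h.2.2.2

/-- A fat diagonal edge meets a fat edge in another direction only in common ends. -/
theorem fatEdge_diag_straight {k : ℤ} {t' : Fin 4} {s s' : ℤ × ℤ × ℤ} {p : Space}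
    (ht' : t' ≠ 2) (hac : ¬ IsAcute s t' s') (h : fatEdge k 2 s p) (h' : fatEdge k t' s' p) :
    (p = latPt s ∨ p = latPt (s + latDir 2)) ∧ (p = latPt s' ∨ p = latPt (s' + latDir t')) := by
  obtain ⟨i, j, l⟩ := s
  obtain ⟨i', j', l'⟩ := s'
  have b := h.bounds
  have inj : ∀ {x : ℝ} {a b : ℤ}, x = a → x = b → a = b := fun h h' => by
    exact_mod_cast h.symm.trans h'
  have first : p 0 = i ∧ p 1 = j ∨ p 0 = i - 1 ∧ p 1 = j + 1 →
      p = latPt (i, j, l) ∨ p = latPt ((i, j, l) + latDir 2) := by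
    rintro (h | h)
    exacts [Or.inl (eq_latPt h.1 h.2 b.2.2.2.2),
      Or.inr (eq_latPt_add_latDir.2.2.1 h.1 h.2 b.2.2.2.2)]
  have meet : ∀ {x : ℝ} {a b : ℤ}, (a : ℝ) ≤ x → x ≤ a + 1 → x = b → x = a ∨ x = a + 1 := by
    rintro x a b h1 h2 rfl
    exact int_meets_interval h1 h2
  have away : ∀ {a b : ℤ}, ¬ a = b - 1 → (a : ℝ) ≤ b - 2 ∨ (b : ℝ) ≤ a := by
    intro a b hab
    rcases (show a ≤ b - 2 ∨ b ≤ a by omega) with h | h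
    · left; exact_mod_cast h
    · right; exact_mod_cast h
  fin_cases t'
  · simp [fatEdge] at h' ⊢
    simp only at b
    obtain ⟨h1, h2, h3, h4⟩ := h'
    obtain rfl : l = l' := inj b.2.2.2.2 h4
    -- The edge lies on the line of the lower or of the upper side of the cell, but is not that
    -- side. Only one half of the swept region reaches this line, and it meets the neighbouring
    -- edges only at the end of the diagonal.
    have hor : p 0 = i ∧ p 1 = j ∨ p 0 = i - 1 ∧ p 1 = j + 1 := by
      rcases meet b.2.2.1 b.2.2.2.1 h3 with hj | hj
      · obtain rfl : j' = j := inj h3 hj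
        have hi : ¬ i' = i - 1 := fun hc => hac ⟨rfl, Or.inl ⟨rfl, hc, Or.inl rfl⟩⟩
        left
        rcases h with h | h
        · rcases away hi with hi | hi
          · linarith [h.bounds.1]
          · exact ⟨by linarith, hj⟩
        · linarith [h.bounds.2.2.1]
      · obtain rfl : j' = j + 1 := inj h3 (by push_cast; exact hj)
        have hi : ¬ i' = i - 1 := fun hc => hac ⟨rfl, Or.inl ⟨rfl, hc, Or.inr rfl⟩⟩
        right
        rcases h with h | h
        · linarith [h.bounds.2.2.2]
        · rcases away hi with hi | hi
          · exact ⟨by linarith, hj⟩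
          · linarith [h.bounds.2.1]
    refine ⟨first hor, ?_⟩
    have h0 : p 0 = i' ∨ p 0 = i' + 1 := by
      rcases hor with h | h
      · exact meet h1 h2 h.1
      · exact meet (b := i - 1) h1 h2 (by push_cast; exact h.1)
    exact h0.imp (fun h0 => eq_latPt h0 h3 h4) fun h0 => eq_latPt_add_latDir.1 h0 h3 h4
  · simp [fatEdge] at h' ⊢
    simp only at b
    obtain ⟨h1, h2, h3, h4⟩ := h'
    obtain rfl : l = l' := inj b.2.2.2.2 h4
    have hor : p 0 = i ∧ p 1 = j ∨ p 0 = i - 1 ∧ p 1 = j + 1 := by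
      rcases meet (x := p 0) (a := i - 1) (by push_cast; linarith) (by push_cast; linarith) h3
        with hi | hi
      · obtain rfl : i' = i - 1 := inj h3 hi
        have hj : ¬ j' = j := fun hc => hac ⟨rfl, Or.inr ⟨rfl, hc, Or.inl rfl⟩⟩
        push_cast at hi
        right
        rcases h with h | h
        · linarith [h.bounds.1]
        · rcases away (a := j') (b := j + 1) (by omega) with hj | hj
          · push_cast at hj
            linarith [h.bounds.2.2.1]
          · push_cast at hj
            exact ⟨hi, by linarith⟩
      · obtain rfl : i' = i := inj h3 (by push_cast at hi; linarith)
        have hj : ¬ j' = j := fun hc => hac ⟨rfl, Or.inr ⟨rfl, hc, Or.inr rfl⟩⟩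
        push_cast at hi
        left
        rcases h with h | h
        · rcases away (a := j') (b := j + 1) (by omega) with hj | hj
          · push_cast at hj
            exact ⟨h3, by linarith⟩
          · push_cast at hj
            linarith [h.bounds.2.2.2]
        · linarith [h.bounds.2.1]
    refine ⟨first hor, ?_⟩
    have h0 : p 1 = j' ∨ p 1 = j' + 1 := by
      rcases hor with h | h
      · exact meet h1 h2 h.2
      · exact meet (b := j + 1) h1 h2 (by push_cast; exact h.2)
    exact h0.imp (fun h0 => eq_latPt h3 h0 h4) fun h0 => eq_latPt_add_latDir.2.1 h3 h0 h4
  · exact absurd rfl ht'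
  · simp [fatEdge] at h' ⊢
    simp only at b
    obtain ⟨h1, h2, h3, h4⟩ := h'
    have hor : p 0 = i ∧ p 1 = j ∨ p 0 = i - 1 ∧ p 1 = j + 1 := by
      have hi := meet (x := p 0) (a := i - 1) (by push_cast; linarith) (by push_cast; linarith) h3
      have hj := meet b.2.2.1 b.2.2.2.1 h4
      push_cast at hi
      rcases h with h | h
      · have := h.bounds
        left
        constructor
        · rcases hi with hi | hi <;> linarith
        · rcases hj with hj | hj <;> linarith
      · have := h.bounds
        right
        constructor
        · rcases hi with hi | hi <;> linarith
        · rcases hj with hj | hj <;> linarith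
    refine ⟨first hor, ?_⟩
    exact (meet h1 h2 b.2.2.2.2).imp (fun h0 => eq_latPt h3 h4 h0)
      fun h0 => eq_latPt_add_latDir.2.2.2 h3 h4 h0

/-- Two different edges that do not make an acute angle have fat versions that meet only in common
ends. -/
theorem fatEdge_inter {k : ℤ} {t t' : Fin 4} {s s' : ℤ × ℤ × ℤ} {p : Space}
    (hne : (t, s) ≠ (t', s')) (h1 : t = 2 → ¬ IsAcute s t' s') (h2 : t' = 2 → ¬ IsAcute s' t s)
    (h : fatEdge k t s p) (h' : fatEdge k t' s' p) : p = latPt s ∨ p = latPt (s + latDir t) := by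
  by_cases ht : t = 2
  · subst ht
    by_cases ht' : t' = 2
    · subst ht'
      exact fatEdge_diag_diag (fun hs => hne (by rw [hs])) h h'
    · exact (fatEdge_diag_straight ht' (h1 rfl) h h').1
  · by_cases ht' : t' = 2
    · subst ht'
      exact (fatEdge_diag_straight ht (h2 rfl) h' h).2
    · exact fatEdge_straight hne ht ht' h h'

/-! ### Triangles of the lattice -/

/-- The triangle with vertices `s`, `s + x`, `s + y`, or the one with vertices `s + x`, `s + y`,
`s + x + y`. -/
def latTriangle (up : Bool) (s : ℤ × ℤ × ℤ) : Set (ℤ × ℤ × ℤ) :=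
  {q | q.2.2 = s.2.2 ∧ bif up then s.1 ≤ q.1 ∧ s.2.1 ≤ q.2.1 ∧ q.1 + q.2.1 ≤ s.1 + s.2.1 + 1 else
    q.1 ≤ s.1 + 1 ∧ q.2.1 ≤ s.2.1 + 1 ∧ s.1 + s.2.1 + 1 ≤ q.1 + q.2.1}

theorem exists_latTriangle {a b c : ℤ × ℤ × ℤ} (hab : LatAdj a b) (hbc : LatAdj b c)
    (hac : LatAdj a c) : ∃ up s, latTriangle up s = {a, b, c} := by
  obtain ⟨a1, a2, a3⟩ := a
  obtain ⟨b1, b2, b3⟩ := b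
  obtain ⟨c1, c2, c3⟩ := c
  rw [latAdj_iff_coords] at hab hbc hac
  simp only at hab hbc hac
  -- Summed over the vertices, each of the first two coordinates is `3 * s + 1` for an upright
  -- triangle and `3 * s + 2` for an inverted one; this determines the base point and the
  -- orientation.
  have key : ∀ s1 s2 : ℤ,
      (a1 + b1 + c1 = 3 * s1 + 1 → a2 + b2 + c2 = 3 * s2 + 1 →
        latTriangle true (s1, s2, a3) = {(a1, a2, a3), (b1, b2, b3), (c1, c2, c3)}) ∧
      (a1 + b1 + c1 = 3 * s1 + 2 → a2 + b2 + c2 = 3 * s2 + 2 →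
        latTriangle false (s1, s2, a3) = {(a1, a2, a3), (b1, b2, b3), (c1, c2, c3)}) := by
    intro s1 s2
    constructor <;>
    · intro h1 h2
      ext ⟨x, y, z⟩
      simp only [latTriangle, cond_true, cond_false, mem_ofPred_eq, mem_insert_iff,
        mem_singleton_iff, Prod.mk.injEq]
      rcases hab with ⟨h | h, h', h''⟩ | ⟨h | h, h', h''⟩ | ⟨⟨h, h'⟩ | ⟨h, h'⟩, h''⟩ |
          ⟨h | h, h', h''⟩ <;>
        rcases hbc with ⟨g | g, g', g''⟩ | ⟨g | g, g', g''⟩ | ⟨⟨g, g'⟩ | ⟨g, g'⟩, g''⟩ |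
          ⟨g | g, g', g''⟩ <;>
        omega
  have hup : ∃ s1 s2 : ℤ, (a1 + b1 + c1 = 3 * s1 + 1 ∧ a2 + b2 + c2 = 3 * s2 + 1) ∨
      (a1 + b1 + c1 = 3 * s1 + 2 ∧ a2 + b2 + c2 = 3 * s2 + 2) := by
    refine ⟨(a1 + b1 + c1) / 3, (a2 + b2 + c2) / 3, ?_⟩
    clear key
    omega
  obtain ⟨s1, s2, h | h⟩ := hup
  · exact ⟨true, _, (key s1 s2).1 h.1 h.2⟩
  · exact ⟨false, _, (key s1 s2).2 h.1 h.2⟩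

theorem mem_convexHull_latTriangle {up : Bool} {s : ℤ × ℤ × ℤ} {p : Space}
    (hp : p ∈ convexHull ℝ (latPt '' latTriangle up s)) :
    p 2 = s.2.2 ∧ bif up then s.1 ≤ p 0 ∧ s.2.1 ≤ p 1 ∧ p 0 + p 1 ≤ s.1 + s.2.1 + 1 else
    p 0 ≤ s.1 + 1 ∧ p 1 ≤ s.2.1 + 1 ∧ s.1 + s.2.1 + 1 ≤ p 0 + p 1 := by
  have hconv : ∀ (f : Space →ₗ[ℝ] ℝ) (r : ℝ), (∀ q ∈ latTriangle up s, f (latPt q) ≤ r) →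
      f p ≤ r := by
    intro f r h
    have := convexHull_min (s := latPt '' latTriangle up s) (t := {p | f p ≤ r})
      (by rintro _ ⟨q, hq, rfl⟩; exact h q hq) (convex_halfSpace_le f.isLinear r)
    exact this hp
  let e : Fin 3 → Space →ₗ[ℝ] ℝ := fun i => (EuclideanSpace.proj i : Space →L[ℝ] ℝ).toLinearMap
  have he : ∀ i p, e i p = p i := fun _ _ => rfl
  have h2 : p 2 = s.2.2 := by
    have h1 := hconv (e 2) s.2.2 fun q hq => by rw [he]; simp [hq.1]
    have h2 := hconv (-e 2) (-s.2.2) fun q hq => by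
      rw [LinearMap.neg_apply, he]; simp [hq.1]
    rw [LinearMap.neg_apply, he] at h2
    rw [he] at h1
    linarith
  refine ⟨h2, ?_⟩
  cases up
  · have h0 := hconv (e 0) (s.1 + 1) fun q hq => by
      have := hq.2.1
      rw [he, latPt_zero]
      exact_mod_cast this
    have h1 := hconv (e 1) (s.2.1 + 1) fun q hq => by
      have := hq.2.2.1
      rw [he, latPt_one]
      exact_mod_cast this
    have h3 := hconv (-(e 0 + e 1)) (-(s.1 + s.2.1 + 1)) fun q hq => by
      have := hq.2.2.2
      rw [LinearMap.neg_apply, LinearMap.add_apply, he, he, latPt_zero, latPt_one, neg_le_neg_iff]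
      exact_mod_cast this
    rw [LinearMap.neg_apply, LinearMap.add_apply, he, he, neg_le_neg_iff] at h3
    exact ⟨h0, h1, h3⟩
  · have h0 := hconv (-e 0) (-s.1) fun q hq => by
      have := hq.2.1
      rw [LinearMap.neg_apply, he, latPt_zero, neg_le_neg_iff]
      exact_mod_cast this
    have h1 := hconv (-e 1) (-s.2.1) fun q hq => by
      have := hq.2.2.1
      rw [LinearMap.neg_apply, he, latPt_one, neg_le_neg_iff]
      exact_mod_cast this
    have h3 := hconv (e 0 + e 1) (s.1 + s.2.1 + 1) fun q hq => by
      have := hq.2.2.2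
      rw [LinearMap.add_apply, he, he, latPt_zero, latPt_one]
      exact_mod_cast this
    rw [LinearMap.neg_apply, he, neg_le_neg_iff] at h0 h1
    exact ⟨h0, h1, h3⟩

theorem latPt_mem_latTriangle {up : Bool} {s q : ℤ × ℤ × ℤ}
    (hp : latPt q ∈ convexHull ℝ (latPt '' latTriangle up s)) : q ∈ latTriangle up s := by
  have h := mem_convexHull_latTriangle hp
  rw [latPt_zero, latPt_one, latPt_two] at h
  refine ⟨Int.cast_injective (α := ℝ) h.1, ?_⟩
  cases up
  · simp only [cond_false] at h ⊢
    exact ⟨by exact_mod_cast h.2.1, by exact_mod_cast h.2.2.1, by exact_mod_cast h.2.2.2⟩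
  · simp only [cond_true] at h ⊢
    exact ⟨by exact_mod_cast h.2.1, by exact_mod_cast h.2.2.1, by exact_mod_cast h.2.2.2⟩

theorem latPt_add (p q : ℤ × ℤ × ℤ) : latPt (p + q) = latPt p + latPt q := by
  apply space_ext <;> simp

/-- A lattice triangle meets an edge that is not one of its sides only in common vertices. -/
theorem mem_latTriangle_of_mem_edge {up : Bool} {s q r : ℤ × ℤ × ℤ} {p : Space}
    (hqr : LatAdj q r) (hT : p ∈ convexHull ℝ (latPt '' latTriangle up s))
    (hp : p ∈ segment ℝ (latPt q) (latPt r))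
    (h1 : ¬ (q ∈ latTriangle up s ∧ r ∈ latTriangle up s)) :
    (q ∈ latTriangle up s ∧ p = latPt q) ∨ (r ∈ latTriangle up s ∧ p = latPt r) := by
  obtain ⟨τ, h0, h2, rfl⟩ := mem_segment_iff_exists_smul.1 hp
  rcases h0.eq_or_lt with rfl | h0
  · simp only [sub_zero, one_smul, zero_smul, add_zero] at hT ⊢
    exact Or.inl ⟨latPt_mem_latTriangle hT, trivial⟩
  rcases h2.eq_or_lt with rfl | h2
  · simp only [sub_self, one_smul, zero_smul, zero_add] at hT ⊢
    exact Or.inr ⟨latPt_mem_latTriangle hT, trivial⟩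
  exfalso
  -- An inner point of an edge satisfies the inequalities of the triangle; by integrality both ends
  -- satisfy them as well.
  have key : ∀ {q r : ℤ × ℤ × ℤ} {τ : ℝ} (t : Fin 4), r = q + latDir t → 0 < τ → τ < 1 →
      (1 - τ) • latPt q + τ • latPt r ∈ convexHull ℝ (latPt '' latTriangle up s) →
      q ∈ latTriangle up s ∧ r ∈ latTriangle up s := by
    rintro ⟨q0, q1, q2⟩ r τ t rfl h0 h2 hT
    obtain ⟨s0, s1, s2⟩ := s
    rw [latPt_add, show (1 - τ) • latPt (q0, q1, q2) + τ • (latPt (q0, q1, q2) + latPt (latDir t))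
      = latPt (q0, q1, q2) + τ • latPt (latDir t) by module] at hT
    have h := mem_convexHull_latTriangle hT
    have lt : ∀ a b : ℤ, (a : ℝ) < b → a < b := fun a b h => by exact_mod_cast h
    have le : ∀ a b : ℤ, (a : ℝ) ≤ b → a ≤ b := fun a b h => by exact_mod_cast h
    fin_cases t <;> cases up <;> simp [latDir, latTriangle] at h ⊢
    · have := lt q0 (s0 + 1) (by push_cast; linarith)
      have := le q1 (s1 + 1) (by push_cast; linarith)
      have := lt (s0 + s1) (q0 + q1) (by push_cast; linarith)
      omega
    · have := lt s0 (q0 + 1) (by push_cast; linarith)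
      have := h.2.2.1
      have := lt (q0 + q1) (s0 + s1 + 1) (by push_cast; linarith)
      omega
    · have := le q0 (s0 + 1) (by push_cast; linarith)
      have := lt q1 (s1 + 1) (by push_cast; linarith)
      have := lt (s0 + s1) (q0 + q1) (by push_cast; linarith)
      omega
    · have := h.2.1
      have := lt s1 (q1 + 1) (by push_cast; linarith)
      have := lt (q0 + q1) (s0 + s1 + 1) (by push_cast; linarith)
      omega
    · have := lt q0 (s0 + 2) (by push_cast; linarith)
      have := lt q1 (s1 + 1) (by push_cast; linarith)
      have := le (s0 + s1 + 1) (q0 + q1) (by push_cast; linarith)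
      omega
    · have := lt s0 q0 (by linarith)
      have := lt s1 (q1 + 1) (by push_cast; linarith)
      have := le (q0 + q1) (s0 + s1 + 1) (by push_cast; linarith)
      omega
    · have := lt q2 s2 (by linarith)
      have := lt s2 (q2 + 1) (by push_cast; linarith)
      omega
    · have := lt q2 s2 (by linarith)
      have := lt s2 (q2 + 1) (by push_cast; linarith)
      omega
  obtain ⟨t, ht | ht⟩ := hqr
  · exact h1 (key t ht h0 h2 hT)
  · refine h1 (key (τ := 1 - τ) t ht (by linarith) (by linarith) ?_).symm
    rwa [sub_sub_cancel, add_comm]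

/-! ### Polygons in the simple hexagonal lattice -/

theorem latPt_mem_fatEdge {k : ℤ} {t : Fin 4} {s : ℤ × ℤ × ℤ} {p : Space}
    (hp : p ∈ segment ℝ (latPt s) (latPt (s + latDir t))) : fatEdge k t s p := by
  obtain ⟨τ, h0, h1, rfl⟩ := mem_segment_iff_exists_smul.1 hp
  obtain ⟨a, b, c⟩ := s
  fin_cases t
  · simp [fatEdge, latDir]
    refine ⟨?_, ?_, ?_, ?_⟩ <;> nlinarith
  · simp [fatEdge, latDir]
    refine ⟨?_, ?_, ?_, ?_⟩ <;> nlinarith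
  · simp [fatEdge, latDir, lowerBend, upperBend]
    rcases le_total τ (1 / 2) with h | h
    · left
      refine ⟨by ring, ?_⟩
      rcases lt_or_ge k a with hk | hk
      · exact Or.inl ⟨hk, by linarith, by linarith, by linarith⟩
      · exact Or.inr ⟨hk, by linarith, by linarith, by linarith⟩
    · right
      refine ⟨by ring, ?_⟩
      rcases lt_or_ge (k + 1) a with hk | hk
      · exact Or.inl ⟨hk, by linarith, by linarith, by linarith⟩
      · exact Or.inr ⟨hk, by linarith, by linarith, by linarith⟩
  · simp [fatEdge, latDir]
    refine ⟨?_, ?_, ?_, ?_⟩ <;> nlinarith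

/-- The points `p` and `q` are the ends of the edge in direction number `t` from `s`. -/
def IsEdge (t : Fin 4) (s p q : ℤ × ℤ × ℤ) : Prop :=
  p = s ∧ q = s + latDir t ∨ q = s ∧ p = s + latDir t

theorem LatAdj.exists_isEdge {p q : ℤ × ℤ × ℤ} (h : LatAdj p q) : ∃ e : Fin 4 × (ℤ × ℤ × ℤ),
    IsEdge e.1 e.2 p q := by
  obtain ⟨t, h | h⟩ := h
  · exact ⟨(t, p), Or.inl ⟨rfl, h⟩⟩
  · exact ⟨(t, q), Or.inr ⟨rfl, h⟩⟩

theorem IsEdge.segment_eq {t : Fin 4} {s p q : ℤ × ℤ × ℤ} (h : IsEdge t s p q) :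
    segment ℝ (latPt p) (latPt q) = segment ℝ (latPt s) (latPt (s + latDir t)) := by
  rcases h with ⟨rfl, rfl⟩ | ⟨rfl, rfl⟩
  · rfl
  · exact segment_symm _ _ _

theorem IsEdge.eq_or_eq {t : Fin 4} {s p q p' q' : ℤ × ℤ × ℤ} (h : IsEdge t s p q)
    (h' : IsEdge t s p' q') : p = p' ∧ q = q' ∨ p = q' ∧ q = p' := by
  rcases h with ⟨rfl, rfl⟩ | ⟨rfl, rfl⟩ <;> rcases h' with ⟨rfl, rfl⟩ | ⟨rfl, rfl⟩ <;> simp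

/-- The acute edges are the four sides of the cell; each shares an end with the diagonal, and the
other ends are joined by another side. -/
theorem IsAcute.exists_triangle {s s' : ℤ × ℤ × ℤ} {t' : Fin 4} (h : IsAcute s t' s') :
    ∃ a b c, IsEdge 2 s a b ∧ IsEdge t' s' b c ∧ LatAdj a c := by
  obtain ⟨i, j, l⟩ := s
  obtain ⟨i', j', l'⟩ := s'
  obtain ⟨hl, ⟨rfl, h1, h2 | h2⟩ | ⟨rfl, h1, h2 | h2⟩⟩ := h <;> simp only at hl h1 h2 <;>
    subst hl h1 h2
  · exact ⟨(i - 1, j' + 1, l'), (i, j', l'), (i - 1, j', l'), Or.inr ⟨rfl, by simp [latDir]; ring⟩,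
      Or.inr ⟨rfl, by simp [latDir]⟩, latAdj_iff_coords.2 (by simp)⟩
  · exact ⟨(i, j, l'), (i - 1, j + 1, l'), (i, j + 1, l'), Or.inl ⟨rfl, by simp [latDir]; ring⟩,
      Or.inl ⟨rfl, by simp [latDir]⟩, latAdj_iff_coords.2 (by simp)⟩
  · exact ⟨(i, j', l'), (i - 1, j' + 1, l'), (i - 1, j', l'), Or.inl ⟨rfl, by simp [latDir]; ring⟩,
      Or.inr ⟨rfl, by simp [latDir]⟩, latAdj_iff_coords.2 (by simp)⟩
  · exact ⟨(i' - 1, j' + 1, l'), (i', j', l'), (i', j' + 1, l'),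
      Or.inr ⟨rfl, by simp [latDir]; ring⟩,
      Or.inl ⟨rfl, by simp [latDir]⟩, latAdj_iff_coords.2 (by simp)⟩

theorem LatAdj.ne {p q : ℤ × ℤ × ℤ} (h : LatAdj p q) : p ≠ q := by
  rintro rfl
  rw [latAdj_iff_coords] at h
  omega

/-- A closed polygon in the simple hexagonal lattice, in sheared coordinates, as a periodic
sequence of vertices. -/
structure IsLatPolygon (n : ℕ) (v : ℕ → ℤ × ℤ × ℤ) : Prop where
  three_le : 3 ≤ n
  periodic : ∀ i, v (i + n) = v i
  inj : ∀ i j, v i = v j → i ≡ j [MOD n]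
  adj : ∀ i, LatAdj (v i) (v (i + 1))

/-- The polygon does not turn by an acute angle. -/
def NoTurn (v : ℕ → ℤ × ℤ × ℤ) : Prop :=
  ∀ i, ¬ LatAdj (v i) (v (i + 2))

theorem eq_of_modEq {α : Type*} {n : ℕ} {v : ℕ → α} (hv : ∀ i, v (i + n) = v i) {i j : ℕ}
    (h : i ≡ j [MOD n]) : v i = v j := by
  have hp : Function.Periodic v n := hv
  rw [← hp.map_mod_nat i, ← hp.map_mod_nat j, h]

theorem polyPath_congr {u v : ℕ → Space} {s t : ℕ} (h : ∀ i, s ≤ i → i ≤ t → u i = v i) :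
    polyPath u s t = polyPath v s t := by
  ext p
  simp only [mem_polyPath]
  refine exists_congr fun i => and_congr_right fun h1 => and_congr_right fun h2 => ?_
  rw [h i h1 h2.le, h (i + 1) (by omega) h2]

theorem IsStep.exists_sign {t : Fin 4} {p q : ℤ × ℤ × ℤ} (h : IsStep t p q) :
    ∃ ε : ℤ, (ε = 1 ∨ ε = -1) ∧ q = p + ε • latDir t := by
  rcases h with rfl | rfl
  · exact ⟨1, by simp⟩
  · exact ⟨-1, by simp⟩

theorem latDir_independent {t t' : Fin 4} (hne : t ≠ t') (x y : ℝ)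
    (h : x • latPt (latDir t) + y • latPt (latDir t') = 0) : x = 0 ∧ y = 0 := by
  have h0 := congrArg (fun p : Space => p 0) h
  have h1 := congrArg (fun p : Space => p 1) h
  have h2 := congrArg (fun p : Space => p 2) h
  fin_cases t <;> fin_cases t' <;> simp [latDir] at h0 h1 h2 hne <;>
    constructor <;> linarith

theorem noncollinear_of_latAdj {a b c : ℤ × ℤ × ℤ} (hab : LatAdj a b) (hbc : LatAdj b c)
    (hac : LatAdj a c) : Noncollinear (latPt a) (latPt b) (latPt c) := by
  obtain ⟨t, ht⟩ := hab
  obtain ⟨t', ht'⟩ := hac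
  obtain ⟨ε, hε, rfl⟩ := ht.exists_sign
  obtain ⟨ε', hε', rfl⟩ := ht'.exists_sign
  have hsmul : ∀ (ε : ℤ) (p : ℤ × ℤ × ℤ), latPt (ε • p) = (ε : ℝ) • latPt p := by
    intro ε p
    apply space_ext <;> simp
  intro x y hxy
  by_cases hne : t = t'
  · exfalso
    subst hne
    rcases hε with rfl | rfl <;> rcases hε' with rfl | rfl
    · exact hbc.ne rfl
    · rw [latAdj_iff_coords] at hbc
      clear * - hbc
      fin_cases t <;> simp [latDir] at hbc <;> omega
    · rw [latAdj_iff_coords] at hbc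
      clear * - hbc
      fin_cases t <;> simp [latDir] at hbc <;> omega
    · exact hbc.ne rfl
  · have := latDir_independent hne (x * ε) (y * ε') (by
      rw [← hxy]
      simp only [latPt_add, hsmul, add_sub_cancel_left, mul_smul])
    constructor
    · refine (mul_eq_zero.1 this.1).resolve_right ?_
      rcases hε with rfl | rfl <;> norm_num
    · refine (mul_eq_zero.1 this.2).resolve_right ?_
      rcases hε' with rfl | rfl <;> norm_num

namespace IsLatPolygon

variable {n : ℕ} {v : ℕ → ℤ × ℤ × ℤ}

theorem shift (h : IsLatPolygon n v) (r : ℕ) : IsLatPolygon n fun i => v (i + r) where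
  three_le := h.three_le
  periodic i := by rw [add_right_comm, h.periodic]
  inj i j hij := Nat.ModEq.add_right_cancel' r (h.inj _ _ hij)
  adj i := by
    have := h.adj (i + r)
    rwa [add_right_comm] at this

theorem eq_add_one (h : IsLatPolygon n v) {i j : ℕ} (hij : v i = v j) :
    v (i + 1) = v (j + 1) :=
  eq_of_modEq h.periodic ((h.inj _ _ hij).add_right 1)

theorem add_two_ne (h : IsLatPolygon n v) (i : ℕ) : v (i + 2) ≠ v i := by
  intro hc
  have h1 := h.inj _ _ hc
  have h2 : 2 ≡ 0 [MOD n] := by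
    have : i + 2 ≡ i + 0 [MOD n] := h1
    exact this.add_left_cancel'
  have := h.three_le
  have := h2.eq_of_lt_of_lt (by omega) (by omega)
  omega

/-- Different edges have different underlying edges of the lattice. -/
theorem modEq_of_isEdge (h : IsLatPolygon n v) {i j : ℕ} {t : Fin 4} {s : ℤ × ℤ × ℤ}
    (hi : IsEdge t s (v i) (v (i + 1))) (hj : IsEdge t s (v j) (v (j + 1))) : i ≡ j [MOD n] := by
  rcases hi.eq_or_eq hj with ⟨h1, -⟩ | ⟨h1, h2⟩
  · exact h.inj _ _ h1
  · exact absurd ((h.eq_add_one h2).trans h1.symm) (h.add_two_ne i)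

/-- Acute edges share a vertex. By injectivity, edges of the polygon that share a vertex are
consecutive or equal; the first is an acute turn, the second contradicts that the outer ends are
adjacent. -/
theorem not_isAcute (h : IsLatPolygon n v) (hturn : NoTurn v) {i j : ℕ} {t' : Fin 4}
    {s s' : ℤ × ℤ × ℤ}
    (hi : IsEdge 2 s (v i) (v (i + 1))) (hj : IsEdge t' s' (v j) (v (j + 1))) :
    ¬ IsAcute s t' s' := by
  intro hac
  obtain ⟨a, b, c, h1, h2, h3⟩ := hac.exists_triangle
  rcases h1.eq_or_eq hi with ⟨rfl, rfl⟩ | ⟨rfl, rfl⟩ <;>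
    rcases h2.eq_or_eq hj with ⟨h4, rfl⟩ | ⟨h4, rfl⟩
  · exact hturn i (by rw [h.eq_add_one h4]; exact h3)
  · refine h3.ne ?_
    have := h.inj _ _ h4
    exact eq_of_modEq h.periodic (this.add_right_cancel' 1)
  · exact h3.ne (h.eq_add_one h4)
  · exact hturn j (by rw [← h.eq_add_one h4]; exact h3.symm)

/-- The fat versions of different edges meet only in common ends. -/
theorem fatEdge_inter (h : IsLatPolygon n v) (hturn : NoTurn v) {k : ℤ} {i j : ℕ}
    (hij : ¬ i ≡ j [MOD n]) {t t' : Fin 4} {s s' : ℤ × ℤ × ℤ} {p : Space}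
    (hi : IsEdge t s (v i) (v (i + 1))) (hj : IsEdge t' s' (v j) (v (j + 1)))
    (hp : fatEdge k t s p) (hp' : fatEdge k t' s' p) :
    p = latPt (v i) ∨ p = latPt (v (i + 1)) := by
  have hne : (t, s) ≠ (t', s') := by
    intro he
    obtain ⟨rfl, rfl⟩ := Prod.mk.inj he
    exact hij (h.modEq_of_isEdge hi hj)
  have := _root_.fatEdge_inter hne
    (fun ht => by subst ht; exact h.not_isAcute hturn hi hj)
    (fun ht => by subst ht; exact h.not_isAcute hturn hj hi) hp hp'
  rcases hi with ⟨h1, h2⟩ | ⟨h1, h2⟩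
  · rw [h1, h2]; exact this
  · rw [h1, h2]; exact this.symm

theorem isSimplePolygon (h : IsLatPolygon n v) (hturn : NoTurn v) :
    IsSimplePolygon n fun i => latPt (v i) where
  three_le := h.three_le
  periodic i := by rw [h.periodic]
  inj i j hij := h.inj _ _ (latPt_injective hij)
  inter i j hij := by
    rintro p ⟨hp, hp'⟩
    obtain ⟨⟨t, s⟩, hi⟩ := (h.adj i).exists_isEdge
    obtain ⟨⟨t', s'⟩, hj⟩ := (h.adj j).exists_isEdge
    simp only at hi hj
    rw [hi.segment_eq] at hp
    rw [hj.segment_eq] at hp'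
    exact h.fatEdge_inter hturn (k := 0) hij hi hj (latPt_mem_fatEdge hp) (latPt_mem_fatEdge hp')

/-- The number of edges between two consecutive levels is even. -/
theorem even_card_crosses (g : ℕ → ℤ) (hstep : ∀ i, |g (i + 1) - g i| ≤ 1) (hg : g n = g 0)
    (k : ℤ) : Even ((Finset.range n).filter fun i => Crosses k (g i) (g (i + 1))).card := by
  rw [← ZMod.natCast_eq_zero_iff_even, Finset.card_filter, Nat.cast_sum]
  -- `b` records the side of the level modulo two and changes exactly along crossing edges, so the
  -- count telescopes around the polygon.
  let b : ℕ → ZMod 2 := fun i => if g i ≤ k then 0 else 1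
  have hb : ∀ i, ((if Crosses k (g i) (g (i + 1)) then 1 else 0 : ℕ) : ZMod 2) = b (i + 1) - b i := by
    intro i
    have := abs_le.1 (hstep i)
    by_cases hc : Crosses k (g i) (g (i + 1)) <;> by_cases h1 : g i ≤ k <;>
      by_cases h2 : g (i + 1) ≤ k <;> simp [b, hc, h1, h2] <;>
      first | decide | (unfold Crosses at hc; omega)
  simp only [hb]
  rw [Finset.sum_range_sub]
  simp [b, hg]

/-- By parity, fewer than four crossings means at most two, and with at most two at every level the
polygon is trivial. -/
theorem exists_four_le_card_crosses (h : IsLatPolygon n v) (hturn : NoTurn v)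
    {f : Space →ₗ[ℝ] ℝ} (g : ℤ × ℤ × ℤ → ℤ) (hf : ∃ u, f u = 1) (hfg : ∀ p, f (latPt p) = g p)
    (hstep : ∀ p q, LatAdj p q → |g q - g p| ≤ 1)
    (hK : ¬ AmbientIsotopic (polyPath (fun i => latPt (v i)) 0 n) roundCircle) :
    ∃ k, 4 ≤ ((Finset.range n).filter fun i => Crosses k (g (v i)) (g (v (i + 1)))).card := by
  by_contra! hcon
  refine hK (IsBridgeHeight.ambientIsotopic_roundCircle (f := f) (g := fun i => g (v i))
    (h.isSimplePolygon hturn) ⟨hf, fun i => hfg _, fun i => hstep _ _ (h.adj i), ?_⟩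
    fun i => by rw [h.periodic])
  intro k i j l hij hjl hil hi hj hl
  have hn : 0 < n := by have := h.three_le; omega
  have hmem : ∀ i, Crosses k (g (v i)) (g (v (i + 1))) → i % n ∈
      (Finset.range n).filter fun i => Crosses k (g (v i)) (g (v (i + 1))) := by
    intro i hi
    rw [Finset.mem_filter, Finset.mem_range]
    refine ⟨Nat.mod_lt _ hn, ?_⟩
    have h1 : i % n ≡ i [MOD n] := Nat.mod_modEq i n
    rwa [eq_of_modEq h.periodic h1, eq_of_modEq h.periodic (h1.add_right 1)]
  have h3 := Finset.two_lt_card.2 ⟨i % n, hmem i hi, j % n, hmem j hj, l % n, hmem l hl,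
    hij, hil, hjl⟩
  have h4 := hcon k
  have h5 := even_card_crosses (n := n) (fun i => g (v i)) (fun i => hstep _ _ (h.adj i))
    (by have := h.periodic 0; rw [zero_add] at this; rw [this]) k
  rw [Nat.even_iff] at h5
  omega

/-- The corner of an acute turn can be cut off. -/
theorem exists_cut (h : IsLatPolygon (n + 1) v) (hn : 3 ≤ n) (hadj : LatAdj (v (n - 1)) (v 0)) :
    ∃ w, IsLatPolygon n w ∧ AmbientIsotopic (polyPath (fun i => latPt (w i)) 0 n)
      (polyPath (fun i => latPt (v i)) 0 (n + 1)) := by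
  obtain ⟨m, rfl⟩ : ∃ m, n = m + 1 := ⟨n - 1, by omega⟩
  rw [Nat.add_sub_cancel] at hadj
  have idx : ∀ {i j : ℕ}, i < m + 2 → j < m + 2 → v i = v j → i = j := fun hi hj hij =>
    (h.inj _ _ hij).eq_of_lt_of_lt hi hj
  have hv0 : v (m + 2) = v 0 := by simpa using h.periodic 0
  have hab := h.adj m
  have hbc := h.adj (m + 1)
  rw [show m + 1 + 1 = m + 2 from rfl, hv0] at hbc
  obtain ⟨up, s, hs⟩ := exists_latTriangle hab hbc hadj
  have key := triangle_move_of_noncollinear (noncollinear_of_latAdj hab hbc hadj)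
    (R := polyPath (fun i => latPt (v i)) 0 m) isPolyhedral_polyPath (by
      rintro p ⟨hp, hT⟩
      obtain ⟨j, -, hj, hpj⟩ := mem_polyPath.1 hp
      rw [show ({latPt (v m), latPt (v (m + 1)), latPt (v 0)} : Set Space)
        = latPt '' {v m, v (m + 1), v 0} by simp [image_insert_eq], ← hs] at hT
      -- No remaining edge is a side of the triangle: it would have to join `v 0` and `v m` with `m
      -- = 1`, whereas `3 ≤ m + 1`.
      have hedge := mem_latTriangle_of_mem_edge (h.adj j) hT hpj (by
        rw [hs]
        simp only [mem_insert_iff, mem_singleton_iff]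
        rintro ⟨h1 | h1 | h1, h2 | h2 | h2⟩ <;> replace h1 := idx (by omega) (by omega) h1 <;>
          replace h2 := idx (by omega) (by omega) h2 <;> omega)
      rw [hs] at hedge
      simp only [mem_insert_iff, mem_singleton_iff] at hedge ⊢
      rcases hedge with ⟨h1 | h1 | h1, h2⟩ | ⟨h1 | h1 | h1, h2⟩
      · exact Or.inl (h1 ▸ h2)
      · have := idx (by omega) (by omega) h1
        omega
      · exact Or.inr (h1 ▸ h2)
      · exact Or.inl (h1 ▸ h2)
      · have := idx (by omega) (by omega) h1
        omega
      · exact Or.inr (h1 ▸ h2))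
  refine ⟨fun i => v (i % (m + 1)), ⟨hn, fun i => by simp, fun i j hij => ?_, fun i => ?_⟩, ?_⟩
  · have h1 := Nat.mod_lt i (show 0 < m + 1 by omega)
    have h2 := Nat.mod_lt j (show 0 < m + 1 by omega)
    exact idx (by omega) (by omega) hij
  · have h1 := Nat.mod_lt i (show 0 < m + 1 by omega)
    have h3 : (i + 1) % (m + 1) = (i % (m + 1) + 1) % (m + 1) := by simp
    simp only [h3]
    rcases (show i % (m + 1) < m ∨ i % (m + 1) = m by omega) with h2 | h2
    · rw [Nat.mod_eq_of_lt (show i % (m + 1) + 1 < m + 1 by omega)]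
      exact h.adj _
    · rw [h2, Nat.mod_self]
      exact hadj
  · rw [polyPath_succ (Nat.zero_le m), polyPath_succ (Nat.zero_le (m + 1)),
      polyPath_succ (Nat.zero_le m), polyPath_congr (v := fun i => latPt (v i))]
    · simp only [Nat.mod_eq_of_lt (Nat.lt_succ_self m), Nat.mod_self,
        show m + 1 + 1 = m + 2 from rfl, hv0]
      refine cast ?_ key
      congr 1
      · ac_rfl
      · ac_rfl
    · intro i _ hi
      simp only [Nat.mod_eq_of_lt (show i < m + 1 by omega)]

/-- A polygon that is not a trivial knot can be replaced by one without acute turns. -/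
theorem exists_noTurn (h : IsLatPolygon n v)
    (hK : ¬ AmbientIsotopic (polyPath (fun i => latPt (v i)) 0 n) roundCircle) :
    ∃ m w, m ≤ n ∧ IsLatPolygon m w ∧ NoTurn w ∧
      AmbientIsotopic (polyPath (fun i => latPt (w i)) 0 m)
        (polyPath (fun i => latPt (v i)) 0 n) := by
  induction n using Nat.strong_induction_on generalizing v with
  | _ n ih =>
  by_cases hturn : NoTurn v
  · exact ⟨n, v, le_rfl, h, hturn, AmbientIsotopic.refl _⟩
  obtain ⟨r, hr⟩ : ∃ r, LatAdj (v r) (v (r + 2)) := by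
    unfold NoTurn at hturn
    push Not at hturn
    exact hturn
  have hn := h.three_le
  rcases hn.eq_or_lt with rfl | hn
  · exfalso
    have h0 := h.adj 0
    have h1 := h.adj 1
    have h2 := h.adj 2
    rw [show v (2 + 1) = v 0 by simpa using h.periodic 0] at h2
    refine hK ?_
    have := (noncollinear_of_latAdj h0 h1 h2.symm).ambientIsotopic_roundCircle
    rw [polyPath_succ (by omega), polyPath_succ (by omega), polyPath_succ (by omega),
      polyPath_self, empty_union, show v (2 + 1) = v 0 by simpa using h.periodic 0,
      segment_symm ℝ (latPt (v 2))]
    exact this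
  · obtain ⟨m, rfl⟩ : ∃ m, n = m + 1 := ⟨n - 1, by omega⟩
    -- After a shift by `r + 2` the corner `v (r + 1)` is the last vertex, the one that `exists_cut`
    -- removes.
    have hshift := IsSimplePolygon.polyPath_shift_period (v := fun i => latPt (v i)) (n := m + 1)
      (fun i => by rw [h.periodic]) (r + 2)
    obtain ⟨w, hw, hiso⟩ := (h.shift (r + 2)).exists_cut (by omega) (by
      rw [show m - 1 + (r + 2) = r + (m + 1) by omega, h.periodic, zero_add]
      exact hr)
    rw [hshift] at hiso
    obtain ⟨l, u, hl, hu, hut, hiso'⟩ := ih m (by omega) hw fun hc => hK (hiso.symm.trans hc)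
    exact ⟨l, u, by omega, hu, hut, hiso'.trans hiso⟩

end IsLatPolygon

/-! ### Bending the diagonal edges -/

/-- The first corner of the bent diagonal edge with lower end `s`. -/
noncomputable def bendLow (k : ℤ) (s : ℤ × ℤ × ℤ) : Space :=
  if k < s.1 then !₂[(s.1 : ℝ), s.2.1 + 1 / 2, s.2.2] else !₂[(s.1 : ℝ) - 1 / 2, s.2.1, s.2.2]

/-- The middle of the diagonal edge with lower end `s`. -/
noncomputable def bendMid (s : ℤ × ℤ × ℤ) : Space :=
  !₂[(s.1 : ℝ) - 1 / 2, s.2.1 + 1 / 2, s.2.2]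

/-- The last corner of the bent diagonal edge with lower end `s`. -/
noncomputable def bendHigh (k : ℤ) (s : ℤ × ℤ × ℤ) : Space :=
  if k + 1 < s.1 then !₂[(s.1 : ℝ) - 1 / 2, s.2.1 + 1, s.2.2]
  else !₂[(s.1 : ℝ) - 1, s.2.1 + 1 / 2, s.2.2]

/-- The edges, with the diagonal edges bent. -/
noncomputable def bentEdge (k : ℤ) (t : Fin 4) (s : ℤ × ℤ × ℤ) : Set Space :=
  if t = 2 then
    segment ℝ (latPt s) (bendLow k s) ∪ segment ℝ (bendLow k s) (bendMid s) ∪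
      (segment ℝ (bendMid s) (bendHigh k s) ∪
        segment ℝ (bendHigh k s) (latPt (s + latDir 2)))
  else segment ℝ (latPt s) (latPt (s + latDir t))

theorem isPolyhedral_bentEdge (k : ℤ) (t : Fin 4) (s : ℤ × ℤ × ℤ) :
    IsPolyhedral (bentEdge k t s) := by
  unfold bentEdge
  split_ifs
  · exact ((IsPolyhedral.segment _ _).union (IsPolyhedral.segment _ _)).union
      ((IsPolyhedral.segment _ _).union (IsPolyhedral.segment _ _))
  · exact IsPolyhedral.segment _ _

section Bend

variable {k : ℤ} {s : ℤ × ℤ × ℤ} {p : Space}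

theorem lowerBend_of_mem_triangle (hp : p ∈ convexHull ℝ {latPt s, bendLow k s, bendMid s}) :
    lowerBend k s p := by
  obtain ⟨α, β, γ, hα, hβ, hγ, hs, rfl⟩ := mem_convexHull_triangle_iff.1 hp
  obtain rfl : α = 1 - β - γ := by linarith
  unfold lowerBend bendLow bendMid
  by_cases hk : k < s.1
  · simp [hk]
    refine ⟨by ring, Or.inl ⟨?_, ?_, ?_⟩⟩ <;> nlinarith
  · simp [hk, not_lt.1 hk]
    refine ⟨by ring, ?_, ?_, ?_⟩ <;> nlinarith

theorem upperBend_of_mem_triangle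
    (hp : p ∈ convexHull ℝ {bendMid s, bendHigh k s, latPt (s + latDir 2)}) :
    upperBend k s p := by
  obtain ⟨α, β, γ, hα, hβ, hγ, hs, rfl⟩ := mem_convexHull_triangle_iff.1 hp
  obtain rfl : α = 1 - β - γ := by linarith
  unfold upperBend bendHigh bendMid
  by_cases hk : k + 1 < s.1
  · simp [hk, latDir]
    refine ⟨by ring, Or.inl ⟨?_, ?_, ?_⟩⟩ <;> nlinarith
  · simp [hk, not_lt.1 hk, latDir]
    refine ⟨by ring, ?_, ?_, ?_⟩ <;> nlinarith

theorem eq_bendMid (h : lowerBend k s p) (h' : upperBend k s p) : p = bendMid s := by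
  have b := h.bounds
  have b' := h'.bounds
  refine space_ext ?_ ?_ h.1
  · change p 0 = (s.1 : ℝ) - 1 / 2
    linarith
  · change p 1 = (s.2.1 : ℝ) + 1 / 2
    linarith

theorem segment_subset_triangle {a b c : Space} :
    segment ℝ a b ⊆ convexHull ℝ {a, b, c} ∧ segment ℝ b c ⊆ convexHull ℝ {a, b, c} ∧
      segment ℝ a c ⊆ convexHull ℝ {a, b, c} := by
  refine ⟨?_, ?_, ?_⟩ <;>
  · refine (convex_convexHull ℝ _).segment_subset ?_ ?_ <;>
    · apply subset_convexHull
      simp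

theorem segment_eq_union_of_midpoint {a b c : Space} (h : b = (1 / 2 : ℝ) • a + (1 / 2 : ℝ) • c) :
    segment ℝ a c = segment ℝ a b ∪ segment ℝ b c := by
  subst h
  apply subset_antisymm
  · intro z hz
    obtain ⟨t, h0, h1, rfl⟩ := mem_segment_iff_exists_smul.1 hz
    rcases le_total t (1 / 2) with h | h
    · exact Or.inl (mem_segment_iff_exists_smul.2 ⟨2 * t, by linarith, by linarith, by module⟩)
    · exact Or.inr (mem_segment_iff_exists_smul.2 ⟨2 * t - 1, by linarith, by linarith, by module⟩)
  · have hb : (1 / 2 : ℝ) • a + (1 / 2 : ℝ) • c ∈ segment ℝ a c :=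
      ⟨1 / 2, 1 / 2, by norm_num, by norm_num, by norm_num, rfl⟩
    exact union_subset
      ((convex_segment a c).segment_subset (left_mem_segment _ _ _) hb)
      ((convex_segment a c).segment_subset hb (right_mem_segment _ _ _))

theorem fatEdge_of_mem_bentEdge {t : Fin 4} (hp : p ∈ bentEdge k t s) : fatEdge k t s p := by
  unfold bentEdge at hp
  split_ifs at hp with ht
  · subst ht
    rcases hp with (hp | hp) | hp | hp
    · exact Or.inl (lowerBend_of_mem_triangle (segment_subset_triangle.1 hp))
    · exact Or.inl (lowerBend_of_mem_triangle (segment_subset_triangle.2.1 hp))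
    · exact Or.inr (upperBend_of_mem_triangle (segment_subset_triangle.1 hp))
    · exact Or.inr (upperBend_of_mem_triangle (segment_subset_triangle.2.1 hp))
  · exact latPt_mem_fatEdge hp

theorem noncollinear_bendLow : Noncollinear (latPt s) (bendLow k s) (bendMid s) := by
  intro x y h
  have h0 := congrArg (fun p : Space => p 0) h
  have h1 := congrArg (fun p : Space => p 1) h
  unfold bendLow bendMid at h0 h1
  split_ifs at h0 h1 <;> simp at h0 h1 <;> constructor <;> linarith

theorem noncollinear_bendHigh :
    Noncollinear (bendMid s) (bendHigh k s) (latPt (s + latDir 2)) := by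
  intro x y h
  have h0 := congrArg (fun p : Space => p 0) h
  have h1 := congrArg (fun p : Space => p 1) h
  unfold bendHigh bendMid at h0 h1
  split_ifs at h0 h1 <;> simp [latDir] at h0 h1 <;> norm_num at h0 h1 <;> constructor <;> linarith

/-- A diagonal edge can be bent. -/
theorem ambientIsotopic_bentEdge {R : Set Space} (hR : IsPolyhedral R) (t : Fin 4)
    (hRf : ∀ p ∈ R, fatEdge k t s p → p = latPt s ∨ p = latPt (s + latDir t)) :
    AmbientIsotopic (segment ℝ (latPt s) (latPt (s + latDir t)) ∪ R) (bentEdge k t s ∪ R) := by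
  unfold bentEdge
  split_ifs with ht
  swap
  · exact AmbientIsotopic.refl _
  subst ht
  have hmid : segment ℝ (latPt s) (latPt (s + latDir 2))
      = segment ℝ (latPt s) (bendMid s) ∪ segment ℝ (bendMid s) (latPt (s + latDir 2)) := by
    refine segment_eq_union_of_midpoint ?_
    apply space_ext <;> simp [bendMid, latDir] <;> ring
  -- The two halves of the diagonal are pushed one after the other; the two swept triangles share
  -- only the midpoint.
  have m1 := triangle_move_of_noncollinear (noncollinear_bendLow (k := k) (s := s))
    (R := segment ℝ (bendMid s) (latPt (s + latDir 2)) ∪ R)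
    ((IsPolyhedral.segment _ _).union hR) (by
      rintro p ⟨hp | hp, hT⟩
      · exact Or.inr (eq_bendMid (lowerBend_of_mem_triangle hT)
          (upperBend_of_mem_triangle (k := k) (segment_subset_triangle.2.2 hp)))
      · have hl := lowerBend_of_mem_triangle hT
        rcases hRf p hp (Or.inl hl) with h | h
        · exact Or.inl h
        · have := hl.bounds.1
          rw [h] at this
          simp [latDir] at this
          linarith)
  have m2 := triangle_move_of_noncollinear (noncollinear_bendHigh (k := k) (s := s))
    (R := segment ℝ (latPt s) (bendLow k s) ∪ segment ℝ (bendLow k s) (bendMid s) ∪ R)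
    (((IsPolyhedral.segment _ _).union (IsPolyhedral.segment _ _)).union hR) (by
      rintro p ⟨(hp | hp) | hp, hT⟩
      · exact Or.inl (eq_bendMid (lowerBend_of_mem_triangle (segment_subset_triangle.1 hp))
          (upperBend_of_mem_triangle hT))
      · exact Or.inl (eq_bendMid (lowerBend_of_mem_triangle (segment_subset_triangle.2.1 hp))
          (upperBend_of_mem_triangle hT))
      · have hl := upperBend_of_mem_triangle hT
        rcases hRf p hp (Or.inr hl) with h | h
        · have := hl.bounds.2.1
          rw [h] at this
          simp at this
          linarith
        · exact Or.inr h)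
  rw [hmid, union_assoc]
  refine m1.trans ?_
  refine cast ?_ m2
  congr 1 <;> ac_rfl

end Bend

/-- All diagonal edges of a polygon without acute turns can be bent. -/
theorem IsLatPolygon.ambientIsotopic_bent {n : ℕ} {v : ℕ → ℤ × ℤ × ℤ} (h : IsLatPolygon n v)
    (hturn : NoTurn v) {e : ℕ → Fin 4 × (ℤ × ℤ × ℤ)}
    (he : ∀ i, IsEdge (e i).1 (e i).2 (v i) (v (i + 1))) (k : ℤ) :
    AmbientIsotopic (polyPath (fun i => latPt (v i)) 0 n)
      (⋃ i ∈ Finset.range n, bentEdge k (e i).1 (e i).2) := by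
  -- The edges are bent one by one. The others, whether already bent or still straight, lie in their
  -- fat edges and so avoid the region swept by edge `j`.
  have key : ∀ j, j ≤ n → AmbientIsotopic (polyPath (fun i => latPt (v i)) 0 n)
      (polyPath (fun i => latPt (v i)) j n ∪ ⋃ i ∈ Finset.range j, bentEdge k (e i).1 (e i).2) := by
    intro j hj
    induction j with
    | zero => simpa using AmbientIsotopic.refl _
    | succ j ih =>
      refine (ih (by omega)).trans ?_
      rw [Finset.range_add_one, Finset.set_biUnion_insert, polyPath_eq_segment_union (by omega)]
      have hstep := ambientIsotopic_bentEdge (k := k) (s := (e j).2)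
        (R := polyPath (fun i => latPt (v i)) (j + 1) n ∪
          ⋃ i ∈ Finset.range j, bentEdge k (e i).1 (e i).2)
        (isPolyhedral_polyPath.union
          (IsPolyhedral.biUnion _ fun i _ => isPolyhedral_bentEdge k _ _)) (e j).1 (by
          intro p hp hf
          have hfat : ∃ i, ¬ j ≡ i [MOD n] ∧ fatEdge k (e i).1 (e i).2 p := by
            rcases hp with hp | hp
            · obtain ⟨i, h1, h2, h3⟩ := mem_polyPath.1 hp
              refine ⟨i, fun hc => ?_, ?_⟩
              · have := hc.eq_of_lt_of_lt (by omega) (by omega)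
                omega
              · rw [(he i).segment_eq] at h3
                exact latPt_mem_fatEdge h3
            · simp only [mem_iUnion, Finset.mem_range] at hp
              obtain ⟨i, h2, h3⟩ := hp
              refine ⟨i, fun hc => ?_, fatEdge_of_mem_bentEdge h3⟩
              have := hc.eq_of_lt_of_lt (by omega) (by omega)
              omega
          obtain ⟨i, hij, hfi⟩ := hfat
          have := h.fatEdge_inter hturn hij (he j) (he i) hf hfi
          rcases he j with ⟨h1, h2⟩ | ⟨h1, h2⟩
          · rwa [h1, h2] at this
          · rw [h1, h2] at this
            exact this.symm)
      rw [← (he j).segment_eq] at hstep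
      refine cast ?_ hstep
      congr 1 <;> ac_rfl
  simpa using key n le_rfl

/-! ### Stretching -/

/-- Stretch the line by the factor two, except for the interval from `k` to `k + 1`. -/
noncomputable def stretchX (k : ℤ) (x : ℝ) : ℝ :=
  x + (min x k + max x (k + 1) - (k + 1))

section Stretch

variable {k : ℤ} {x y : ℝ}

theorem stretchX_of_le (h : x ≤ k) : stretchX k x = 2 * x := by
  rw [stretchX, min_eq_left h, max_eq_right (by linarith)]
  ring

theorem stretchX_of_ge (h : k + 1 ≤ x) : stretchX k x = 2 * x - 1 := by
  rw [stretchX, min_eq_right (by linarith), max_eq_left h]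
  ring

theorem stretchX_of_mem (h : k ≤ x) (h' : x ≤ k + 1) : stretchX k x = x + k := by
  rw [stretchX, min_eq_right h, max_eq_right h']
  ring

theorem stretchX_strictMono : StrictMono (stretchX k) := by
  intro x y hxy
  unfold stretchX
  have h1 : min x (k : ℝ) ≤ min y k := min_le_min_right _ hxy.le
  have h2 : max x ((k : ℝ) + 1) ≤ max y (k + 1) := max_le_max_right _ hxy.le
  linarith

/-- The stretching homeomorphism of space. -/
noncomputable def stretch (k : ℤ) (p : Space) : Space :=
  !₂[stretchX k (p 0), 2 * p 1, p 2]

theorem stretch_injective : Function.Injective (stretch k) := by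
  intro p q h
  have h0 := congrArg (fun p : Space => p 0) h
  have h1 := congrArg (fun p : Space => p 1) h
  have h2 := congrArg (fun p : Space => p 2) h
  simp [stretch] at h0 h1 h2
  exact space_ext (stretchX_strictMono.injective h0) h1 h2

/-- The stretching adds to the second and to the first coordinate a nondecreasing function of that
coordinate, so it is composed of two displacements with slope bound zero. -/
theorem ambientIsotopic_stretch (A : Set Space) : AmbientIsotopic A (stretch k '' A) := by
  have h1 := AmbientIsotopic.shear (h := fun p => p 1) (by fun_prop) (v := !₂[0, 1, 0]) (k := 0)
    le_rfl one_pos (fun p s hs => by simpa using hs) A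
  have h2 := AmbientIsotopic.shear
    (h := fun p => min (p 0) k + max (p 0) (k + 1) - (k + 1)) (by fun_prop) (v := !₂[1, 0, 0])
    (k := 0) le_rfl one_pos (fun p s hs => by
      have e1 : min (p 0) (k : ℝ) ≤ min (p 0 + s) k := min_le_min_right _ (by linarith)
      have e2 : max (p 0) ((k : ℝ) + 1) ≤ max (p 0 + s) (k + 1) := max_le_max_right _ (by linarith)
      simp
      linarith)
    ((fun p : Space => p + p 1 • (!₂[0, 1, 0] : Space)) '' A)
  refine cast (congrArg _ ?_) (h1.trans h2)
  rw [image_image]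
  refine image_congr fun p _ => ?_
  apply space_ext <;> simp [stretch, stretchX]
  ring

/-- The map is affine on every slab between consecutive integers, though not across the walls of
column `k`. -/
theorem image_stretch_segment {p q : Space} (c : ℤ) (hp : c ≤ p 0) (hp' : p 0 ≤ c + 1)
    (hq : c ≤ q 0) (hq' : q 0 ≤ c + 1) :
    stretch k '' segment ℝ p q = segment ℝ (stretch k p) (stretch k q) := by
  have haff : ∃ α β : ℝ, ∀ x : ℝ, c ≤ x → x ≤ c + 1 → stretchX k x = α * x + β := by
    rcases lt_trichotomy c k with h | h | h
    · have h' : (c : ℝ) + 1 ≤ k := by exact_mod_cast h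
      exact ⟨2, 0, fun x _ h2 => by rw [stretchX_of_le (by linarith)]; ring⟩
    · subst h
      exact ⟨1, c, fun x h1 h2 => by rw [stretchX_of_mem h1 h2]; ring⟩
    · have h' : (k : ℝ) + 1 ≤ c := by exact_mod_cast h
      exact ⟨2, -1, fun x h1 _ => by rw [stretchX_of_ge (by linarith)]; ring⟩
  obtain ⟨α, β, hαβ⟩ := haff
  have key : ∀ t : ℝ, 0 ≤ t → t ≤ 1 →
      stretch k ((1 - t) • p + t • q) = (1 - t) • stretch k p + t • stretch k q := by
    intro t h0 h1
    apply space_ext <;> simp [stretch]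
    · rw [hαβ _ hp hp', hαβ _ hq hq', hαβ _ (by nlinarith) (by nlinarith)]
      ring
    · ring
  ext z
  constructor
  · rintro ⟨w, hw, rfl⟩
    obtain ⟨t, h0, h1, rfl⟩ := mem_segment_iff_exists_smul.1 hw
    exact mem_segment_iff_exists_smul.2 ⟨t, h0, h1, key t h0 h1⟩
  · intro hz
    obtain ⟨t, h0, h1, rfl⟩ := mem_segment_iff_exists_smul.1 hz
    exact ⟨_, mem_segment_iff_exists_smul.2 ⟨t, h0, h1, rfl⟩, key t h0 h1⟩

end Stretch

/-! ### Paths given by lists -/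

/-- The union of the segments between consecutive members of a list of lattice points. -/
def listPath : List (ℤ × ℤ × ℤ) → Set Space
  | a :: b :: l => segment ℝ (latPt a) (latPt b) ∪ listPath (b :: l)
  | _ => ∅

@[simp]
theorem listPath_cons_cons (a b : ℤ × ℤ × ℤ) (l : List (ℤ × ℤ × ℤ)) :
    listPath (a :: b :: l) = segment ℝ (latPt a) (latPt b) ∪ listPath (b :: l) := rfl

@[simp]
theorem listPath_singleton (a : ℤ × ℤ × ℤ) : listPath [a] = ∅ := rfl

@[simp]
theorem listPath_nil : listPath [] = ∅ := rfl

theorem listPath_append_cons (l l' : List (ℤ × ℤ × ℤ)) (c : ℤ × ℤ × ℤ) :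
    listPath (l ++ c :: l') = listPath (l ++ [c]) ∪ listPath (c :: l') := by
  induction l with
  | nil => simp
  | cons a l ih =>
    cases l with
    | nil => simp
    | cons b l =>
      simp only [List.cons_append, listPath_cons_cons] at ih ⊢
      rw [ih, union_assoc]

theorem listPath_reverse (l : List (ℤ × ℤ × ℤ)) : listPath l.reverse = listPath l := by
  induction l with
  | nil => rfl
  | cons a l ih =>
    cases l with
    | nil => rfl
    | cons b l =>
      rw [List.reverse_cons, List.reverse_cons, List.append_assoc, List.singleton_append,
        listPath_append_cons, ← List.reverse_cons, ih]
      simp [segment_symm, union_comm]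

theorem listPath_eq_iUnion (l : List (ℤ × ℤ × ℤ)) :
    listPath l = ⋃ (i : ℕ) (h : i + 1 < l.length), segment ℝ (latPt l[i]) (latPt l[i + 1]) := by
  induction l with
  | nil => simp
  | cons a l ih =>
    cases l with
    | nil => simp
    | cons b l =>
      rw [listPath_cons_cons, ih]
      ext p
      simp only [mem_union, mem_iUnion]
      constructor
      · rintro (h | ⟨i, h, hp⟩)
        · exact ⟨0, by simp, h⟩
        · exact ⟨i + 1, by simpa using h, hp⟩
      · rintro ⟨_ | i, h, hp⟩
        · exact Or.inl hp
        · exact Or.inr ⟨i, by simpa using h, hp⟩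

/-- Two points of the cubic lattice are the ends of an edge. -/
def CubicAdj (p q : ℤ × ℤ × ℤ) : Prop :=
  dist (latPt p) (latPt q) = 1

theorem CubicAdj.symm {p q : ℤ × ℤ × ℤ} (h : CubicAdj p q) : CubicAdj q p := by
  rwa [CubicAdj, dist_comm]

theorem cubicAdj_iff {p q : ℤ × ℤ × ℤ} : CubicAdj p q ↔
    (p.1 - q.1) ^ 2 + (p.2.1 - q.2.1) ^ 2 + (p.2.2 - q.2.2) ^ 2 = 1 := by
  rw [CubicAdj, EuclideanSpace.dist_eq, Real.sqrt_eq_one, Fin.sum_univ_three, Real.dist_eq,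
    Real.dist_eq, Real.dist_eq, sq_abs, sq_abs, sq_abs, latPt_zero, latPt_zero, latPt_one,
    latPt_one, latPt_two, latPt_two]
  exact_mod_cast Iff.rfl

/-- A closed list of adjacent lattice points, distinct except for the ends, is a polygon. -/
theorem exists_latticePolygon_of_list {a : ℤ × ℤ × ℤ} {l : List (ℤ × ℤ × ℤ)}
    (hnodup : (a :: l).Nodup) (hlen : 3 ≤ (a :: l).length)
    (hchain : (a :: l ++ [a]).IsChain CubicAdj) :
    ∃ P : LatticePolygon cubicLattice,
      P.numEdges = (a :: l).length ∧ P.carrier = listPath (a :: l ++ [a]) := by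
  set M := a :: l with hM
  have : NeZero M.length := ⟨by omega⟩
  have hget : ∀ (i : ZMod M.length),
      ∃ h : i.val + 1 < (M ++ [a]).length, (M ++ [a])[i.val] = M[i.val]'(ZMod.val_lt i) ∧
        (M ++ [a])[i.val + 1] = M[(i + 1).val]'(ZMod.val_lt _) := by
    intro i
    have hi := ZMod.val_lt i
    refine ⟨by simpa using hi, List.getElem_append_left hi, ?_⟩
    have hval : (i + 1).val = (i.val + 1) % M.length := by
      rw [ZMod.val_add, ZMod.val_one'' (by omega)]
    rcases Nat.lt_or_ge (i.val + 1) M.length with h | h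
    · rw [List.getElem_append_left h]
      congr 1
      rw [hval, Nat.mod_eq_of_lt h]
    · have h' : i.val + 1 = M.length := by omega
      have h0 : (i + 1).val = 0 := by rw [hval, h', Nat.mod_self]
      simp only [h0, h']
      simp [hM]
  refine ⟨⟨M.length, hlen, fun i => latPt (M[i.val]'(ZMod.val_lt i)), fun i => ?_, fun i => ?_,
    fun i j h => ?_⟩, rfl, ?_⟩
  · intro c
    fin_cases c
    exacts [⟨_, latPt_zero _⟩, ⟨_, latPt_one _⟩, ⟨_, latPt_two _⟩]
  · obtain ⟨h, h1, h2⟩ := hget i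
    have := List.isChain_iff_getElem.1 hchain i.val h
    rwa [h1, h2] at this
  · have := (hnodup.getElem_inj_iff).1 (latPt_injective h)
    exact ZMod.val_injective _ this
  · rw [listPath_eq_iUnion]
    ext p
    simp only [LatticePolygon.carrier, mem_iUnion]
    constructor
    · rintro ⟨i, hp⟩
      obtain ⟨h, h1, h2⟩ := hget i
      refine ⟨i.val, h, ?_⟩
      rwa [h1, h2]
    · rintro ⟨i, h, hp⟩
      have hi : i < M.length := by simpa using h
      obtain ⟨h', h1, h2⟩ := hget (i : ZMod M.length)
      refine ⟨i, ?_⟩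
      rw [← h1, ← h2]
      simpa only [ZMod.val_cast_of_lt hi] using hp

/-! ### Stretched edges -/

/-- The stretching map in integer coordinates. -/
def stretchPt (k : ℤ) (p : ℤ × ℤ × ℤ) : ℤ × ℤ × ℤ :=
  (if p.1 ≤ k then 2 * p.1 else 2 * p.1 - 1, 2 * p.2.1, p.2.2)

theorem stretch_latPt (k : ℤ) (p : ℤ × ℤ × ℤ) : stretch k (latPt p) = latPt (stretchPt k p) := by
  apply space_ext
  · simp only [stretch, stretchPt, latPt_zero, PiLp.toLp_apply, Matrix.cons_val_zero]
    split_ifs with h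
    · rw [stretchX_of_le (by exact_mod_cast h)]
      push_cast
      ring
    · rw [stretchX_of_ge (by exact_mod_cast not_le.1 h)]
      push_cast
      ring
  · simp [stretch, stretchPt]
  · simp [stretch, stretchPt]

/-- The inner vertices of the stretched bent edge in direction number `t` from `s`. -/
def innerPts (k : ℤ) (t : Fin 4) (s : ℤ × ℤ × ℤ) : List (ℤ × ℤ × ℤ) :=
  match t with
  | 0 => if s.1 = k then [] else [stretchPt k s + (1, 0, 0)]
  | 1 => [stretchPt k s + (0, 1, 0)]
  | 2 =>
    if s.1 ≤ k then
      [stretchPt k s + (-1, 0, 0), stretchPt k s + (-1, 1, 0), stretchPt k s + (-2, 1, 0)]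
    else if s.1 = k + 1 then [stretchPt k s + (0, 1, 0), stretchPt k s + (-1, 1, 0)]
    else [stretchPt k s + (0, 1, 0), stretchPt k s + (-1, 1, 0), stretchPt k s + (-1, 2, 0)]
  | 3 => []

/-- The vertices of the stretched bent edge in direction number `t` from `s`. -/
def edgePts (k : ℤ) (t : Fin 4) (s : ℤ × ℤ × ℤ) : List (ℤ × ℤ × ℤ) :=
  stretchPt k s :: (innerPts k t s ++ [stretchPt k (s + latDir t)])

/-- The lengths of the stretched edges that do not cross the column number `k`. -/
def stepWeight : Fin 4 → ℕ :=
  ![2, 2, 4, 1]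

section Edges

variable {k : ℤ} {t : Fin 4} {s : ℤ × ℤ × ℤ}

/-- An edge crossing the unstretched column is one shorter than its weight: an x-edge keeps length
1, and a diagonal crosses the column by a single horizontal edge at middle height. -/
theorem length_innerPts : (innerPts k t s).length + 1 +
    (if Crosses k s.1 (s + latDir t).1 then 1 else 0) = stepWeight t := by
  have ht : t = 0 ∨ t = 1 ∨ t = 2 ∨ t = 3 := by
    fin_cases t <;> simp
  by_cases hc : Crosses k s.1 (s + latDir t).1
  all_goals
    simp only [hc, if_true, if_false]
    unfold Crosses at hc
    rcases ht with rfl | rfl | rfl | rfl <;>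
      simp only [latDir, Prod.fst_add, Matrix.cons_val] at hc <;>
      simp only [innerPts, stepWeight] <;> (try split_ifs) <;> first | rfl | omega

theorem isChain_edgePts : (edgePts k t s).IsChain CubicAdj := by
  obtain ⟨a, b, c⟩ := s
  fin_cases t <;> simp [edgePts, innerPts, latDir, stretchPt]
  · split_ifs <;> simp [cubicAdj_iff] <;> ring_nf <;> simp <;> omega
  · simp [cubicAdj_iff]
    ring_nf
    simp
  · split_ifs <;> simp [cubicAdj_iff] <;> ring_nf <;> simp <;> omega
  · simp [cubicAdj_iff]

theorem nodup_edgePts : (edgePts k t s).Nodup := by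
  obtain ⟨a, b, c⟩ := s
  fin_cases t <;> simp [edgePts, innerPts, latDir, stretchPt]
  · split_ifs <;> simp <;> omega
  · omega
  · split_ifs <;> simp <;> omega


theorem latPt_mem_listPath {l : List (ℤ × ℤ × ℤ)} {q : ℤ × ℤ × ℤ} (hl : 2 ≤ l.length)
    (hq : q ∈ l) : latPt q ∈ listPath l := by
  induction l with
  | nil => simp at hq
  | cons a l ih =>
    match l, hl with
    | b :: l, _ =>
      rw [listPath_cons_cons]
      rcases List.mem_cons.1 hq with rfl | hq
      · exact Or.inl (left_mem_segment _ _ _)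
      · match l with
        | [] =>
          obtain rfl : q = b := by simpa using hq
          exact Or.inl (right_mem_segment _ _ _)
        | c :: l => exact Or.inr (ih (by simp) hq)

theorem image_stretch_segment_latPt (c : ℤ) {p q : Space} {a b : ℤ × ℤ × ℤ} (hp : c ≤ p 0)
    (hp' : p 0 ≤ c + 1) (hq : c ≤ q 0) (hq' : q 0 ≤ c + 1) (ha : stretch k p = latPt a)
    (hb : stretch k q = latPt b) :
    stretch k '' segment ℝ p q = segment ℝ (latPt a) (latPt b) := by
  rw [image_stretch_segment c hp hp' hq hq', ha, hb]

theorem image_stretch_bentEdge_two : stretch k '' bentEdge k 2 s =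
    segment ℝ (stretch k (latPt s)) (stretch k (bendLow k s)) ∪
        segment ℝ (stretch k (bendLow k s)) (stretch k (bendMid s)) ∪
      (segment ℝ (stretch k (bendMid s)) (stretch k (bendHigh k s)) ∪
        segment ℝ (stretch k (bendHigh k s)) (stretch k (latPt (s + latDir 2)))) := by
  have h1 : ((s.1 - 1 : ℤ) : ℝ) ≤ latPt s 0 ∧ latPt s 0 ≤ (s.1 - 1 : ℤ) + 1 := by simp
  have h2 : ((s.1 - 1 : ℤ) : ℝ) ≤ bendLow k s 0 ∧ bendLow k s 0 ≤ (s.1 - 1 : ℤ) + 1 := by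
    unfold bendLow
    split_ifs <;> simp <;> linarith
  have h3 : ((s.1 - 1 : ℤ) : ℝ) ≤ bendMid s 0 ∧ bendMid s 0 ≤ (s.1 - 1 : ℤ) + 1 := by
    simp [bendMid]
    linarith
  have h4 : ((s.1 - 1 : ℤ) : ℝ) ≤ bendHigh k s 0 ∧ bendHigh k s 0 ≤ (s.1 - 1 : ℤ) + 1 := by
    unfold bendHigh
    split_ifs <;> simp <;> linarith
  have h5 : ((s.1 - 1 : ℤ) : ℝ) ≤ latPt (s + latDir 2) 0 ∧
      latPt (s + latDir 2) 0 ≤ (s.1 - 1 : ℤ) + 1 := by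
    simp [latDir]
  rw [bentEdge, if_pos rfl, image_union, image_union, image_union,
    image_stretch_segment _ h1.1 h1.2 h2.1 h2.2, image_stretch_segment _ h2.1 h2.2 h3.1 h3.2,
    image_stretch_segment _ h3.1 h3.2 h4.1 h4.2, image_stretch_segment _ h4.1 h4.2 h5.1 h5.2]

theorem listPath_edgePts_two : listPath (edgePts k 2 s) = stretch k '' bentEdge k 2 s := by
  rw [image_stretch_bentEdge_two, stretch_latPt, stretch_latPt]
  rcases lt_trichotomy s.1 (k + 1) with h | h | h
  · have h' : s.1 ≤ k := by omega
    have hr : (s.1 : ℝ) ≤ k := by exact_mod_cast h'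
    have hX : stretchX k ((s.1 : ℝ) - 2⁻¹) = 2 * s.1 - 1 := by
      rw [stretchX_of_le (by linarith)]
      ring
    have hY : stretchX k ((s.1 : ℝ) - 1) = 2 * s.1 - 2 := by
      rw [stretchX_of_le (by linarith)]
      ring
    have e1 : stretch k (bendLow k s) = latPt (stretchPt k s + (-1, 0, 0)) := by
      rw [bendLow, if_neg (by omega)]
      apply space_ext <;> simp [stretch, stretchPt, hX, h'] <;> ring
    have e2 : stretch k (bendMid s) = latPt (stretchPt k s + (-1, 1, 0)) := by
      rw [bendMid]
      apply space_ext <;> simp [stretch, stretchPt, hX, h'] <;> ring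
    have e3 : stretch k (bendHigh k s) = latPt (stretchPt k s + (-2, 1, 0)) := by
      rw [bendHigh, if_neg (by omega)]
      apply space_ext <;> simp [stretch, stretchPt, hY, h'] <;> ring
    rw [e1, e2, e3]
    simp [edgePts, innerPts, h', union_assoc]
  -- In the unstretched column the image of the middle is not a lattice point, but it is the
  -- midpoint of the horizontal edge formed by the two inner segments.
  · have hr : (s.1 : ℝ) = k + 1 := by exact_mod_cast h
    have h' : ¬ s.1 ≤ k := by omega
    have hX : stretchX k ((s.1 : ℝ) - 2⁻¹) = 2 * s.1 - 3 / 2 := by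
      rw [stretchX_of_mem (by linarith) (by linarith)]
      linarith
    have hY : stretchX k ((s.1 : ℝ) - 1) = 2 * s.1 - 2 := by
      rw [stretchX_of_le (by linarith)]
      ring
    have hZ : stretchX k s.1 = 2 * s.1 - 1 := by
      rw [stretchX_of_ge (by linarith)]
    have e1 : stretch k (bendLow k s) = latPt (stretchPt k s + (0, 1, 0)) := by
      rw [bendLow, if_pos (by omega)]
      apply space_ext <;> simp [stretch, stretchPt, hZ, h'] <;> ring
    have e2 : stretch k (bendMid s) = (1 / 2 : ℝ) • latPt (stretchPt k s + (0, 1, 0)) +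
        (1 / 2 : ℝ) • latPt (stretchPt k s + (-1, 1, 0)) := by
      rw [bendMid]
      apply space_ext <;> simp [stretch, stretchPt, hX, h'] <;> ring
    have e3 : stretch k (bendHigh k s) = latPt (stretchPt k s + (-1, 1, 0)) := by
      rw [bendHigh, if_neg (by omega)]
      apply space_ext <;> simp [stretch, stretchPt, hY, h'] <;> ring
    rw [union_assoc, ← union_assoc (segment ℝ (stretch k (bendLow k s)) _), e1, e3,
      ← segment_eq_union_of_midpoint e2]
    simp [edgePts, innerPts, h]
  · have h' : ¬ s.1 ≤ k := by omega
    have hr : (k : ℝ) + 2 ≤ s.1 := by exact_mod_cast (by omega : k + 2 ≤ s.1)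
    have hX : stretchX k ((s.1 : ℝ) - 2⁻¹) = 2 * s.1 - 2 := by
      rw [stretchX_of_ge (by linarith)]
      ring
    have hZ : stretchX k s.1 = 2 * s.1 - 1 := by
      rw [stretchX_of_ge (by linarith)]
    have e1 : stretch k (bendLow k s) = latPt (stretchPt k s + (0, 1, 0)) := by
      rw [bendLow, if_pos (by omega)]
      apply space_ext <;> simp [stretch, stretchPt, hZ, h'] <;> ring
    have e2 : stretch k (bendMid s) = latPt (stretchPt k s + (-1, 1, 0)) := by
      rw [bendMid]
      apply space_ext <;> simp [stretch, stretchPt, hX, h'] <;> ring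
    have e3 : stretch k (bendHigh k s) = latPt (stretchPt k s + (-1, 2, 0)) := by
      rw [bendHigh, if_pos (by omega)]
      apply space_ext <;> simp [stretch, stretchPt, hX, h'] <;> ring
    rw [e1, e2, e3]
    simp [edgePts, innerPts, h', h.ne', union_assoc]

theorem listPath_edgePts : listPath (edgePts k t s) = stretch k '' bentEdge k t s := by
  have hhalf : ∀ {a b : ℤ × ℤ × ℤ} {c : ℤ × ℤ × ℤ}, c + c = a + b →
      segment ℝ (latPt a) (latPt b) =
        segment ℝ (latPt a) (latPt c) ∪ segment ℝ (latPt c) (latPt b) := by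
    intro a b c h
    refine segment_eq_union_of_midpoint ?_
    have h2 : latPt c + latPt c = latPt a + latPt b := by rw [← latPt_add, ← latPt_add, h]
    have h3 : (1 / 2 : ℝ) • (latPt c + latPt c) = (1 / 2 : ℝ) • (latPt a + latPt b) := by rw [h2]
    rw [← smul_add, ← h3]
    module
  fin_cases t
  · simp only [bentEdge, edgePts]
    rw [if_neg (by decide), image_stretch_segment_latPt s.1 _ _ _ _ (stretch_latPt _ _)
      (stretch_latPt _ _)]
    · simp only [innerPts]
      split_ifs with h
      · simp
      · simp only [List.cons_append, List.nil_append, listPath_cons_cons, listPath_singleton,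
          union_empty]
        refine (hhalf ?_).symm
        simp only [stretchPt, latDir, Prod.ext_iff]
        split_ifs <;> simp <;> omega
    all_goals simp [latDir]
  · simp only [bentEdge, edgePts]
    rw [if_neg (by decide), image_stretch_segment_latPt s.1 _ _ _ _ (stretch_latPt _ _)
      (stretch_latPt _ _)]
    · simp only [innerPts, List.cons_append, List.nil_append, listPath_cons_cons,
        listPath_singleton, union_empty]
      refine (hhalf ?_).symm
      simp only [stretchPt, latDir, Prod.ext_iff]
      simp
      omega
    all_goals simp [latDir]
  · exact listPath_edgePts_two
  · simp only [bentEdge, edgePts]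
    rw [if_neg (by decide), image_stretch_segment_latPt s.1 _ _ _ _ (stretch_latPt _ _)
      (stretch_latPt _ _)]
    · simp [innerPts]
    all_goals simp [latDir]

end Edges

/-! ### The polygon in the cubic lattice -/

theorem Crosses.comm {k a b : ℤ} : Crosses k a b ↔ Crosses k b a := by
  unfold Crosses
  omega

/-- The polygon may traverse the edge against its standard direction; then the list of vertices is
reversed. -/
theorem IsEdge.exists_innerPts {t : Fin 4} {s p q : ℤ × ℤ × ℤ} (h : IsEdge t s p q) (k : ℤ) :
    ∃ m : List (ℤ × ℤ × ℤ),
      m.length + 1 + (if Crosses k p.1 q.1 then 1 else 0) = stepWeight t ∧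
      (stretchPt k p :: (m ++ [stretchPt k q])).IsChain CubicAdj ∧
      (stretchPt k p :: (m ++ [stretchPt k q])).Nodup ∧
      listPath (stretchPt k p :: (m ++ [stretchPt k q])) = stretch k '' bentEdge k t s := by
  rcases h with ⟨rfl, rfl⟩ | ⟨rfl, rfl⟩
  · exact ⟨innerPts k t p, length_innerPts, isChain_edgePts, nodup_edgePts, listPath_edgePts⟩
  · have hrev : stretchPt k (q + latDir t) :: ((innerPts k t q).reverse ++ [stretchPt k q]) =
        (edgePts k t q).reverse := by simp [edgePts]
    refine ⟨(innerPts k t q).reverse, ?_, ?_, ?_, ?_⟩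
    · simp only [Crosses.comm, List.length_reverse]
      exact length_innerPts
    · rw [hrev, List.isChain_reverse]
      exact isChain_edgePts.imp fun _ _ h => h.symm
    · rw [hrev, List.nodup_reverse]
      exact nodup_edgePts
    · rw [hrev, listPath_reverse]
      exact listPath_edgePts

/-- A polygon without acute turns in the simple hexagonal lattice can be transformed into a
polygon in the cubic lattice. -/
theorem IsLatPolygon.exists_latticePolygon {n : ℕ} {v : ℕ → ℤ × ℤ × ℤ} (h : IsLatPolygon n v)
    (hturn : NoTurn v) {e : ℕ → Fin 4 × (ℤ × ℤ × ℤ)}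
    (he : ∀ i, IsEdge (e i).1 (e i).2 (v i) (v (i + 1))) (k : ℤ) :
    ∃ P : LatticePolygon cubicLattice,
      P.numEdges + ((Finset.range n).filter fun i => Crosses k (v i).1 (v (i + 1)).1).card =
        ∑ i ∈ Finset.range n, stepWeight (e i).1 ∧
      AmbientIsotopic (polyPath (fun i => latPt (v i)) 0 n) P.carrier := by
  choose m hlen hchain hnodup hpath using fun i => (he i).exists_innerPts k
  -- Each piece keeps its first vertex and drops its last, so that the concatenation lists every
  -- vertex once.
  set D : ℕ → List (ℤ × ℤ × ℤ) := fun i => stretchPt k (v i) :: m i with hD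
  have hn := h.three_le
  have hsplit : ∀ j, (List.range (j + 1)).flatMap D ++ [stretchPt k (v (j + 1))] =
      (List.range j).flatMap D ++ stretchPt k (v j) :: (m j ++ [stretchPt k (v (j + 1))]) := by
    intro j
    simp [List.range_succ, hD]
  have hC : ∀ j, ((List.range j).flatMap D ++ [stretchPt k (v j)]).IsChain CubicAdj := by
    intro j
    induction j with
    | zero => simp
    | succ j ih =>
      rw [hsplit, List.isChain_split]
      exact ⟨ih, hchain j⟩
  have hP : ∀ j, listPath ((List.range j).flatMap D ++ [stretchPt k (v j)]) =
      ⋃ i ∈ Finset.range j, stretch k '' bentEdge k (e i).1 (e i).2 := by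
    intro j
    induction j with
    | zero => simp
    | succ j ih =>
      rw [hsplit, listPath_append_cons, ih, hpath, Finset.range_add_one,
        Finset.set_biUnion_insert, union_comm]
  have hfat : ∀ i, ∀ q ∈ D i, ∃ z, fatEdge k (e i).1 (e i).2 z ∧ stretch k z = latPt q ∧
      z ≠ latPt (v (i + 1)) := by
    intro i q hq
    have hq' : q ∈ stretchPt k (v i) :: (m i ++ [stretchPt k (v (i + 1))]) := by
      rw [← List.cons_append]
      exact List.mem_append_left _ hq
    have := latPt_mem_listPath (by simp) hq'
    rw [hpath] at this
    obtain ⟨z, hz, hzq⟩ := this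
    refine ⟨z, fatEdge_of_mem_bentEdge hz, hzq, ?_⟩
    rintro rfl
    rw [stretch_latPt] at hzq
    have hnd := hnodup i
    rw [← List.cons_append, List.nodup_append] at hnd
    exact hnd.2.2 q hq _ (List.mem_singleton_self _) (latPt_injective hzq).symm
  have hN : ((List.range n).flatMap D).Nodup := by
    rw [List.nodup_flatMap]
    refine ⟨fun i _ => ?_, ?_⟩
    · have hnd := hnodup i
      rw [← List.cons_append, List.nodup_append] at hnd
      exact hnd.1
    · refine List.nodup_range.pairwise_of_forall_ne fun i hi j hj hij => ?_
      rw [Function.onFun, List.disjoint_left]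
      intro q hqi hqj
      rw [List.mem_range] at hi hj
      have hmod : ¬ i ≡ j [MOD n] := fun hc => hij (hc.eq_of_lt_of_lt hi hj)
      obtain ⟨z, hz, hzq, hzi⟩ := hfat i q hqi
      obtain ⟨z', hz', hzq', hzj⟩ := hfat j q hqj
      -- A vertex common to two pieces comes from a point common to two fat edges, hence from an end
      -- of each. It is not the final end of either, so it equals both `v i` and `v j`.
      obtain rfl : z = z' := stretch_injective (hzq.trans hzq'.symm)
      have h1 := (h.fatEdge_inter hturn hmod (he i) (he j) hz hz').resolve_right hzi
      have h2 := (h.fatEdge_inter hturn (fun hc => hmod hc.symm) (he j) (he i) hz' hz).resolve_right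
        hzj
      exact hmod (h.inj _ _ (latPt_injective (h1.symm.trans h2)))
  have hL : ((List.range n).flatMap D).length = ∑ i ∈ Finset.range n, ((m i).length + 1) := by
    rw [List.length_flatMap, Finset.sum, Finset.range_val, ← Multiset.coe_range, Multiset.map_coe,
      Multiset.sum_coe]
    rfl
  obtain ⟨l, hl⟩ : ∃ l, (List.range n).flatMap D = stretchPt k (v 0) :: l := by
    obtain ⟨j, rfl⟩ : ∃ j, n = j + 1 := ⟨n - 1, by omega⟩
    rw [List.range_succ_eq_map]
    exact ⟨_, rfl⟩
  have hper : v n = v 0 := by simpa using h.periodic 0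
  have hlen3 : 3 ≤ ((List.range n).flatMap D).length := by
    rw [hL]
    calc 3 ≤ ∑ i ∈ Finset.range n, 1 := by simpa using hn
      _ ≤ _ := Finset.sum_le_sum fun i _ => by omega
  have hCn := hC n
  have hPn := hP n
  rw [hper] at hCn hPn
  obtain ⟨P, hPe, hPc⟩ := exists_latticePolygon_of_list (hl ▸ hN) (hl ▸ hlen3) (hl ▸ hCn)
  refine ⟨P, ?_, ?_⟩
  · rw [hPe, ← hl, hL, Finset.card_filter, ← Finset.sum_add_distrib]
    exact Finset.sum_congr rfl fun i _ => hlen i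
  · rw [hPc, ← hl, hPn, ← image_iUnion₂]
    exact (h.ambientIsotopic_bent hturn he k).trans (ambientIsotopic_stretch _)

/-! ### The rotation of the lattice -/

/-- The rotation of the simple hexagonal lattice by sixty degrees, in sheared coordinates. -/
def latRot (p : ℤ × ℤ × ℤ) : ℤ × ℤ × ℤ :=
  (-p.2.1, p.1 + p.2.1, p.2.2)

/-- The action of the rotation on the directions of edges. -/
def dirRot : Fin 4 → Fin 4 :=
  ![1, 2, 0, 3]

theorem isStep_latRot {t : Fin 4} {p q : ℤ × ℤ × ℤ} :
    IsStep (dirRot t) (latRot p) (latRot q) ↔ IsStep t p q := by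
  have ht : t = 0 ∨ t = 1 ∨ t = 2 ∨ t = 3 := by
    fin_cases t <;> simp
  rcases ht with rfl | rfl | rfl | rfl <;>
    simp only [dirRot, Matrix.cons_val, isStep_zero, isStep_one, isStep_two, isStep_three,
      latRot] <;> omega

theorem latAdj_latRot {p q : ℤ × ℤ × ℤ} : LatAdj (latRot p) (latRot q) ↔ LatAdj p q := by
  simp only [latAdj_iff_coords, latRot]
  omega

theorem latRot_injective : Function.Injective latRot := by
  intro p q h
  simp only [latRot, Prod.ext_iff] at h ⊢
  omega

theorem IsLatPolygon.rot {n : ℕ} {v : ℕ → ℤ × ℤ × ℤ} (h : IsLatPolygon n v) :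
    IsLatPolygon n fun i => latRot (v i) where
  three_le := h.three_le
  periodic i := by rw [h.periodic]
  inj i j hij := h.inj i j (latRot_injective hij)
  adj i := latAdj_latRot.2 (h.adj i)

theorem NoTurn.rot {v : ℕ → ℤ × ℤ × ℤ} (h : NoTurn v) : NoTurn fun i => latRot (v i) :=
  fun i hi => h i (latAdj_latRot.1 hi)

/-- Linear shears are realized by isotopies. -/
theorem ambientIsotopic_polyPath_shear (f : Space →L[ℝ] ℝ) {u : Space} (hu : 0 ≤ f u)
    (v : ℕ → Space) (s t : ℕ) :
    AmbientIsotopic (polyPath v s t) (polyPath (fun i => v i + f (v i) • u) s t) := by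
  have h := AmbientIsotopic.shear (h := f) f.continuous (v := u) le_rfl one_pos
    (fun p r hr => by
      rw [map_add, map_smul, smul_eq_mul]
      nlinarith [mul_nonneg hr hu]) (polyPath v s t)
  refine cast (congrArg _ ?_) h
  have hg : ∀ p q, (fun p => p + f p • u) '' segment ℝ p q =
      segment ℝ (p + f p • u) (q + f q • u) := fun p q =>
    image_segment ℝ ((LinearMap.id + f.toLinearMap.smulRight u).toAffineMap) p q
  simp only [polyPath, image_iUnion₂, hg]

/-- In sheared coordinates the rotation is a product of two shears, `(x, y) ↦ (x, x + y)` and `(x,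
y) ↦ (x - y, y)`. -/
theorem ambientIsotopic_latRot (v : ℕ → ℤ × ℤ × ℤ) (s t : ℕ) :
    AmbientIsotopic (polyPath (fun i => latPt (v i)) s t)
      (polyPath (fun i => latPt (latRot (v i))) s t) := by
  have h1 := ambientIsotopic_polyPath_shear (EuclideanSpace.proj (0 : Fin 3))
    (u := !₂[0, 1, 0]) (by simp) (fun i => latPt (v i)) s t
  have h2 := ambientIsotopic_polyPath_shear (-EuclideanSpace.proj (1 : Fin 3))
    (u := !₂[1, 0, 0]) (by simp)
    (fun i => latPt (v i) + EuclideanSpace.proj (𝕜 := ℝ) (0 : Fin 3) (latPt (v i)) •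
      (!₂[0, 1, 0] : Space)) s t
  refine cast (congrArg _ (polyPath_congr fun i _ _ => ?_)) (h1.trans h2)
  apply space_ext <;> simp [latRot]
  ring

/-! ### Counting edges -/

/-- The number of edges in a given direction. -/
def stepCount (n : ℕ) (v : ℕ → ℤ × ℤ × ℤ) (t : Fin 4) : ℕ :=
  ((Finset.range n).filter fun i => IsStep t (v i) (v (i + 1))).card

theorem stepCount_rot (n : ℕ) (v : ℕ → ℤ × ℤ × ℤ) (t : Fin 4) :
    stepCount n (fun i => latRot (v i)) (dirRot t) = stepCount n v t := by
  simp only [stepCount, isStep_latRot]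

theorem IsEdge.isStep_iff {t t' : Fin 4} {s p q : ℤ × ℤ × ℤ} (h : IsEdge t s p q) :
    IsStep t' p q ↔ t' = t := by
  have ht : ∀ t : Fin 4, t = 0 ∨ t = 1 ∨ t = 2 ∨ t = 3 := by
    decide
  rcases h with ⟨rfl, rfl⟩ | ⟨rfl, rfl⟩ <;>
    rcases ht t with rfl | rfl | rfl | rfl <;> rcases ht t' with rfl | rfl | rfl | rfl <;>
    simp [isStep_zero, isStep_one, isStep_two, isStep_three, latDir] <;> omega

theorem sum_stepCount {n : ℕ} {v : ℕ → ℤ × ℤ × ℤ} (h : ∀ i, LatAdj (v i) (v (i + 1))) :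
    stepCount n v 0 + stepCount n v 1 + stepCount n v 2 + stepCount n v 3 = n := by
  choose e he using fun i => (h i).exists_isEdge
  simp only [stepCount, (he _).isStep_iff, Finset.card_filter, ← Finset.sum_add_distrib]
  refine (Finset.sum_congr rfl fun i _ => ?_).trans (b := ∑ i ∈ Finset.range n, 1) (by simp)
  generalize (e i).1 = t
  revert t
  decide

/-- Relative to weight 2 for each edge, a diagonal costs two more and a vertical edge one less. -/
theorem sum_stepWeight {n : ℕ} {v : ℕ → ℤ × ℤ × ℤ} {e : ℕ → Fin 4 × (ℤ × ℤ × ℤ)}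
    (he : ∀ i, IsEdge (e i).1 (e i).2 (v i) (v (i + 1))) :
    ∑ i ∈ Finset.range n, stepWeight (e i).1 + stepCount n v 3 = 2 * n + 2 * stepCount n v 2 := by
  have h2 : 2 * n = ∑ i ∈ Finset.range n, 2 := by simp [mul_comm]
  rw [h2]
  simp only [stepCount, (he _).isStep_iff, Finset.card_filter, Finset.mul_sum,
    ← Finset.sum_add_distrib]
  refine Finset.sum_congr rfl fun i _ => ?_
  generalize (e i).1 = t
  revert t
  decide

/-- A nontrivial polygon without acute turns, in a suitable position, can be transformed into a
polygon in the cubic lattice that is not too long. -/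
theorem IsLatPolygon.exists_short_of_noTurn {n : ℕ} {v : ℕ → ℤ × ℤ × ℤ} (h : IsLatPolygon n v)
    (hturn : NoTurn v) (hK : ¬ AmbientIsotopic (polyPath (fun i => latPt (v i)) 0 n) roundCircle)
    (hmin : 3 * stepCount n v 2 + stepCount n v 3 ≤ n) :
    ∃ P : LatticePolygon cubicLattice, 3 * P.numEdges + 30 ≤ 8 * n ∧
      AmbientIsotopic (polyPath (fun i => latPt (v i)) 0 n) P.carrier := by
  choose e he using fun i => (h.adj i).exists_isEdge
  obtain ⟨k, hk⟩ := h.exists_four_le_card_crosses hturn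
    (f := (EuclideanSpace.proj (𝕜 := ℝ) (0 : Fin 3)).toLinearMap)
    (fun p => p.1) ⟨!₂[1, 0, 0], by simp⟩ (fun p => by simp) (fun p q hpq => by
      rw [latAdj_iff_coords] at hpq
      rw [abs_le]
      omega) hK
  obtain ⟨l, hl⟩ := h.exists_four_le_card_crosses hturn
    (f := (EuclideanSpace.proj (𝕜 := ℝ) (2 : Fin 3)).toLinearMap)
    (fun p => p.2.2) ⟨!₂[0, 0, 1], by simp⟩ (fun p => by simp) (fun p q hpq => by
      rw [latAdj_iff_coords] at hpq
      rw [abs_le]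
      omega) hK
  -- Only edges in direction w change the third coordinate.
  have hw : 4 ≤ stepCount n v 3 := by
    refine hl.trans (Finset.card_le_card fun i hi => ?_)
    rw [Finset.mem_filter] at hi ⊢
    refine ⟨hi.1, ?_⟩
    have hadj := h.adj i
    have hc := hi.2
    rw [latAdj_iff_coords] at hadj
    rw [isStep_three]
    unfold Crosses at hc
    omega
  obtain ⟨P, hP, hiso⟩ := h.exists_latticePolygon hturn he k
  refine ⟨P, ?_, hiso⟩
  -- With `z`, `w`, `c` diagonal, vertical and column-crossing edges, `P` has `2n + 2z - w - c`
  -- edges. Tripling and using `6z ≤ 2n - 2w` gives at most `8n - 5w - 3c ≤ 8n - 32`.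
  have := sum_stepWeight (n := n) he
  omega

/-- A nontrivial polygon in the simple hexagonal lattice can be transformed into a polygon in
the cubic lattice that is not too long. -/
theorem IsLatPolygon.exists_short {n : ℕ} {v : ℕ → ℤ × ℤ × ℤ} (h : IsLatPolygon n v)
    (hK : ¬ AmbientIsotopic (polyPath (fun i => latPt (v i)) 0 n) roundCircle) :
    ∃ P : LatticePolygon cubicLattice, 3 * P.numEdges + 30 ≤ 8 * n ∧
      AmbientIsotopic (polyPath (fun i => latPt (v i)) 0 n) P.carrier := by
  obtain ⟨m, w, hmn, hw, hturn, hiso⟩ := h.exists_noTurn hK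
  suffices ∃ P : LatticePolygon cubicLattice, 3 * P.numEdges + 30 ≤ 8 * m ∧
      AmbientIsotopic (polyPath (fun i => latPt (w i)) 0 m) P.carrier by
    obtain ⟨P, hP, hP'⟩ := this
    exact ⟨P, by omega, hiso.symm.trans hP'⟩
  have hKw : ¬ AmbientIsotopic (polyPath (fun i => latPt (w i)) 0 m) roundCircle :=
    fun hc => hK (hiso.symm.trans hc)
  have hsum := sum_stepCount (n := m) hw.adj
  have r1 := ambientIsotopic_latRot w 0 m
  have r2 := r1.trans (ambientIsotopic_latRot (fun i => latRot (w i)) 0 m)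
  have c := stepCount_rot m w
  have c' := stepCount_rot m (fun i => latRot (w i))
  have c1 := c 1
  have c3 := c 3
  have d1 := (c' 1).trans (c 0)
  have d3 := (c' 3).trans (c 3)
  simp only [dirRot, Matrix.cons_val] at c1 c3 d1 d3
  -- The three horizontal counts add up to `m - stepCount m w 3`, so one of them is at most a third
  -- of it; zero, one or two rotations make that direction the diagonal.
  by_cases h2 : 3 * stepCount m w 2 + stepCount m w 3 ≤ m
  · exact hw.exists_short_of_noTurn hturn hKw h2
  · by_cases h1 : 3 * stepCount m w 1 + stepCount m w 3 ≤ m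
    · obtain ⟨P, hP, hP'⟩ := hw.rot.exists_short_of_noTurn hturn.rot
        (fun hc => hKw (r1.trans hc)) (by rwa [c1, c3])
      exact ⟨P, hP, r1.trans hP'⟩
    · obtain ⟨P, hP, hP'⟩ := hw.rot.rot.exists_short_of_noTurn hturn.rot.rot
        (fun hc => hKw (r2.trans hc)) (by
          rw [d1, d3]
          omega)
      exact ⟨P, hP, r2.trans hP'⟩

/-! ### Polygons in the simple hexagonal lattice and their knot types -/

theorem LatticePolygon.carrier_eq_polyPath {L : Set Space} (P : LatticePolygon L) :
    P.carrier = polyPath (fun i => P.vertex (i : ZMod P.numEdges)) 0 P.numEdges := by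
  have : NeZero P.numEdges := ⟨by have := P.three_le; omega⟩
  ext p
  simp only [LatticePolygon.carrier, mem_iUnion, mem_polyPath]
  constructor
  · rintro ⟨i, hi⟩
    refine ⟨i.val, Nat.zero_le _, ZMod.val_lt i, ?_⟩
    push_cast
    rwa [ZMod.natCast_zmod_val]
  · rintro ⟨i, -, -, hi⟩
    exact ⟨i, by simpa using hi⟩

/-- The point of the simple hexagonal lattice with given integer coordinates. -/
noncomputable def shPt (p : ℤ × ℤ × ℤ) : Space :=
  (p.1 : ℝ) • !₂[(1 : ℝ), 0, 0] + (p.2.1 : ℝ) • !₂[(1 / 2 : ℝ), √3 / 2, 0]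
    + (p.2.2 : ℝ) • !₂[(0 : ℝ), 0, 1]

/-- The squared length is the integral form `x² + xy + y² + z²`; completing squares bounds each
coordinate by one, which leaves finitely many cases. -/
theorem latAdj_of_dist_shPt {p q : ℤ × ℤ × ℤ} (h : dist (shPt p) (shPt q) = 1) : LatAdj p q := by
  rw [EuclideanSpace.dist_eq, Real.sqrt_eq_one, Fin.sum_univ_three, Real.dist_eq,
    Real.dist_eq, Real.dist_eq, sq_abs, sq_abs, sq_abs] at h
  simp [shPt] at h
  have h3 : (√3 : ℝ) ^ 2 = 3 := Real.sq_sqrt (by norm_num)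
  have hr : (((q.1 - p.1) ^ 2 + (q.1 - p.1) * (q.2.1 - p.2.1) + (q.2.1 - p.2.1) ^ 2 +
      (q.2.2 - p.2.2) ^ 2 : ℤ) : ℝ) = (1 : ℤ) := by
    push_cast
    rw [← h]
    linear_combination (-(1 / 4 : ℝ) * ((q.2.1 : ℝ) - p.2.1) ^ 2) * h3
  rw [Int.cast_inj] at hr
  obtain ⟨x, hx⟩ : ∃ x, x = q.1 - p.1 := ⟨_, rfl⟩
  obtain ⟨y, hy⟩ : ∃ y, y = q.2.1 - p.2.1 := ⟨_, rfl⟩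
  obtain ⟨z, hz⟩ : ∃ z, z = q.2.2 - p.2.2 := ⟨_, rfl⟩
  rw [← hx, ← hy, ← hz] at hr
  have hx1 : x ≤ 1 := by nlinarith [sq_nonneg (2 * y + x), sq_nonneg z]
  have hx2 : -1 ≤ x := by nlinarith [sq_nonneg (2 * y + x), sq_nonneg z]
  have hy1 : y ≤ 1 := by nlinarith [sq_nonneg (2 * x + y), sq_nonneg z]
  have hy2 : -1 ≤ y := by nlinarith [sq_nonneg (2 * x + y), sq_nonneg z]
  have hz1 : z ≤ 1 := by nlinarith [sq_nonneg (2 * x + y), sq_nonneg y]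
  have hz2 : -1 ≤ z := by nlinarith [sq_nonneg (2 * x + y), sq_nonneg y]
  rw [latAdj_iff_coords]
  interval_cases x <;> interval_cases y <;> interval_cases z <;> omega

/-- The second coordinate is scaled by `2 / √3`, and then half of it is subtracted from the first.
-/
theorem ambientIsotopic_shPt (v : ℕ → ℤ × ℤ × ℤ) (s t : ℕ) :
    AmbientIsotopic (polyPath (fun i => shPt (v i)) s t)
      (polyPath (fun i => latPt (v i)) s t) := by
  have h3 : 0 < (√3 : ℝ) := Real.sqrt_pos.2 (by norm_num)
  have h4 : (√3 : ℝ) ≤ 2 := by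
    rw [Real.sqrt_le_iff]
    norm_num
  have h1 := ambientIsotopic_polyPath_shear
    ((2 / √3 - 1 : ℝ) • EuclideanSpace.proj (1 : Fin 3))
    (u := !₂[0, 1, 0]) (by
      simp
      rwa [one_le_div h3]) (fun i => shPt (v i)) s t
  have h2 := ambientIsotopic_polyPath_shear (-(1 / 2 : ℝ) • EuclideanSpace.proj (1 : Fin 3))
    (u := !₂[1, 0, 0]) (by simp) (fun i => shPt (v i) +
      ((2 / √3 - 1 : ℝ) • EuclideanSpace.proj (𝕜 := ℝ) (1 : Fin 3)) (shPt (v i)) •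
        (!₂[0, 1, 0] : Space)) s t
  refine cast (congrArg _ (polyPath_congr fun i _ _ => ?_)) (h1.trans h2)
  apply space_ext <;> simp [shPt] <;> field_simp <;> ring

/-- A polygon in the simple hexagonal lattice, in sheared coordinates. -/
theorem LatticePolygon.exists_isLatPolygon (P : LatticePolygon shLattice) :
    ∃ v, IsLatPolygon P.numEdges v ∧
      AmbientIsotopic P.carrier (polyPath (fun i => latPt (v i)) 0 P.numEdges) := by
  have hmem : ∀ i, ∃ p, P.vertex i = shPt p := by
    intro i
    obtain ⟨a, b, c, h⟩ := P.vertex_mem i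
    exact ⟨(a, b, c), h⟩
  choose p hp using hmem
  refine ⟨fun i => p i, ⟨P.three_le, fun i => by simp, fun i j hij => ?_, fun i => ?_⟩, ?_⟩
  · refine (ZMod.natCast_eq_natCast_iff _ _ _).1 (P.vertex_injective ?_)
    rw [hp, hp, hij]
  · refine latAdj_of_dist_shPt ?_
    rw [← hp, ← hp]
    push_cast
    exact P.dist_eq_one _
  · rw [P.carrier_eq_polyPath]
    simp only [hp]
    exact ambientIsotopic_shPt (fun i => p i) _ _

theorem IsKnot.of_ambientIsotopic {A B : Set Space} (hA : IsKnot A) (h : AmbientIsotopic A B) :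
    IsKnot B := by
  obtain ⟨f, hf, rfl⟩ := hA
  obtain ⟨H, -, -, rfl⟩ := h
  exact ⟨H 1 ∘ f, (H 1).isEmbedding.comp hf, range_comp _ _⟩

theorem KnotType.Contains.of_ambientIsotopic {K : KnotType} {A B : Set Space} (hA : K.Contains A)
    (h : AmbientIsotopic A B) : K.Contains B := by
  obtain ⟨hk, rfl⟩ := hA
  exact ⟨hk.of_ambientIsotopic h, Quotient.sound h.symm⟩

theorem KnotType.Contains.eq_unknot {K : KnotType} {A : Set Space} (hA : K.Contains A)
    (h : AmbientIsotopic A roundCircle) : K = KnotType.unknot := by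
  obtain ⟨hk, rfl⟩ := hA
  exact Quotient.sound h

theorem LatticePolygon.three_mul_edgeLength_le {K : KnotType} (hK : K ≠ KnotType.unknot)
    (P : LatticePolygon shLattice) (hP : K.Contains P.carrier) :
    3 * K.edgeLength cubicLattice + 30 ≤ 8 * (P.numEdges : ℕ∞) := by
  obtain ⟨v, hv, hiso⟩ := P.exists_isLatPolygon
  have hKv := hP.of_ambientIsotopic hiso
  obtain ⟨Q, hQ, hQiso⟩ := hv.exists_short fun hc => hK (hKv.eq_unknot hc)
  have hle : K.edgeLength cubicLattice ≤ Q.numEdges :=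
    iInf₂_le Q (hKv.of_ambientIsotopic hQiso)
  calc 3 * K.edgeLength cubicLattice + 30 ≤ 3 * (Q.numEdges : ℕ∞) + 30 := by gcongr
    _ ≤ _ := by exact_mod_cast hQ

end

theorem mainTheorem5 (K : KnotType) (hK : K ≠ KnotType.unknot) :
    (3 * (K.edgeLength cubicLattice : ℝ≥0∞) + 30) / 8 ≤ (K.edgeLength shLattice : ℝ≥0∞) := by
  -- With the infimum taken in `ℝ≥0∞`, the bound is checked for each polygon separately; the case
  -- without polygons is the empty infimum `⊤`.
  have h : (K.edgeLength shLattice : ℝ≥0∞) =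
      ⨅ (P : LatticePolygon shLattice) (_ : K.Contains P.carrier), ((P.numEdges : ℕ∞) : ℝ≥0∞) := by
    simp only [KnotType.edgeLength, ENat.toENNReal_iInf]
  rw [h]
  refine le_iInf₂ fun P hP => ENNReal.div_le_of_le_mul ?_
  rw [mul_comm _ (8 : ℝ≥0∞)]
  exact_mod_cast P.three_mul_edgeLength_le hK hP
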